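/- **Seeds and mutation.** Let $\mathbb{P}=\mathrm{Trop}(z_1,z_2,z_3)$ be the free abelian group (written multiplicatively) on $z_1,z_2,z_3$ with auxiliary addition $\prod_i z_i^{a_i}\oplus\prod_i z_i^{b_i}=\prod_i z_i^{\min(a_i,b_i)}$. Let $\mathbb{ZP}=\mathbb{Z}[z_1^{\pm1},z_2^{\pm1},z_3^{\pm1}]$ be its group ring, and put $\mathbb{ZP}_+=\mathbb{Z}[z_1,z_2,z_3]$. Let $\mathcal F$ be a field containing $\mathbb{ZP}$. A seed of rank $n$ in $\mathcal F$ is a triple $(\mathbf x,\mathbf y,B)$ where $\mathbf x=(x_1,\dots,x_n)$ freely generates $\mathcal F$ as a field over the fraction field of $\mathbb{ZP}$, $\mathbf y\in\mathbb{P}^n$, and $B$ is a skew-symmetrizable integer $n\times n$ matrix. With $[a]_+=\max(a,0)$, mutation in direction $k$ replaces $x_k$ by $$x_k'=\frac{y_k\prod_j x_j^{[B_{jk}]_+}+\prod_j x_j^{[-B_{jk}]_+}}{(y_k\oplus 1)\,x_k},$$ replaces $y_k$ by $y_k^{-1}$ and $y_i$ by $y_i\,y_k^{[B_{ki}]_+}(y_k\oplus1)^{-B_{ki}}$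 for $i\ne k$, and replaces $B_{ij}$ by $-B_{ij}$ if $i=k$ or $j=k$, and by $B_{ij}+\tfrac12(|B_{ik}|B_{kj}+B_{ik}|B_{kj}|)$ otherwise. Two seeds are mutation equivalent if one is obtained from the other by a finite sequence of mutations, up to permuting the indices. **Cluster algebra and upper cluster algebra.** For a subring $\mathbb A\subseteq\mathbb{ZP}$ and a seed, the cluster algebra $\mathcal A_{\mathbb A}$ is the $\mathbb A$-subalgebra of $\mathcal F$ generated by the entries of the clusters of all mutation equivalent seeds. The upper cluster algebra $\mathcal U_{\mathbb A}$ is the intersection, over all mutation equivalent seeds $(\mathbf x',\mathbf y',B')$, of the rings $\mathbb A[x_1'^{\pm1},\dots,x_n'^{\pm1}]\subseteq\mathcal F$. **The Cremmer–Gervais seed on $\mathrm{Mat}_3$.** Let $Q(CG,3)$ be the quiver with mutable vertices $1,\dots,6$, frozen vertices $z_1,z_2,z_3$, and the following arrows, each of multiplicity one: $$2\to1,\;1\to6,\;2\to3,\;2\to4,\;3\to4,\;3\to5,\;4\to5,\;4\to6,\;5\to2,\;5\to6,\;6\to3,$$ $$1\to z_1,\;z_1\to2,\;3\to z_1,\;4\to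 z_2,\;z_2\to3,\;6\to z_3,\;z_3\to1.$$ It gives the seed of rank $6$ whose cluster is any $\mathbf x=(x_1,\dots,x_6)$ freely generating $\mathcal F$ over the fraction field of $\mathbb{ZP}$, where $B_{ji}$ is the number of arrows $i\to j$ minus the number of arrows $j\to i$, and the exponent of $z_j$ in $y_i$ is the number of arrows $i\to z_j$ minus the number of arrows $z_j\to i$. Write $\mathcal A_{\mathbb A}(CG,3)$ and $\mathcal U_{\mathbb A}(CG,3)$ for the resulting algebras. **Proposition.** Over $\mathbb{ZP}$ there is equality $$\mathcal A_{\mathbb{ZP}}(CG,3)=\mathcal U_{\mathbb{ZP}}(CG,3),$$ but over $\mathbb{ZP}_+$ the containment is strict: $$\mathcal A_{\mathbb{ZP}_+}(CG,3)\subsetneq\mathcal U_{\mathbb{ZP}_+}(CG,3).$$ -/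

import Mathlib

noncomputable section

namespace ClusterAlgebra

/-- A semifield structure on a multiplicatively written abelian group `P`: an auxiliary addition
that is commutative, associative and distributed over by the multiplication.
(Such a group is automatically torsion free.) -/
class SemifieldAdd (P : Type*) [CommGroup P] where
  oplus : P → P → P
  oplus_comm : ∀ a b, oplus a b = oplus b a
  oplus_assoc : ∀ a b c, oplus (oplus a b) c = oplus a (oplus b c)
  mul_oplus : ∀ a b c, a * oplus b c = oplus (a * b) (a * c)

/-- The integral group ring `ℤP`. -/
abbrev ZP (P : Type*) [CommGroup P] : Type _ := MonoidAlgebra ℤ P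

/-- An element of `P` viewed in a field `F` that contains `ℤP`. -/
def coeff (F : Type*) {P : Type*} [CommGroup P] [Field F] [Algebra (ZP P) F] (p : P) : F :=
  algebraMap (ZP P) F (MonoidAlgebra.of ℤ P p)

/-- The fraction field of `ℤP` inside a field `F` that contains `ℤP`. -/
def fracZP (P F : Type*) [CommGroup P] [Field F] [Algebra (ZP P) F] : Subfield F :=
  Subfield.closure (Set.range (algebraMap (ZP P) F))

/-- The data `(x, y, B)` of a labelled seed of rank `n`; the conditions on the data are
collected in `Seed.IsSeed`. -/
structure Seed (n : ℕ) (P F : Type*) where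
  /-- the cluster -/
  x : Fin n → F
  /-- the coefficients -/
  y : Fin n → P
  /-- the exchange matrix -/
  B : Matrix (Fin n) (Fin n) ℤ

namespace Seed

variable {n : ℕ} {P F : Type*}

/-- The conditions on a seed: the cluster freely generates the field `F` over the fraction field
of `ℤP`, and the exchange matrix is skew-symmetrizable. -/
structure IsSeed [CommGroup P] [Field F] [Algebra (ZP P) F] (s : Seed n P F) : Prop where
  algebraicIndependent : AlgebraicIndependent (fracZP P F) s.x
  adjoin_eq_top : IntermediateField.adjoin (fracZP P F) (Set.range s.x) = ⊤
  skewSymmetrizable :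
    ∃ d : Fin n → ℤ, (∀ i, 0 < d i) ∧ ∀ i j, d i * s.B i j = -(d j * s.B j i)

/-- The new cluster variable obtained by mutation in direction `k`.
Here `(a.toNat)` is the positive part `[a]₊` of an integer `a`. -/
def newVar [CommGroup P] [SemifieldAdd P] [Field F] [Algebra (ZP P) F]
    (s : Seed n P F) (k : Fin n) : F :=
  (coeff F (s.y k) * ∏ j, s.x j ^ (s.B j k).toNat + ∏ j, s.x j ^ (-s.B j k).toNat) /
    (coeff F (SemifieldAdd.oplus (s.y k) 1) * s.x k)

/-- Mutation of a seed in direction `k`. The division by `2` is exact. -/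
def mutate [CommGroup P] [SemifieldAdd P] [Field F] [Algebra (ZP P) F]
    (s : Seed n P F) (k : Fin n) : Seed n P F where
  x := Function.update s.x k (s.newVar k)
  y := fun i =>
    if i = k then (s.y k)⁻¹
    else s.y i * s.y k ^ (s.B k i).toNat * SemifieldAdd.oplus (s.y k) 1 ^ (-s.B k i)
  B := fun i j =>
    if i = k ∨ j = k then -s.B i j
    else s.B i j + (|s.B i k| * s.B k j + s.B i k * |s.B k j|) / 2

/-- Permuting the indices of a seed. -/
def relabel (s : Seed n P F) (σ : Equiv.Perm (Fin n)) : Seed n P F where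
  x := s.x ∘ σ
  y := s.y ∘ σ
  B := s.B.submatrix σ σ

/-- `t` is mutation equivalent to `s`: it is obtained from `s` by a finite sequence of mutations,
up to permuting the indices. -/
def MutEquiv [CommGroup P] [SemifieldAdd P] [Field F] [Algebra (ZP P) F]
    (s t : Seed n P F) : Prop :=
  ∃ (l : List (Fin n)) (σ : Equiv.Perm (Fin n)), t = (l.foldl mutate s).relabel σ

variable [CommGroup P] [SemifieldAdd P] [Field F] [Algebra (ZP P) F]

/-- The cluster variables: the elements of all clusters of seeds mutation equivalent to `s`. -/
def clusterVariables (s : Seed n P F) : Set F :=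
  {v | ∃ t : Seed n P F, s.MutEquiv t ∧ v ∈ Set.range t.x}

/-- The cluster algebra over the ground ring `A ⊆ ℤP`: the `A`-subalgebra of `F` generated by
all cluster variables. -/
def clusterAlgebra (A : Subring (ZP P)) (s : Seed n P F) : Subalgebra A F :=
  Algebra.adjoin A s.clusterVariables

/-- The ring `A[x₁^{±1}, …, xₙ^{±1}]` of Laurent polynomials in the cluster of the seed,
inside `F`. -/
def laurentRing (A : Subring (ZP P)) (s : Seed n P F) : Subalgebra A F :=
  Algebra.adjoin A (Set.range s.x ∪ Set.range fun i => (s.x i)⁻¹)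

/-- The upper cluster algebra over the ground ring `A ⊆ ℤP`: the intersection of the Laurent
polynomial rings of all seeds mutation equivalent to `s`. -/
def upperClusterAlgebra (A : Subring (ZP P)) (s : Seed n P F) : Subalgebra A F :=
  ⨅ t : {t : Seed n P F // s.MutEquiv t}, laurentRing A t.1

end Seed

/-- The tropical semifield `Trop(z₁, …, zₘ)`, an element being recorded by its exponents. -/
abbrev Trop (m : ℕ) : Type := Multiplicative (Fin m → ℤ)

instance Trop.instSemifieldAdd (m : ℕ) : SemifieldAdd (Trop m) where
  oplus a b := Multiplicative.ofAdd (fun i => min (a.toAdd i) (b.toAdd i))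
  oplus_comm a b := by
    apply Multiplicative.toAdd.injective
    funext i
    exact min_comm _ _
  oplus_assoc a b c := by
    apply Multiplicative.toAdd.injective
    funext i
    exact min_assoc _ _ _
  mul_oplus a b c := by
    apply Multiplicative.toAdd.injective
    funext i
    exact (min_add_add_left (a.toAdd i) (b.toAdd i) (c.toAdd i)).symm

/-- The polynomial ground ring `ℤP₊ = ℤ[z₁, …, zₘ]` inside
`ℤP = ℤ[z₁^{±1}, …, zₘ^{±1}]`. -/
def ZPplus (m : ℕ) : Subring (ZP (Trop m)) :=
  Subring.closure
    (Set.range fun i : Fin m => MonoidAlgebra.of ℤ (Trop m) (Multiplicative.ofAdd (Pi.single i 1)))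

/-- A quiver with mutable vertices `Fin n` and frozen vertices `Fin m`: `arrows u v` is the number
of arrows `u → v`; no loops, no directed 2-cycles, no arrows between frozen vertices. -/
structure IceQuiver (n m : ℕ) where
  arrows : Fin n ⊕ Fin m → Fin n ⊕ Fin m → ℕ
  no_loop : ∀ u, arrows u u = 0
  no_two_cycle : ∀ u v, arrows u v = 0 ∨ arrows v u = 0
  no_frozen : ∀ i j, arrows (Sum.inr i) (Sum.inr j) = 0

/-- The seed over `Trop(z₁, …, zₘ)` with cluster `x` given by a quiver: `B j i` is the signed
number of arrows `i → j` between mutable vertices, and the exponent of `z_j` in `y i` is the signed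
number of arrows from the mutable vertex `i` to the frozen vertex `j`. -/
def IceQuiver.seed {n m : ℕ} {F : Type*} (Q : IceQuiver n m) (x : Fin n → F) :
    Seed n (Trop m) F where
  x := x
  y := fun i => Multiplicative.ofAdd fun j =>
    (Q.arrows (Sum.inl i) (Sum.inr j) : ℤ) - Q.arrows (Sum.inr j) (Sum.inl i)
  B := fun j i =>
    (Q.arrows (Sum.inl i) (Sum.inl j) : ℤ) - Q.arrows (Sum.inl j) (Sum.inl i)

/-- The arrows of the Cremmer–Gervais quiver `Q(CG,3)`, all simple. In terms of the positions in
the drawing of the quiver on the grid points `(column, row)`, the mutable vertices `0, …, 5` are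
`(1,1), (2,1), (2,2), (2,3), (3,1), (3,2)` and the frozen vertices `0, 1, 2` are
`(1,2), (1,3), (3,3)`. -/
def cremmerGervaisArrows : Finset ((Fin 6 ⊕ Fin 3) × (Fin 6 ⊕ Fin 3)) :=
  { -- arrows between mutable vertices
    (.inl 1, .inl 0), (.inl 0, .inl 5), (.inl 1, .inl 2), (.inl 1, .inl 3), (.inl 2, .inl 3),
    (.inl 2, .inl 4), (.inl 3, .inl 4), (.inl 3, .inl 5), (.inl 4, .inl 1), (.inl 4, .inl 5),
    (.inl 5, .inl 2),
    -- arrows between mutable and frozen vertices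
    (.inl 0, .inr 0), (.inr 0, .inl 1), (.inl 2, .inr 0), (.inl 3, .inr 1), (.inr 1, .inl 2),
    (.inl 5, .inr 2), (.inr 2, .inl 0) }

/-- The Cremmer–Gervais quiver `Q(CG,3)`. -/
def cremmerGervaisQuiver : IceQuiver 6 3 where
  arrows u v := if (u, v) ∈ cremmerGervaisArrows then 1 else 0
  no_loop := by decide
  no_two_cycle := by decide
  no_frozen := by decide

/-- The seed of the Cremmer–Gervais cluster structure on `3 × 3` matrices, with cluster `x`. -/
def cremmerGervaisSeed {F : Type*} (x : Fin 6 → F) : Seed 6 (Trop 3) F :=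
  cremmerGervaisQuiver.seed x

end ClusterAlgebra

end

/-! The coefficients `y` become the frozen rows of an extended exchange matrix (`Seed.toExt`), and
the whole question moves into one polynomial ring. The extended cluster consists of explicit
polynomials `coord v` in nine algebraically independent elements `v = (p, q, r, p', q', r', f, g,
h)`, and the upper cluster algebra over `ZPplus 3` turns out to be exactly `ℤ[v]`.

This rests on two facts. A nondegenerate compatible form makes the upper bound (Laurent in a seed
and in its neighbours) invariant under mutation, by `ExtSeed.mem_laurent_mutate_mutate`; hence the
upper cluster algebra over `ZPplus` is the upper bound of the initial seed and contains all cluster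
variables. The upper bound is contained in `ℤ[v]` by a check at each prime
(`ExtSeed.upperBound_le_range`) and contains every coordinate (`ExtSeed.coordinate_mem_upperBound`).

Over `ZP`, six coordinates are cluster variables up to sign, while `f`, `g`, `h` become polynomials
in cluster variables and other coordinates after multiplication by a frozen variable. Inverting the
frozen variables gives equality (`coordinate_mem_clusterAlgebra_top`).

Over `ZPplus`, the element `g = v 7` is missing. There is a positive grading for which all cluster
and frozen variables are homogeneous and `g` is the only monomial of its weight. A homogeneous
generator containing the linear term `g` must therefore be an integer multiple `n g`, and
polynomials without that term form a subring. To exclude a cluster variable `n g`, a skew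
biderivation is used for which every cluster is log-canonical. For a cluster variable `x`, the
derivation `{x, ·}` is nilpotent modulo `x` on every element of `ℤ[v]`, up to a monomial in the
other variables. For `x = n g`, however, its square acts on `f` modulo `x` as multiplication by the
constant `4 n² r r'`, which forces `g` to divide `(4 n² r r')^M f`; this is absurd
(`ExtSeed.IsCanonical.ne_C_mul_X`). -/

namespace ClusterAlgebra

open MvPolynomial

/-! ### Exchange binomials and derivations acting diagonally on variables. -/

section Binomials

variable {ι : Type*} [Fintype ι] {R S : Type*} [CommRing R] [CommRing S]

/-- The monomial `∏ i, X i ^ [u i]₊`. -/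
def posMonomial (X : ι → R) (u : ι → ℤ) : R := ∏ i, X i ^ (u i).toNat

/-- The exchange binomial `∏ i, X i ^ [u i]₊ + ∏ i, X i ^ [-u i]₊`. -/
def binomial (X : ι → R) (u : ι → ℤ) : R := posMonomial X u + posMonomial X (-u)

lemma binomial_neg (X : ι → R) (u : ι → ℤ) : binomial X (-u) = binomial X u := by
  simp [binomial, add_comm]

lemma posMonomial_congr {X Y : ι → R} {u v : ι → ℤ} (h : ∀ i, X i ^ (u i).toNat = Y i ^ (v i).toNat) :
    posMonomial X u = posMonomial Y v := Finset.prod_congr rfl fun i _ => h i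

lemma posMonomial_update [DecidableEq ι] (X : ι → R) (u : ι → ℤ) (k : ι) (a : R) (hk : u k = 0) :
    posMonomial (Function.update X k a) u = posMonomial X u := by
  refine posMonomial_congr fun i => ?_
  rcases eq_or_ne i k with rfl | h
  · simp [hk]
  · simp [h]

lemma binomial_update [DecidableEq ι] (X : ι → R) (u : ι → ℤ) (k : ι) (a : R) (hk : u k = 0) :
    binomial (Function.update X k a) u = binomial X u := by
  rw [binomial, posMonomial_update _ _ _ _ hk, posMonomial_update _ _ _ _ (by simp [hk]), binomial]

lemma map_posMonomial {G : Type*} [FunLike G R S] [RingHomClass G R S] (f : G) (X : ι → R)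
    (u : ι → ℤ) : f (posMonomial X u) = posMonomial (fun i => f (X i)) u := by
  simp [posMonomial, map_prod]

lemma map_binomial {G : Type*} [FunLike G R S] [RingHomClass G R S] (f : G) (X : ι → R)
    (u : ι → ℤ) : f (binomial X u) = binomial (fun i => f (X i)) u := by
  simp [binomial, map_posMonomial]

lemma posMonomial_mem {T : Type*} [SetLike T R] [SubringClass T R] (s : T) (X : ι → R) (u : ι → ℤ)
    (h : ∀ i, u i ≠ 0 → X i ∈ s) : posMonomial X u ∈ s := by
  refine prod_mem fun i _ => ?_
  rcases eq_or_ne (u i) 0 with h0 | h0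
  · simp [h0, one_mem]
  · exact pow_mem (h i h0) _

lemma binomial_mem {T : Type*} [SetLike T R] [SubringClass T R] (s : T) (X : ι → R) (u : ι → ℤ)
    (h : ∀ i, u i ≠ 0 → X i ∈ s) : binomial X u ∈ s :=
  add_mem (posMonomial_mem s X u h) (posMonomial_mem s X (-u) fun i hi => h i (by simpa using hi))

lemma posMonomial_indicator [DecidableEq ι] (i : ι) (v : ι → ℤ) :
    posMonomial (fun j : ι => if j = i then (0 : ℤ) else 1) v = 0 ^ (v i).toNat := by
  rw [posMonomial, Finset.prod_eq_single i]
  · simp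
  · intro b _ hb; simp [hb]
  · simp

lemma binomial_indicator [DecidableEq ι] {i : ι} {u : ι → ℤ} (hi : u i ≠ 0) :
    binomial (fun j : ι => if j = i then (0 : ℤ) else 1) u = 1 := by
  rw [binomial, posMonomial_indicator, posMonomial_indicator, Pi.neg_apply]
  rcases lt_or_gt_of_ne hi with h0 | h0
  · rw [Int.toNat_of_nonpos h0.le, zero_pow (n := (-u i).toNat) (by omega)]; simp
  · rw [zero_pow (by omega), Int.toNat_of_nonpos (by omega)]; simp

/-- At most one of the two monomials involves `X i`, so putting `X i = 0` and all other variables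
equal to `1` gives `1` or `2`, never `0`. -/
lemma not_X_dvd_binomial [DecidableEq ι] (u : ι → ℤ) (i : ι) :
    ¬ (X i : MvPolynomial ι ℤ) ∣ binomial X u := by
  intro h
  have h2 := map_dvd (aeval (fun j : ι => if j = i then (0 : ℤ) else 1)) h
  rw [map_binomial] at h2
  simp only [aeval_X, if_true, zero_dvd_iff] at h2
  rcases eq_or_ne (u i) 0 with h0 | h0
  · simp [binomial, posMonomial_indicator, h0] at h2
  · rw [binomial_indicator h0] at h2
    exact one_ne_zero h2

lemma exists_X_dvd_of_dvd_posMonomial {π : MvPolynomial ι ℤ} (hπ : Prime π) {u : ι → ℤ}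
    (h : π ∣ posMonomial X u) : ∃ i, u i ≠ 0 ∧ (X i : MvPolynomial ι ℤ) ∣ π ∧ π ∣ X i := by
  obtain ⟨i, -, hi⟩ := (hπ.dvd_finsetProd_iff _).1 h
  have hi0 : u i ≠ 0 := by
    rintro h0
    simp only [h0, Int.toNat_zero, pow_zero] at hi
    exact hπ.not_isUnit (isUnit_of_dvd_one hi)
  have h1 := hπ.dvd_of_dvd_pow hi
  exact ⟨i, hi0, ((hπ.associated_of_dvd X_prime h1).symm.dvd) , h1⟩

lemma not_dvd_posMonomial_of_dvd_binomial [DecidableEq ι] {π : MvPolynomial ι ℤ} (hπ : Prime π)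
    {u : ι → ℤ} (h : π ∣ binomial X u) (v : ι → ℤ) : ¬ π ∣ posMonomial X v := by
  intro h2
  obtain ⟨i, -, hi, -⟩ := exists_X_dvd_of_dvd_posMonomial hπ h2
  exact not_X_dvd_binomial u i (hi.trans h)

lemma binomial_ne_zero [DecidableEq ι] [Nonempty ι] (u : ι → ℤ) :
    (binomial X u : MvPolynomial ι ℤ) ≠ 0 := by
  intro h
  exact not_X_dvd_binomial u (Classical.arbitrary ι) (h ▸ dvd_zero _)

/-- A derivation acting diagonally on `X` acts diagonally on monomials. -/
lemma derivation_posMonomial {A : Type*} [CommRing A] [Algebra A R] (δ : Derivation A R R) (Y : ι → R) (w : ι → ℤ)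
    (m : R) (h : ∀ i, δ (Y i) = (w i : R) * (m * Y i)) (u : ι → ℤ) :
    δ (posMonomial Y u) = ((∑ i, ((u i).toNat : ℤ) * w i : ℤ) : R) * (m * posMonomial Y u) := by
  classical
  have key : ∀ s : Finset ι, δ (∏ i ∈ s, Y i ^ (u i).toNat) =
      ((∑ i ∈ s, ((u i).toNat : ℤ) * w i : ℤ) : R) * (m * ∏ i ∈ s, Y i ^ (u i).toNat) := by
    intro s
    induction s using Finset.induction_on with
    | empty => simp
    | insert a s ha ih =>
      rw [Finset.prod_insert ha, Finset.sum_insert ha, Derivation.leibniz, ih,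
        Derivation.leibniz_pow, h]
      rcases Nat.eq_zero_or_pos (u a).toNat with h0 | h0
      · simp [h0]
      · obtain ⟨n, hn⟩ : ∃ n, (u a).toNat = n + 1 := ⟨_, (Nat.succ_pred_eq_of_pos h0).symm⟩
        rw [hn]
        simp only [smul_eq_mul, nsmul_eq_mul, Nat.add_sub_cancel]
        push_cast
        ring
  exact key Finset.univ

lemma toNat_sub_toNat_neg' (a : ℤ) : (a.toNat : ℤ) = a + ((-a).toNat : ℤ) := by omega

lemma sum_toNat_mul (u w : ι → ℤ) : ∑ i, ((u i).toNat : ℤ) * w i =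
    ∑ i, u i * w i + ∑ i, (((-u) i).toNat : ℤ) * w i := by
  rw [← Finset.sum_add_distrib]
  refine Finset.sum_congr rfl fun i _ => ?_
  rw [toNat_sub_toNat_neg' (u i), add_mul, Pi.neg_apply]

end Binomials

/-! ### Coprimality of exchange binomials. -/

section Coprime

variable {ι : Type*} [Fintype ι] [DecidableEq ι]

/-- Write `p = π ^ n * c` with `π ∤ c`. Modulo `π ^ n` the derivative of `p` is `n π ^ (n - 1) c δ
π`, and neither `n` nor `c` can absorb the missing factor `π`. -/
lemma prime_dvd_derivation {A R : Type*} [CommRing A] [CommRing R] [Algebra A R] [IsDomain R]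
    [WfDvdMonoid R] (δ : Derivation A R R) {p π : R} (hp : p ≠ 0) (hπ : Prime π) (h : π ∣ p)
    (hδ : p ∣ δ p) (hchar : ∀ n : ℕ, 0 < n → ¬ π ∣ (n : R)) : π ∣ δ π := by
  obtain ⟨n, c, hc, hpc⟩ := WfDvdMonoid.max_power_factor hp hπ.irreducible
  have hn : n ≠ 0 := by
    rintro rfl
    exact hc (by simpa [hpc] using h)
  obtain ⟨m, rfl⟩ := Nat.exists_eq_succ_of_ne_zero hn
  have h1 : π ^ (m + 1) ∣ δ p := (Dvd.intro _ hpc.symm).trans hδ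
  rw [hpc, Derivation.leibniz, Derivation.leibniz_pow] at h1
  simp only [smul_eq_mul, nsmul_eq_mul, Nat.succ_eq_add_one, Nat.add_sub_cancel] at h1
  have h2 : π ^ (m + 1) ∣ π ^ m * ((((m + 1 : ℕ) : R) * c) * δ π) := by
    have := (dvd_add_right (Dvd.intro (δ c) rfl : π ^ (m + 1) ∣ π ^ (m+1) * δ c)).1 h1
    refine this.trans (dvd_of_eq ?_)
    ring
  rw [pow_succ, mul_dvd_mul_iff_left (pow_ne_zero _ hπ.ne_zero)] at h2
  rcases hπ.dvd_or_dvd h2 with h3 | h3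
  · rcases hπ.dvd_or_dvd h3 with h4 | h4
    · exact absurd h4 (hchar _ (Nat.succ_pos _))
    · exact absurd h4 hc
  · exact h3

/-- Exchange binomials separated by a grading have no common prime factor. -/
lemma not_dvd_binomial_of_dvd_binomial {π : MvPolynomial ι ℤ} (hπ : Prime π) {u v w : ι → ℤ}
    (hu : ∑ i, u i * w i = 0) (hv : ∑ i, v i * w i ≠ 0) (h : π ∣ binomial X u) :
    ¬ π ∣ binomial X v := by
  intro hπv
  obtain ⟨i, hi⟩ : ∃ i, v i ≠ 0 := by
    by_contra! h0
    exact hv (by simp [h0])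
  have : Nonempty ι := ⟨i⟩
  let δ : Derivation ℤ (MvPolynomial ι ℤ) (MvPolynomial ι ℤ) :=
    mkDerivation ℤ fun i => (w i : MvPolynomial ι ℤ) * X i
  have hmon : ∀ u : ι → ℤ, δ (posMonomial X u) =
      ((∑ i, ((u i).toNat : ℤ) * w i : ℤ) : MvPolynomial ι ℤ) * posMonomial X u := fun u => by
    have h1 := derivation_posMonomial δ X w 1 (fun i => by
      rw [one_mul]; exact mkDerivation_X _ _ _) u
    rwa [one_mul] at h1
  -- A divisor of a nonzero integer is constant, hence unchanged by evaluation. At the 0/1 point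
  -- attached to an `i` with `v i ≠ 0` the binomial of `v` takes the value `1`, so `π` would be a
  -- unit.
  have hconst : ∀ n : ℤ, n ≠ 0 → ¬ π ∣ (n : MvPolynomial ι ℤ) := by
    rintro n hn ⟨c, hc⟩
    have hdeg : π.totalDegree = 0 := by
      have h0 : c ≠ 0 := by
        rintro rfl
        simp [hn] at hc
      have := congrArg totalDegree hc
      rw [totalDegree_mul_of_isDomain hπ.ne_zero h0] at this
      have h1 : (n : MvPolynomial ι ℤ).totalDegree = 0 := by
        rw [← eq_intCast (C : ℤ →+* MvPolynomial ι ℤ)]; exact totalDegree_C n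
      omega
    rw [totalDegree_eq_zero_iff_eq_C] at hdeg
    have h2 := map_dvd (aeval (fun j : ι => if j = i then (0 : ℤ) else 1)) hπv
    rw [map_binomial, hdeg] at h2
    simp only [aeval_X, aeval_C, binomial_indicator hi] at h2
    apply hπ.not_isUnit
    rw [hdeg]
    exact (isUnit_of_dvd_one h2).map C
  have hδu : binomial X u ∣ δ (binomial X u) := by
    have h0 := sum_toNat_mul u w
    rw [hu, zero_add] at h0
    rw [binomial, map_add, hmon, hmon, h0, ← mul_add]
    exact Dvd.intro_left _ rfl
  have hδπ : π ∣ δ π := prime_dvd_derivation δ (binomial_ne_zero u) hπ h hδu fun n hn => by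
    have := hconst n (by exact_mod_cast hn.ne')
    exact_mod_cast this
  have hδv : π ∣ δ (binomial X v) := by
    obtain ⟨c, hc⟩ := hπv
    rw [hc, Derivation.leibniz]
    exact dvd_add (Dvd.intro _ rfl) (hδπ.trans (Dvd.intro_left c rfl))
  have h0 := sum_toNat_mul v w
  rw [binomial, map_add, hmon, hmon, h0] at hδv
  -- The two monomials of the second binomial have weights differing by `∑ v i * w i`. Subtracting a
  -- multiple of the binomial leaves this difference times a single monomial.
  have h3 : π ∣ ((∑ i, v i * w i : ℤ) : MvPolynomial ι ℤ) * posMonomial X v := by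
    have h4 := dvd_sub hδv (Dvd.dvd.mul_left hπv
      (((∑ i, (((-v) i).toNat : ℤ) * w i : ℤ) : ℤ) : MvPolynomial ι ℤ))
    refine h4.trans (dvd_of_eq ?_)
    rw [binomial]
    push_cast
    ring
  rcases hπ.dvd_or_dvd h3 with h4 | h4
  · exact hconst _ hv h4
  · exact not_dvd_posMonomial_of_dvd_binomial hπ hπv v h4

end Coprime

/-! ### Localization at a prime, inside the field. -/

section LocalSubring

variable {R F : Type*} [CommRing R] [Field F] (e : R →+* F) {π : R} (hπ : Prime π)

/-- The elements of `F` that are fractions of elements of `R` with denominator prime to `π`. -/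
def localSubring (hπ : Prime π) : Subring F where
  carrier := {f | ∃ a d, ¬ π ∣ d ∧ f * e d = e a}
  zero_mem' := ⟨0, 1, fun h => hπ.not_isUnit (isUnit_of_dvd_one h), by simp⟩
  one_mem' := ⟨1, 1, fun h => hπ.not_isUnit (isUnit_of_dvd_one h), by simp⟩
  add_mem' := by
    rintro f g ⟨a, d, hd, hf⟩ ⟨a', d', hd', hg⟩
    refine ⟨a * d' + a' * d, d * d', hπ.not_dvd_mul hd hd', ?_⟩
    simp only [map_mul, map_add, ← hf, ← hg]
    ring
  mul_mem' := by
    rintro f g ⟨a, d, hd, hf⟩ ⟨a', d', hd', hg⟩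
    refine ⟨a * a', d * d', hπ.not_dvd_mul hd hd', ?_⟩
    simp only [map_mul, ← hf, ← hg]
    ring
  neg_mem' := by
    rintro f ⟨a, d, hd, hf⟩
    exact ⟨-a, d, hd, by rw [map_neg, ← hf, neg_mul]⟩

/-- The elements of the maximal ideal of the local ring at `π`. -/
def IsNonunitAt (π : R) (f : F) : Prop := ∃ a d, π ∣ a ∧ ¬ π ∣ d ∧ f * e d = e a

/-- The units of the local ring at `π`. -/
def IsUnitAt (π : R) (f : F) : Prop := ∃ a d, ¬ π ∣ a ∧ ¬ π ∣ d ∧ f * e d = e a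

variable {e}

lemma map_mem_localSubring (a : R) : e a ∈ localSubring e hπ :=
  ⟨a, 1, fun h => hπ.not_isUnit (isUnit_of_dvd_one h), by simp⟩

lemma isUnitAt_map {a : R} (h : ¬ π ∣ a) (hπ : Prime π) : IsUnitAt e π (e a) :=
  ⟨a, 1, h, fun h => hπ.not_isUnit (isUnit_of_dvd_one h), by simp⟩

lemma isNonunitAt_map {a : R} (h : π ∣ a) (hπ : Prime π) : IsNonunitAt e π (e a) :=
  ⟨a, 1, h, fun h => hπ.not_isUnit (isUnit_of_dvd_one h), by simp⟩

lemma IsUnitAt.mem {f : F} (h : IsUnitAt e π f) : f ∈ localSubring e hπ := by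
  obtain ⟨a, d, -, hd, hf⟩ := h
  exact ⟨a, d, hd, hf⟩

lemma IsNonunitAt.mem {f : F} (h : IsNonunitAt e π f) : f ∈ localSubring e hπ := by
  obtain ⟨a, d, -, hd, hf⟩ := h
  exact ⟨a, d, hd, hf⟩

lemma IsUnitAt.ne_zero (he : Function.Injective e) {f : F} (h : IsUnitAt e π f) : f ≠ 0 := by
  rintro rfl
  obtain ⟨a, d, ha, hd, hf⟩ := h
  rw [zero_mul] at hf
  exact ha ((he (hf.symm.trans (map_zero e).symm)) ▸ dvd_zero _)

lemma IsUnitAt.inv (he : Function.Injective e) {f : F} (h : IsUnitAt e π f) :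
    IsUnitAt e π f⁻¹ := by
  have h0 := h.ne_zero he
  obtain ⟨a, d, ha, hd, hf⟩ := h
  exact ⟨d, a, hd, ha, by rw [← hf]; field_simp⟩

lemma IsUnitAt.mul (hπ : Prime π) {f g : F} (hf : IsUnitAt e π f) (hg : IsUnitAt e π g) :
    IsUnitAt e π (f * g) := by
  obtain ⟨a, d, ha, hd, hf⟩ := hf
  obtain ⟨a', d', ha', hd', hg⟩ := hg
  refine ⟨a * a', d * d', hπ.not_dvd_mul ha ha', hπ.not_dvd_mul hd hd', ?_⟩
  simp only [map_mul, ← hf, ← hg]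
  ring

lemma IsUnitAt.div (he : Function.Injective e) (hπ : Prime π) {f g : F} (hf : IsUnitAt e π f)
    (hg : IsUnitAt e π g) : IsUnitAt e π (f / g) := by
  rw [div_eq_mul_inv]
  exact hf.mul hπ (hg.inv he)

lemma IsUnitAt.one (hπ : Prime π) : IsUnitAt e π 1 := by
  simpa using isUnitAt_map (e := e) (fun h => hπ.not_isUnit (isUnit_of_dvd_one h)) hπ

lemma IsUnitAt.pow (hπ : Prime π) {f : F} (hf : IsUnitAt e π f) (n : ℕ) :
    IsUnitAt e π (f ^ n) := by
  induction n with
  | zero => simpa using IsUnitAt.one hπ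
  | succ n ih => rw [pow_succ]; exact ih.mul hπ hf

lemma IsUnitAt.prod (hπ : Prime π) {ι : Type*} (s : Finset ι) (f : ι → F)
    (h : ∀ i ∈ s, IsUnitAt e π (f i)) : IsUnitAt e π (∏ i ∈ s, f i) := by
  classical
  induction s using Finset.induction_on with
  | empty => simpa using IsUnitAt.one hπ
  | insert a s ha ih =>
    rw [Finset.prod_insert ha]
    exact (h a (by simp)).mul hπ (ih fun i hi => h i (by simp [hi]))

lemma IsNonunitAt.mul (hπ : Prime π) {f g : F} (hf : IsNonunitAt e π f)
    (hg : g ∈ localSubring e hπ) : IsNonunitAt e π (f * g) := by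
  obtain ⟨a, d, ha, hd, hf⟩ := hf
  obtain ⟨a', d', hd', hg⟩ := hg
  refine ⟨a * a', d * d', ha.mul_right _, hπ.not_dvd_mul hd hd', ?_⟩
  simp only [map_mul, ← hf, ← hg]
  ring

lemma IsUnitAt.add (hπ : Prime π) {f g : F} (hf : IsUnitAt e π f) (hg : IsNonunitAt e π g) :
    IsUnitAt e π (f + g) := by
  obtain ⟨a, d, ha, hd, hf⟩ := hf
  obtain ⟨a', d', ha', hd', hg⟩ := hg
  refine ⟨a * d' + a' * d, d * d', fun h => ?_, hπ.not_dvd_mul hd hd', ?_⟩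
  · exact hπ.not_dvd_mul ha hd' ((dvd_add_left (ha'.mul_right _)).1 h)
  · simp only [map_mul, map_add, ← hf, ← hg]
    ring

lemma mem_localSubring_of_mul_mem (he : Function.Injective e) {f g : F} (hg : IsUnitAt e π g)
    (h : f * g ∈ localSubring e hπ) : f ∈ localSubring e hπ := by
  have := mul_mem h ((hg.inv he).mem hπ)
  rwa [mul_assoc, mul_inv_cancel₀ (hg.ne_zero he), mul_one] at this

lemma dvd_pow_of_forall_prime_dvd [IsDomain R] [UniqueFactorizationMonoid R] {b x : R} (hb : b ≠ 0)
    (h : ∀ π, Prime π → π ∣ b → π ∣ x) : ∃ N : ℕ, b ∣ x ^ N := by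
  induction b using UniqueFactorizationMonoid.induction_on_prime with
  | h₁ => exact absurd rfl hb
  | h₂ u hu => exact ⟨0, hu.dvd⟩
  | h₃ a p ha hp ih =>
    obtain ⟨N, hN⟩ := ih ha fun π hπ hd => h π hπ (hd.mul_left _)
    exact ⟨N + 1, by rw [pow_succ']; exact mul_dvd_mul (h p hp (Dvd.intro _ rfl)) hN⟩

/-- A fraction that is integral at all primes not dividing `x` becomes integral after
multiplication by a power of `x`. -/
lemma exists_mul_pow_eq [IsDomain R] [UniqueFactorizationMonoid R] (he : Function.Injective e)
    {f : F} {x : R} (hf : ∃ a d, d ≠ 0 ∧ f * e d = e a)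
    (h : ∀ π (hπ : Prime π), ¬ π ∣ x → f ∈ localSubring e hπ) :
    ∃ (N : ℕ) (a : R), f * e x ^ N = e a := by
  obtain ⟨a, d, hd, hfa⟩ := hf
  obtain ⟨d', a', c, hrel, rfl, rfl⟩ :=
    UniqueFactorizationMonoid.exists_reduced_factors d hd a
  have hc : c ≠ 0 := by rintro rfl; simp at hd
  have hec : e c ≠ 0 := by rwa [Ne, map_eq_zero_iff e he]
  have hf' : f * e d' = e a' := by
    apply mul_left_cancel₀ hec
    rw [← map_mul, ← hfa, map_mul]; ring
  have hd' : d' ≠ 0 := by rintro rfl; simp at hd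
  -- In lowest terms, a prime of the denominator at which `f` is integral would also divide the
  -- numerator. So all primes of the denominator divide `x`.
  obtain ⟨N, u, hu⟩ := dvd_pow_of_forall_prime_dvd (x := x) hd' fun π hπ hdvd => by
    by_contra hx
    obtain ⟨a₁, d₁, hd₁, h₁⟩ := h π hπ hx
    have h2 : a' * d₁ = a₁ * d' := by
      apply he
      rw [map_mul, map_mul, ← hf', ← h₁]; ring
    have h3 : π ∣ a' * d₁ := h2 ▸ hdvd.mul_left _
    have h4 := (hπ.dvd_or_dvd h3).resolve_right hd₁
    exact hπ.not_isUnit (hrel hdvd h4)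
  refine ⟨N, a' * u, ?_⟩
  rw [← map_pow, hu, map_mul, map_mul, ← mul_assoc, hf']

lemma exists_eq_of_forall_prime [IsDomain R] [UniqueFactorizationMonoid R]
    (he : Function.Injective e) {f : F} (hf : ∃ a d, d ≠ 0 ∧ f * e d = e a)
    (h : ∀ π (hπ : Prime π), f ∈ localSubring e hπ) : ∃ a : R, f = e a := by
  obtain ⟨N, a, ha⟩ := exists_mul_pow_eq he (x := 1) hf fun π hπ _ => h π hπ
  exact ⟨a, by simpa using ha⟩

end LocalSubring

/-! ### Geometric seeds, their mutation, and compatible forms. -/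

/-- A seed of geometric type, with mutable indices `κ` and frozen indices `φ`: an extended cluster
and an extended exchange matrix. -/
structure ExtSeed (κ φ F : Type*) where
  /-- the extended cluster -/
  x : κ ⊕ φ → F
  /-- the extended exchange matrix -/
  b : κ ⊕ φ → κ → ℤ

namespace ExtSeed

variable {κ φ : Type*} [Fintype κ] [Fintype φ] {F : Type*} [Field F]

/-- A column of the extended exchange matrix. -/
def col (t : ExtSeed κ φ F) (k : κ) : κ ⊕ φ → ℤ := fun i => t.b i k

/-- The variable replacing `x k` in the mutation in direction `k`. -/
def newVar (t : ExtSeed κ φ F) (k : κ) : F := binomial t.x (t.col k) / t.x (.inl k)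

/-- The transformation of an integer under matrix mutation. -/
def mutateEntry (a b c : ℤ) : ℤ := a + b.toNat * c.toNat - (-b).toNat * (-c).toNat

lemma mutateEntry_swap (a b c : ℤ) : mutateEntry (-a) b c = -mutateEntry a (-c) (-b) := by
  simp only [mutateEntry, neg_neg]; ring

lemma mutateEntry_mutateEntry (a b c : ℤ) : mutateEntry (mutateEntry a b c) (-b) (-c) = a := by
  simp only [mutateEntry, neg_neg]; ring

lemma mutateEntry_eq (a b c : ℤ) : a + (|b| * c + b * |c|) / 2 = mutateEntry a b c := by
  unfold mutateEntry
  rcases le_total 0 b with hb | hb <;> rcases le_total 0 c with hc | hc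
  · rw [abs_of_nonneg hb, abs_of_nonneg hc, Int.toNat_of_nonneg hb, Int.toNat_of_nonneg hc,
      Int.toNat_of_nonpos (neg_nonpos.2 hb)]
    have : b * c + b * c = 2 * (b * c) := by ring
    rw [this, Int.mul_ediv_cancel_left _ (by norm_num)]; simp
  · rw [abs_of_nonneg hb, abs_of_nonpos hc, Int.toNat_of_nonpos hc,
      Int.toNat_of_nonpos (neg_nonpos.2 hb)]
    simp
  · rw [abs_of_nonpos hb, abs_of_nonneg hc, Int.toNat_of_nonpos hb,
      Int.toNat_of_nonpos (neg_nonpos.2 hc)]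
    simp
  · rw [abs_of_nonpos hb, abs_of_nonpos hc, Int.toNat_of_nonpos hb,
      Int.toNat_of_nonneg (neg_nonneg.2 hb), Int.toNat_of_nonneg (neg_nonneg.2 hc)]
    have : -b * c + b * -c = 2 * (-(b * c)) := by ring
    rw [this, Int.mul_ediv_cancel_left _ (by norm_num)]; simp; ring

variable [DecidableEq κ] [DecidableEq φ]

/-- Mutation in direction `k`. -/
def mutate (t : ExtSeed κ φ F) (k : κ) : ExtSeed κ φ F where
  x := Function.update t.x (.inl k) (t.newVar k)
  b i j := if i = .inl k ∨ j = k then -t.b i j else mutateEntry (t.b i j) (t.b i k) (t.b (.inl k) j)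

/-- The mutable part of the exchange matrix is skew-symmetric. -/
def IsSkew (t : ExtSeed κ φ F) : Prop := ∀ i j, t.b (.inl i) j = -t.b (.inl j) i

/-- The skew-symmetric form `Λ` is compatible with the exchange matrix. -/
structure IsCompatible (t : ExtSeed κ φ F) (c : ℤ) (Λ : κ ⊕ φ → κ ⊕ φ → ℤ) : Prop where
  skew : ∀ i j, Λ i j = -Λ j i
  sum_eq : ∀ j l, ∑ i, t.b i j * Λ i l = if l = .inl j then c else 0

/-- Weights on the extended cluster, transformed by mutation. -/
def mutateWeight (t : ExtSeed κ φ F) (k : κ) (w : κ ⊕ φ → ℤ) : κ ⊕ φ → ℤ :=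
  Function.update w (.inl k) (-w (.inl k) + ∑ i, ((t.b i k).toNat : ℤ) * w i)

/-- Mutation of the compatible form. -/
def mutateForm (t : ExtSeed κ φ F) (k : κ) (Λ : κ ⊕ φ → κ ⊕ φ → ℤ) (i l : κ ⊕ φ) : ℤ :=
  if l = .inl k then
    t.mutateWeight k (fun i => -Λ i (.inl k) + ∑ m, ((t.b m k).toNat : ℤ) * Λ i m) i
  else t.mutateWeight k (fun i => Λ i l) i

variable {t : ExtSeed κ φ F}

omit [Fintype κ] [Fintype φ] [Field F] [DecidableEq κ] [DecidableEq φ] in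
lemma IsSkew.diag (h : t.IsSkew) (k : κ) : t.b (.inl k) k = 0 := by
  have := h k k; omega

lemma IsSkew.mutate (h : t.IsSkew) (k : κ) : (t.mutate k).IsSkew := by
  intro i j
  simp only [ExtSeed.mutate, Sum.inl.injEq]
  by_cases hi : i = k
  · simp [hi, h k j]
  · by_cases hj : j = k
    · simp [hj, h i k]
    · simp only [hi, hj, or_self, if_false]
      rw [h i j, mutateEntry_swap, ← h k i, h k j, neg_neg]

@[simp] lemma mutate_x_self (k : κ) : (t.mutate k).x (.inl k) = t.newVar k := by
  simp [ExtSeed.mutate]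

lemma mutate_x_of_ne {k : κ} {i : κ ⊕ φ} (h : i ≠ .inl k) : (t.mutate k).x i = t.x i := by
  simp [ExtSeed.mutate, h]

lemma mutate_col_self (k : κ) : (t.mutate k).col k = -t.col k := by
  funext i
  simp [ExtSeed.mutate, col]

lemma binomial_mutate (h : t.IsSkew) (k : κ) :
    binomial (t.mutate k).x ((t.mutate k).col k) = binomial t.x (t.col k) := by
  rw [mutate_col_self, binomial_neg]
  exact binomial_update _ _ _ _ (h.diag k)

lemma newVar_mutate (h : t.IsSkew) {k : κ} (hx : t.x (.inl k) ≠ 0) (hx' : t.newVar k ≠ 0) :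
    (t.mutate k).newVar k = t.x (.inl k) := by
  rw [newVar, binomial_mutate h k, mutate_x_self, newVar]
  have h0 : binomial t.x (t.col k) ≠ 0 := fun h0 => hx' (by simp [newVar, h0])
  field_simp

lemma mutate_mutate (h : t.IsSkew) {k : κ} (hx : t.x (.inl k) ≠ 0) (hx' : t.newVar k ≠ 0) :
    (t.mutate k).mutate k = t := by
  have h1 : ((t.mutate k).mutate k).x = t.x := by
    funext i
    by_cases hi : i = .inl k
    · subst hi; rw [mutate_x_self, newVar_mutate h hx hx']
    · rw [mutate_x_of_ne hi, mutate_x_of_ne hi]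
  have h2 : ((t.mutate k).mutate k).b = t.b := by
    funext i j
    by_cases hi : i = .inl k
    · simp [ExtSeed.mutate, hi]
    · by_cases hj : j = k
      · simp [ExtSeed.mutate, hj]
      · simp [ExtSeed.mutate, hi, hj, mutateEntry_mutateEntry]
  cases t
  exact congrArg₂ ExtSeed.mk h1 h2

/-- The common source of two invariances: it transports compatible forms, where `w` is a column of
the form, and gradings, where all the pairings vanish. -/
lemma sum_mutate_mul (h : t.IsSkew) (k j : κ) (w : κ ⊕ φ → ℤ) :
    ∑ i, (t.mutate k).b i j * t.mutateWeight k w i =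
      if j = k then -∑ i, t.b i k * w i
      else ∑ i, t.b i j * w i + ((-t.b (.inl k) j).toNat : ℤ) * ∑ i, t.b i k * w i := by
  split_ifs with hj
  · subst hj
    rw [← Finset.sum_neg_distrib]
    refine Finset.sum_congr rfl fun i _ => ?_
    by_cases hi : i = .inl j
    · subst hi; simp [ExtSeed.mutate, h.diag]
    · simp [ExtSeed.mutate, mutateWeight, hi]
  · set s := ∑ i, ((t.b i k).toNat : ℤ) * w i with hs
    have hterm : ∀ i, (t.mutate k).b i j * t.mutateWeight k w i =
        (t.b i j * w i + ((t.b i k).toNat * (t.b (.inl k) j).toNat -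
          (-t.b i k).toNat * (-(t.b (.inl k) j)).toNat) * w i) +
        if i = .inl k then - t.b (.inl k) j * s else 0 := by
      intro i
      by_cases hi : i = .inl k
      · subst hi
        simp only [ExtSeed.mutate, mutateWeight, h.diag k, Function.update_self, true_or, if_true,
          ← hs]
        simp only [Int.toNat_zero, neg_zero]
        push_cast
        ring
      · simp only [ExtSeed.mutate, mutateWeight, hi, hj, or_self, if_false, mutateEntry]
        rw [Function.update_of_ne hi]
        ring
    simp_rw [hterm, Finset.sum_add_distrib]
    rw [Finset.sum_ite_eq' Finset.univ (Sum.inl k)]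
    simp only [Finset.mem_univ, if_true]
    have h1 : -t.b (.inl k) j * s = ∑ i, -t.b (.inl k) j * (((t.b i k).toNat : ℤ) * w i) := by
      rw [hs, Finset.mul_sum]
    rw [h1, Finset.mul_sum, add_assoc, ← Finset.sum_add_distrib]
    congr 1
    refine Finset.sum_congr rfl fun i _ => ?_
    have h2 := toNat_sub_toNat_neg' (t.b (.inl k) j)
    have h3 := toNat_sub_toNat_neg' (t.b i k)
    rw [h2, h3]
    generalize ((-t.b i k).toNat : ℤ) = p
    generalize ((-t.b (.inl k) j).toNat : ℤ) = q
    ring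

/-- Away from index `k` the columns of the form mutate as weights, so `sum_mutate_mul` applies
directly. Column `k` is first replaced by the combination of old columns dictated by the exchange
monomial. -/
lemma IsCompatible.mutate {c : ℤ} {Λ : κ ⊕ φ → κ ⊕ φ → ℤ} (hs : t.IsSkew)
    (h : t.IsCompatible c Λ) (k : κ) : (t.mutate k).IsCompatible c (t.mutateForm k Λ) := by
  -- The double sum is a skew form evaluated on a repeated vector, hence zero, and the two linear
  -- sums cancel by skewness.
  have hself : t.mutateForm k Λ (.inl k) (.inl k) = 0 := by
    simp only [mutateForm, if_true, mutateWeight, Function.update_self]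
    simp_rw [mul_add, Finset.mul_sum, Finset.sum_add_distrib]
    have h1 : ∑ i, ∑ m, ((t.b i k).toNat : ℤ) * (((t.b m k).toNat : ℤ) * Λ i m) = 0 := by
      have h2 : ∑ i, ∑ m, ((t.b i k).toNat : ℤ) * (((t.b m k).toNat : ℤ) * Λ i m) =
          -∑ i, ∑ m, ((t.b i k).toNat : ℤ) * (((t.b m k).toNat : ℤ) * Λ i m) := by
        conv_lhs => rw [Finset.sum_comm]
        rw [← Finset.sum_neg_distrib]
        refine Finset.sum_congr rfl fun i _ => ?_
        rw [← Finset.sum_neg_distrib]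
        refine Finset.sum_congr rfl fun m _ => ?_
        rw [h.skew m i]; ring
      omega
    have h3 : Λ (.inl k) (.inl k) = 0 := by have := h.skew (.inl k) (.inl k); omega
    have h4 : ∑ i, ((t.b i k).toNat : ℤ) * -Λ i (.inl k) =
        ∑ i, ((t.b i k).toNat : ℤ) * Λ (.inl k) i :=
      Finset.sum_congr rfl fun i _ => by rw [h.skew (.inl k) i]
    rw [h1, h3, h4]
    ring
  refine ⟨fun i l => ?_, fun j l => ?_⟩
  · by_cases hi : i = .inl k <;> by_cases hl : l = .inl k
    · subst hi; subst hl; rw [hself, neg_zero]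
    · subst hi
      simp only [mutateForm, hl, if_false, if_true, mutateWeight, Function.update_self]
      rw [Function.update_of_ne hl, h.skew l (.inl k)]
      simp_rw [h.skew l]
      simp
      ring
    · subst hl
      simp only [mutateForm, hi, if_false, if_true, mutateWeight, Function.update_self]
      rw [Function.update_of_ne hi, h.skew i (.inl k)]
      simp_rw [h.skew i]
      simp
      ring
    · simp only [mutateForm, hi, hl, if_false, mutateWeight]
      rw [Function.update_of_ne hi, Function.update_of_ne hl, h.skew]
  · by_cases hl : l = .inl k
    · subst hl
      -- Compatibility leaves only `m = .inl j` in the double sum.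
      have hsum : ∀ j, ∑ i, t.b i j * (-Λ i (.inl k) + ∑ m, ((t.b m k).toNat : ℤ) * Λ i m) =
          if j = k then -c else ((t.b (.inl j) k).toNat : ℤ) * c := by
        intro j
        have h1 : ∑ i, t.b i j * ∑ m, ((t.b m k).toNat : ℤ) * Λ i m =
            ((t.b (.inl j) k).toNat : ℤ) * c := by
          simp_rw [Finset.mul_sum]
          rw [Finset.sum_comm]
          have : ∀ m, ∑ i, t.b i j * (((t.b m k).toNat : ℤ) * Λ i m) =
              if m = .inl j then ((t.b m k).toNat : ℤ) * c else 0 := by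
            intro m
            rw [← mul_ite_zero, ← h.sum_eq j m, Finset.mul_sum]
            exact Finset.sum_congr rfl fun i _ => by ring
          simp_rw [this]
          simp
        simp_rw [mul_add, Finset.sum_add_distrib, h1, mul_neg, Finset.sum_neg_distrib, h.sum_eq]
        by_cases hj : j = k
        · subst hj; simp [hs.diag]
        · simp [hj, Ne.symm hj]
      simp only [mutateForm, if_true]
      rw [sum_mutate_mul hs, hsum, hsum]
      by_cases hj : j = k
      · simp [hj]
      · simp only [hj, if_false, if_true, Sum.inl.injEq, Ne.symm hj]
        rw [hs j k]; ring
    · simp only [mutateForm, hl, if_false]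
      rw [sum_mutate_mul hs, h.sum_eq, h.sum_eq]
      by_cases hj : j = k
      · simp [hj, hl]
      · simp [hj, hl]

end ExtSeed

end ClusterAlgebra

namespace ClusterAlgebra

/-! ### Laurent polynomials in two variables linked by an exchange relation. -/

section OneVariable

open Polynomial in
/-- An element that is a Laurent polynomial both in `x` and in `x' = P / x` is the sum of a
polynomial in `x` and a polynomial in `x'`. -/
lemma exists_aeval_add_aeval {A F : Type*} [CommRing A] [IsDomain A] [Field F] [Algebra A F]
    {x x' f : F} (hx : Transcendental A x) {P : A} (hP : P ≠ 0)
    (hxx' : x * x' = algebraMap A F P) {N M : ℕ} {g h : A[X]} (hg : f * x ^ N = aeval x g)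
    (hh : f * x' ^ M = aeval x' h) : ∃ g' h' : A[X], f = aeval x g' + aeval x' h' := by
  have hx0 : x ≠ 0 := by
    rintro rfl
    exact hx isAlgebraic_zero
  -- The polynomial `r` below is `x ^ d * h (P / x)`. This `d` is large enough to clear all
  -- denominators and to make the indices `M + N - n` used later at most `d`.
  set d := h.natDegree + N + M with hd
  let r : A[X] := ∑ i ∈ Finset.range (d + 1), C (h.coeff i * P ^ i) * X ^ (d - i)
  have hr : aeval x r = x ^ d * aeval x' h := by
    rw [aeval_eq_sum_range' (show h.natDegree < d + 1 by omega), map_sum, Finset.mul_sum]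
    refine Finset.sum_congr rfl fun i hi => ?_
    have hi' : i ≤ d := by simpa [Nat.lt_succ_iff] using hi
    rw [map_mul, map_pow, aeval_X, aeval_C, map_mul, map_pow, ← hxx', Algebra.smul_def, mul_pow]
    calc _ = algebraMap A F (h.coeff i) * x' ^ i * (x ^ i * x ^ (d - i)) := by ring
      _ = _ := by rw [← pow_add, Nat.add_sub_cancel' hi']; ring
  have hpoly : C (P ^ M) * g * X ^ d = X ^ (M + N) * r := by
    apply transcendental_iff_injective.1 hx
    simp only [map_mul, map_pow, aeval_X, aeval_C, hr, ← hg, ← hh, ← hxx']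
    ring
  have hr_coeff : ∀ i ≤ d, r.coeff (d - i) = h.coeff i * P ^ i := by
    intro i hi
    simp only [r, finsetSum_coeff, coeff_C_mul, coeff_X_pow]
    rw [Finset.sum_eq_single i]
    · simp
    · intro b hb hbi
      have : b ≤ d := by simpa [Nat.lt_succ_iff] using hb
      rw [if_neg (show ¬ d - i = d - b by omega), mul_zero]
    · intro hi'; simp at hi'; omega
  -- The coefficient of `x ^ (n - N)` in `f` is divisible by `P ^ (N - n)`, so each negative power
  -- of `x` can be rewritten as a positive power of `x' = P / x`.
  have hcoeff : ∀ n < N, g.coeff n = h.coeff (M + N - n) * P ^ (N - n) := by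
    intro n hn
    have h1 := congrArg (fun q : A[X] => q.coeff (n + d)) hpoly
    simp only [coeff_mul_X_pow, coeff_C_mul] at h1
    rw [show n + d = (d - (M + N - n)) + (M + N) by omega, mul_comm (X ^ (M + N)),
      coeff_mul_X_pow, hr_coeff _ (by omega)] at h1
    apply mul_left_cancel₀ (pow_ne_zero M hP)
    rw [h1, show M + N - n = M + (N - n) by omega, pow_add]
    ring
  refine ⟨∑ n ∈ Finset.range (g.natDegree + 1), C (g.coeff (N + n)) * X ^ n,
    ∑ n ∈ Finset.range N, C (h.coeff (M + N - n)) * X ^ (N - n), ?_⟩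
  apply mul_right_cancel₀ (pow_ne_zero N hx0)
  rw [hg, aeval_eq_sum_range' (show g.natDegree < N + (g.natDegree + 1) by omega),
    Finset.sum_range_add, add_comm, add_mul, map_sum, map_sum, Finset.sum_mul, Finset.sum_mul]
  congr 1
  · refine Finset.sum_congr rfl fun n _ => ?_
    simp only [map_mul, map_pow, aeval_X, aeval_C, Algebra.smul_def]
    ring
  · refine Finset.sum_congr rfl fun n hn => ?_
    have hn' : n < N := by simpa using hn
    simp only [map_mul, map_pow, aeval_X, aeval_C, Algebra.smul_def, hcoeff n hn', ← hxx']
    have : x ^ N = x ^ n * x ^ (N - n) := by rw [← pow_add]; congr 1; omega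
    rw [this]
    ring

end OneVariable

open MvPolynomial

/-! ### Laurent rings of a seed and independence of its cluster. -/

namespace ExtSeed

variable {κ φ : Type*} [Fintype κ] [Fintype φ] [DecidableEq κ] [DecidableEq φ]
  {F : Type*} [Field F] {t : ExtSeed κ φ F}

section Rings

/-- Polynomials in the extended cluster. -/
abbrev polyRing (t : ExtSeed κ φ F) : Subalgebra ℤ F := Algebra.adjoin ℤ (Set.range t.x)

/-- Laurent polynomials in the cluster with coefficients polynomial in the frozen variables. -/
abbrev laurent (t : ExtSeed κ φ F) : Subalgebra ℤ F :=
  Algebra.adjoin ℤ (Set.range t.x ∪ Set.range fun j => (t.x (.inl j))⁻¹)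

/-- Polynomials in the extended cluster variables other than `x k`. -/
abbrev coreRing (t : ExtSeed κ φ F) (k : κ) : Subalgebra ℤ F := Algebra.adjoin ℤ (t.x '' {.inl k}ᶜ)

omit [Fintype κ] [Fintype φ] [DecidableEq κ] [DecidableEq φ] in
lemma x_mem_coreRing {k : κ} {i : κ ⊕ φ} (h : i ≠ .inl k) : t.x i ∈ t.coreRing k :=
  Algebra.subset_adjoin ⟨i, h, rfl⟩

omit [Fintype κ] [Fintype φ] [DecidableEq κ] [DecidableEq φ] in
lemma x_mem_polyRing (i : κ ⊕ φ) : t.x i ∈ t.polyRing := Algebra.subset_adjoin ⟨i, rfl⟩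

omit [Fintype κ] [Fintype φ] [DecidableEq κ] [DecidableEq φ] in
lemma x_mem_laurent (i : κ ⊕ φ) : t.x i ∈ t.laurent := Algebra.subset_adjoin (Or.inl ⟨i, rfl⟩)

omit [Fintype κ] [Fintype φ] [DecidableEq κ] [DecidableEq φ] in
lemma inv_x_mem_laurent (j : κ) : (t.x (.inl j))⁻¹ ∈ t.laurent :=
  Algebra.subset_adjoin (Or.inr ⟨j, rfl⟩)

omit [Fintype κ] [Fintype φ] [DecidableEq κ] [DecidableEq φ] in
lemma mem_of_mem_laurent {V : Subring F} (h : ∀ i, t.x i ∈ V) (h' : ∀ j, (t.x (.inl j))⁻¹ ∈ V)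
    {f : F} (hf : f ∈ t.laurent) : f ∈ V := by
  have : t.laurent ≤ subalgebraOfSubring V := Algebra.adjoin_le (by
    rintro _ (⟨i, rfl⟩ | ⟨j, rfl⟩)
    · exact h i
    · exact h' j)
  exact this hf

omit [Fintype κ] [Fintype φ] [DecidableEq κ] [DecidableEq φ] in
lemma mem_of_mem_coreRing {V : Subring F} {k : κ} (h : ∀ i, i ≠ .inl k → t.x i ∈ V)
    {f : F} (hf : f ∈ t.coreRing k) : f ∈ V := by
  have : t.coreRing k ≤ subalgebraOfSubring V := Algebra.adjoin_le (by
    rintro _ ⟨i, hi, rfl⟩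
    exact h i hi)
  exact this hf

omit [Fintype κ] [Fintype φ] [DecidableEq κ] [DecidableEq φ] in
lemma polyRing_le_laurent : t.polyRing ≤ t.laurent := Algebra.adjoin_mono Set.subset_union_left

omit [Fintype φ] [DecidableEq κ] [DecidableEq φ] in
lemma exists_mul_prod_pow_mem (hx : ∀ j, t.x (.inl j) ≠ 0) {f : F} (hf : f ∈ t.laurent) :
    ∃ N : ℕ, f * (∏ j, t.x (.inl j)) ^ N ∈ t.polyRing := by
  classical
  have hprod : ∏ j, t.x (.inl j) ∈ t.polyRing := prod_mem fun j _ => x_mem_polyRing _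
  induction hf using Algebra.adjoin_induction with
  | mem y hy =>
    rcases hy with ⟨i, rfl⟩ | ⟨j, rfl⟩
    · exact ⟨0, by simpa using x_mem_polyRing i⟩
    · refine ⟨1, ?_⟩
      rw [pow_one, ← Finset.mul_prod_erase _ _ (Finset.mem_univ j), inv_mul_cancel_left₀ (hx j)]
      exact prod_mem fun i _ => x_mem_polyRing _
  | algebraMap r => exact ⟨0, by simp⟩
  | add f g _ _ hf hg =>
    obtain ⟨N, hN⟩ := hf
    obtain ⟨M, hM⟩ := hg
    refine ⟨N + M, ?_⟩
    have := add_mem (mul_mem hN (pow_mem hprod M)) (mul_mem hM (pow_mem hprod N))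
    refine (congrArg (· ∈ t.polyRing) ?_).mp this
    ring
  | mul f g _ _ hf hg =>
    obtain ⟨N, hN⟩ := hf
    obtain ⟨M, hM⟩ := hg
    refine ⟨N + M, ?_⟩
    refine (congrArg (· ∈ t.polyRing) ?_).mp (mul_mem hN hM)
    ring

omit [Fintype φ] [DecidableEq κ] [DecidableEq φ] in
lemma mem_laurent_of_mul_prod_pow (hx : ∀ j, t.x (.inl j) ≠ 0) {f : F} {N : ℕ}
    (hf : f * (∏ j, t.x (.inl j)) ^ N ∈ t.laurent) : f ∈ t.laurent := by
  have h2 : ∏ j, (t.x (.inl j))⁻¹ ∈ t.laurent := prod_mem fun j _ => inv_x_mem_laurent j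
  have h1 := pow_mem h2 N
  have := mul_mem hf h1
  have h0 : ∏ j, t.x (.inl j) ≠ 0 := Finset.prod_ne_zero_iff.2 fun j _ => hx j
  rwa [Finset.prod_inv_distrib, mul_assoc, ← mul_pow, mul_inv_cancel₀ h0, one_pow, mul_one] at this

omit [Fintype κ] [Fintype φ] [DecidableEq κ] [DecidableEq φ] in
lemma exists_aeval_of_mem_polyRing {A : Subalgebra ℤ F} {k : κ} (hA : ∀ i, i ≠ .inl k → t.x i ∈ A)
    {f : F} (hf : f ∈ t.polyRing) : ∃ g : Polynomial A, f = Polynomial.aeval (t.x (.inl k)) g := by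
  classical
  induction hf using Algebra.adjoin_induction with
  | mem y hy =>
    obtain ⟨i, rfl⟩ := hy
    by_cases hi : i = .inl k
    · exact ⟨Polynomial.X, by simp [hi]⟩
    · exact ⟨Polynomial.C ⟨t.x i, hA i hi⟩, by simp⟩
  | algebraMap r => exact ⟨Polynomial.C (algebraMap _ _ r), by simp⟩
  | add f g _ _ hf hg =>
    obtain ⟨p, rfl⟩ := hf
    obtain ⟨q, rfl⟩ := hg
    exact ⟨p + q, by simp⟩
  | mul f g _ _ hf hg =>
    obtain ⟨p, rfl⟩ := hf
    obtain ⟨q, rfl⟩ := hg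
    exact ⟨p * q, by simp⟩

lemma coreRing_mutate (k : κ) : (t.mutate k).coreRing k = t.coreRing k := by
  unfold coreRing
  congr 1
  exact Set.image_congr fun i hi => mutate_x_of_ne hi

end Rings

section Independence

omit [Fintype κ] [Fintype φ] [DecidableEq κ] [DecidableEq φ] in
lemma x_ne_zero (h : AlgebraicIndependent ℤ t.x) (i : κ ⊕ φ) : t.x i ≠ 0 := h.ne_zero i

lemma binomial_ne_zero_of_indep (h : AlgebraicIndependent ℤ t.x) (k : κ) (u : κ ⊕ φ → ℤ) :
    binomial t.x u ≠ 0 := by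
  have : Nonempty (κ ⊕ φ) := ⟨.inl k⟩
  have h1 : aeval t.x (binomial X u : MvPolynomial (κ ⊕ φ) ℤ) = binomial t.x u := by
    rw [map_binomial]; simp
  rw [← h1]
  intro h0
  exact ClusterAlgebra.binomial_ne_zero u (h.eq_zero_of_aeval_eq_zero _ h0)

lemma newVar_ne_zero (h : AlgebraicIndependent ℤ t.x) (k : κ) : t.newVar k ≠ 0 :=
  div_ne_zero (binomial_ne_zero_of_indep h k _) (x_ne_zero h _)

omit [DecidableEq κ] [DecidableEq φ] in
lemma x_mul_newVar (h : AlgebraicIndependent ℤ t.x) (k : κ) :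
    t.x (.inl k) * t.newVar k = binomial t.x (t.col k) :=
  mul_div_cancel₀ _ (x_ne_zero h _)

omit [DecidableEq κ] [DecidableEq φ] in
lemma binomial_col_mem_coreRing (hs : t.IsSkew) (k : κ) :
    binomial t.x (t.col k) ∈ t.coreRing k :=
  binomial_mem _ _ _ fun i hi => x_mem_coreRing (by
    rintro rfl
    exact hi (hs.diag k))

/-- The remaining variables do not change, and the old variable is an element of their ring divided
by the new one; if the new variable were algebraic over that ring, so would be the old one. -/
lemma indep_mutate (h : AlgebraicIndependent ℤ t.x) (hs : t.IsSkew) (k : κ) :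
    AlgebraicIndependent ℤ (t.mutate k).x := by
  rw [AlgebraicIndependent.iff_transcendental_adjoin_image (.inl k)] at h ⊢
  refine ⟨?_, ?_⟩
  · convert h.1 using 2 with j
    exact mutate_x_of_ne j.2
  · have h1 := (AlgebraicIndependent.iff_transcendental_adjoin_image _).2 h
    have h2 : Transcendental (t.coreRing k) (t.x (.inl k)) := h.2
    rw [mutate_x_self]
    suffices hA : ∀ A : Subalgebra ℤ F, A = t.coreRing k → Transcendental A (t.newVar k) from
      hA _ (coreRing_mutate k)
    rintro A rfl halg
    apply h2
    have h3 : t.x (.inl k) = algebraMap (t.coreRing k) F ⟨_, binomial_col_mem_coreRing hs k⟩ *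
        (t.newVar k)⁻¹ := by
      rw [Subalgebra.algebraMap_def, eq_mul_inv_iff_mul_eq₀ (newVar_ne_zero h1 k)]
      exact x_mul_newVar h1 k
    rw [h3]
    exact (isAlgebraic_algebraMap _).mul halg.inv

end Independence

/-- An element Laurent in two adjacent clusters: normal form up to monomials in the common part. -/
lemma exists_eq_aeval_add_aeval (h : AlgebraicIndependent ℤ t.x) (hs : t.IsSkew) {k : κ} {f : F}
    (hf : f ∈ t.laurent) (hf' : f ∈ (t.mutate k).laurent) :
    ∃ (N : ℕ) (g g' : Polynomial (t.coreRing k)),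
      f * (∏ j ∈ Finset.univ.erase k, t.x (.inl j)) ^ N =
        Polynomial.aeval (t.x (.inl k)) g + Polynomial.aeval (t.newVar k) g' := by
  have h' := indep_mutate h hs k
  set ν := ∏ j ∈ Finset.univ.erase k, t.x (.inl j) with hν
  have hνmem : ν ∈ t.coreRing k := prod_mem fun j hj => x_mem_coreRing (by
    have := Finset.ne_of_mem_erase hj
    simpa using this)
  have hν1 : ∏ j, t.x (.inl j) = t.x (.inl k) * ν :=
    (Finset.mul_prod_erase _ _ (Finset.mem_univ k)).symm
  have hν2 : ∏ j, (t.mutate k).x (.inl j) = t.newVar k * ν := by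
    rw [← Finset.mul_prod_erase _ _ (Finset.mem_univ k), mutate_x_self]
    congr 1
    refine Finset.prod_congr rfl fun j hj => mutate_x_of_ne ?_
    have := Finset.ne_of_mem_erase hj
    simpa using this
  obtain ⟨N, hN⟩ := exists_mul_prod_pow_mem (fun j => x_ne_zero h _) hf
  obtain ⟨M, hM⟩ := exists_mul_prod_pow_mem (fun j => x_ne_zero h' _) hf'
  obtain ⟨g, hg⟩ := exists_aeval_of_mem_polyRing (k := k) (fun i hi => x_mem_coreRing hi) hN
  obtain ⟨g', hg'⟩ := exists_aeval_of_mem_polyRing (k := k) (A := t.coreRing k)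
    (fun i hi => by rw [mutate_x_of_ne hi]; exact x_mem_coreRing hi) hM
  rw [mutate_x_self] at hg'
  rw [hν1] at hg
  rw [hν2] at hg'
  let n : t.coreRing k := ⟨ν, hνmem⟩
  have hn : ∀ y : F, ∀ m : ℕ, Polynomial.aeval y (Polynomial.C (n ^ m)) = ν ^ m := fun y m => by
    rw [Polynomial.aeval_C, map_pow]; rfl
  have hP : (⟨_, binomial_col_mem_coreRing hs k⟩ : t.coreRing k) ≠ 0 := fun h0 =>
    binomial_ne_zero_of_indep h k _ (congrArg Subtype.val h0)
  obtain ⟨p, p', hp⟩ := exists_aeval_add_aeval (A := t.coreRing k) (x := t.x (.inl k))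
    (x' := t.newVar k) (f := f * ν ^ (N + M)) (N := N) (M := M) (g := Polynomial.C (n ^ M) * g)
    (h := Polynomial.C (n ^ N) * g')
    ((AlgebraicIndependent.iff_transcendental_adjoin_image _).1 h).2 hP (x_mul_newVar h k)
    (by rw [map_mul, hn, ← hg]; ring) (by rw [map_mul, hn, ← hg']; ring)
  exact ⟨N + M, p, p', hp⟩

end ExtSeed

/-! ### Local computations with two successive exchanges. -/

section ExchangeMem

variable {ι : Type*} [Fintype ι] [DecidableEq ι] {F : Type*} [Field F]

lemma posMonomial_eq_mul_prod_erase (X : ι → F) (u : ι → ℤ) (k : ι) :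
    posMonomial X u = X k ^ (u k).toNat * ∏ i ∈ Finset.univ.erase k, X i ^ (u i).toNat :=
  (Finset.mul_prod_erase _ _ (Finset.mem_univ k)).symm

/-- The key computation behind the Laurent phenomenon: the variable obtained from `X` by exchange
at `j`, expressed in the cluster `Y` obtained by exchanges at `k` and then at `j`. -/
lemma exchange_mem (V : Subring F) (X Y : ι → F) (u v : ι → ℤ) {j k : ι} (hjk : j ≠ k)
    (hb : 0 < u k) (hvj : v j = -u k) (huj : u j = 0) (hvk : v k = 0)
    (hY : ∀ i, i ≠ j → i ≠ k → Y i = X i) (hV : ∀ i, Y i ∈ V) (hXj : X j ∈ V) (hXj0 : X j ≠ 0)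
    (hk : X k * Y k = binomial X v)
    (hj : X j * Y j = binomial Y (fun i => if i = k then -u k else u i + u k * (v i).toNat)) :
    binomial X u / X j * Y k ^ (u k).toNat ∈ V := by
  set β := (u k).toNat with hβ
  have hβ' : (β : ℤ) = u k := Int.toNat_of_nonneg hb.le
  have hβ0 : β ≠ 0 := by omega
  have hcongr : ∀ (w : ι → ℤ) (s : Finset ι), (w j).toNat = 0 → ((w k).toNat = 0 ∨ k ∉ s) →
      ∏ i ∈ s, X i ^ (w i).toNat = ∏ i ∈ s, Y i ^ (w i).toNat := by
    intro w s hwj hwk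
    refine Finset.prod_congr rfl fun i hi => ?_
    by_cases hij : i = j
    · subst hij; rw [hwj, pow_zero, pow_zero]
    · by_cases hik : i = k
      · subst hik
        rcases hwk with hwk | hwk
        · rw [hwk, pow_zero, pow_zero]
        · exact absurd hi hwk
      · rw [hY i hij hik]
  set A := ∏ i ∈ Finset.univ.erase k, Y i ^ (u i).toNat with hA
  set B := posMonomial Y (-u) with hB
  set D := posMonomial Y v with hD
  set E := X j ^ (β - 1) * ∏ i ∈ Finset.univ.erase j, Y i ^ ((-v) i).toNat with hE
  have hXu : posMonomial X u = X k ^ β * A := by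
    rw [posMonomial_eq_mul_prod_erase X u k, hcongr u _ (by simp [huj]) (Or.inr (by simp))]
  have hXu' : posMonomial X (-u) = B :=
    hcongr _ _ (by simp [huj]) (Or.inl (by simp; omega))
  have hXv : posMonomial X v = D := hcongr _ _ (by rw [hvj]; omega) (Or.inl (by simp [hvk]))
  have hXv' : posMonomial X (-v) = X j * E := by
    rw [posMonomial_eq_mul_prod_erase X (-v) j, Pi.neg_apply, hvj, neg_neg, ← hβ, hE, ← mul_assoc,
      ← pow_succ', Nat.sub_add_cancel (Nat.one_le_iff_ne_zero.2 hβ0)]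
    congr 1
    refine Finset.prod_congr rfl fun i hi => ?_
    by_cases hik : i = k
    · subst hik; simp [hvk]
    · rw [hY i (Finset.ne_of_mem_erase hi) hik]
  set u' : ι → ℤ := fun i => if i = k then -u k else u i + u k * (v i).toNat with hu'
  -- `G` is the monomial cancelled in passing to the mutated column: `D ^ β * A` and `Y k ^ β * B`
  -- are `G` times the two monomials of `u'`. The truncated subtraction is exact since `u i ≤ u' i`
  -- for `i ≠ k`.
  set G := ∏ i ∈ Finset.univ.erase k, Y i ^ ((-u i).toNat - (-(u' i)).toNat) with hG
  have hu'i : ∀ i ∈ Finset.univ.erase k, u' i = u i + (β * (v i).toNat : ℕ) := by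
    intro i hi
    simp only [hu', Finset.ne_of_mem_erase hi, if_false]
    push_cast [hβ']
    rfl
  have hGp : G * posMonomial Y u' = D ^ β * A := by
    rw [posMonomial_eq_mul_prod_erase Y u' k, hD, posMonomial_eq_mul_prod_erase Y v k, hvk, hG, hA]
    have h0 : (u' k).toNat = 0 := by simp only [hu', if_true]; omega
    rw [h0, Int.toNat_zero, pow_zero, one_mul, one_mul, ← Finset.prod_pow,
      ← Finset.prod_mul_distrib, ← Finset.prod_mul_distrib]
    refine Finset.prod_congr rfl fun i hi => ?_
    rw [← pow_mul, ← pow_add, ← pow_add, hu'i i hi, mul_comm (v i).toNat β]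
    congr 1
    generalize β * (v i).toNat = m
    omega
  have hGm : G * posMonomial Y (-u') = Y k ^ β * B := by
    rw [posMonomial_eq_mul_prod_erase Y (-u') k, hB, posMonomial_eq_mul_prod_erase Y (-u) k, hG]
    have h0 : ((-u') k).toNat = β := by simp [hu', hβ]
    have h1 : ((-u) k).toNat = 0 := by simp; omega
    rw [h0, h1, pow_zero, one_mul, mul_left_comm, ← Finset.prod_mul_distrib]
    congr 1
    refine Finset.prod_congr rfl fun i hi => ?_
    rw [← pow_add, Pi.neg_apply, Pi.neg_apply, hu'i i hi]
    congr 1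
    generalize β * (v i).toNat = m
    omega
  have hprodV : ∀ (s : Finset ι) (n : ι → ℕ), ∏ i ∈ s, Y i ^ n i ∈ V := fun s n =>
    prod_mem fun i _ => pow_mem (hV i) _
  have hAV : A ∈ V := hprodV _ _
  have hDV : D ∈ V := hprodV _ _
  have hEV : E ∈ V := mul_mem (pow_mem hXj _) (hprodV _ _)
  have hGV : G ∈ V := hprodV _ _
  -- Since `X k * Y k = D + X j * E`, its `β`-th power agrees with `D ^ β` modulo `X j`. This
  -- congruence is what makes the division by `X j` possible in `V`.
  obtain ⟨W, hW⟩ : ∃ W : V, (D + X j * E) ^ β - D ^ β = X j * E * W := by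
    obtain ⟨W, hW⟩ := sub_dvd_pow_sub_pow
      (⟨D + X j * E, add_mem hDV (mul_mem hXj hEV)⟩ : V) ⟨D, hDV⟩ β
    refine ⟨W, ?_⟩
    have := congrArg Subtype.val hW
    simpa using this
  have hk' : X k * Y k = D + X j * E := by rw [hk, binomial, hXv, hXv']
  have key : binomial X u / X j * Y k ^ β = G * Y j + E * W * A := by
    rw [binomial, hXu, hXu']
    have h1 : (X k ^ β * A + B) * Y k ^ β = X j * (G * Y j + E * W * A) := by
      calc _ = (X k * Y k) ^ β * A + Y k ^ β * B := by rw [mul_pow]; ring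
        _ = ((D + X j * E) ^ β - D ^ β) * A + (D ^ β * A + Y k ^ β * B) := by rw [hk']; ring
        _ = X j * E * W * A + G * (X j * Y j) := by
          rw [hW, ← hGp, ← hGm, hj, binomial]; ring
        _ = _ := by ring
    rw [div_mul_eq_mul_div, h1, mul_div_cancel_left₀ _ hXj0]
  rw [key]
  exact add_mem (mul_mem hGV (hV j)) (mul_mem (mul_mem hEV W.2) hAV)

/-- If `x j` vanishes at a prime dividing an exchange binomial, then an exchange binomial
involving `x j` is a unit there. -/
lemma isUnitAt_binomial {Y X' : ι → F} {u v : ι → ℤ} {π : MvPolynomial ι ℤ} (hπ : Prime π)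
    (hu : π ∣ binomial X u) {j : ι} (hvj : v j ≠ 0)
    (hY : ∀ i, i ≠ j → v i ≠ 0 → Y i = X' i)
    (hj : IsNonunitAt (aeval X' : MvPolynomial ι ℤ →ₐ[ℤ] F).toRingHom π (Y j)) :
    IsUnitAt (aeval X' : MvPolynomial ι ℤ →ₐ[ℤ] F).toRingHom π (binomial Y v) := by
  set e := (aeval X' : MvPolynomial ι ℤ →ₐ[ℤ] F).toRingHom with he
  have heX : ∀ i, e (X i) = X' i := fun i => by simp [he]
  -- Exactly one monomial contains `Y j` and so vanishes at `π`. The other is a monomial in the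
  -- variables `X'`, a unit because a prime dividing a binomial is not associated to a variable.
  have key : ∀ w : ι → ℤ, w j < 0 → (∀ i, i ≠ j → w i ≠ 0 → Y i = X' i) →
      IsUnitAt e π (posMonomial Y w + posMonomial Y (-w)) := by
    intro w hw hYw
    refine IsUnitAt.add hπ ?_ ?_
    · have : posMonomial Y w = e (posMonomial X w) := by
        rw [map_posMonomial]
        refine posMonomial_congr fun i => ?_
        by_cases hij : i = j
        · subst hij; rw [Int.toNat_of_nonpos hw.le, pow_zero, pow_zero]
        · by_cases hi : w i = 0
          · simp [hi]
          · rw [hYw i hij hi, heX]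
      rw [this]
      exact isUnitAt_map (not_dvd_posMonomial_of_dvd_binomial hπ hu w) hπ
    · have h1 : (-w j).toNat ≠ 0 := by omega
      rw [posMonomial_eq_mul_prod_erase Y (-w) j, Pi.neg_apply,
        ← Nat.sub_add_cancel (Nat.one_le_iff_ne_zero.2 h1), pow_succ', mul_assoc]
      refine hj.mul hπ (mul_mem (pow_mem (hj.mem hπ) _) (prod_mem fun i hi => ?_))
      by_cases hwi : w i = 0
      · simp [hwi, one_mem]
      · rw [hYw i (Finset.ne_of_mem_erase hi) hwi, ← heX]
        exact pow_mem (map_mem_localSubring hπ _) _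
  rcases lt_or_gt_of_ne hvj with h | h
  · exact key v h hY
  · have := key (-v) (by simpa using h) fun i hi hvi => hY i hi (by simpa using hvi)
    rwa [neg_neg, add_comm] at this

end ExchangeMem

/-! ### The Laurent phenomenon through invariance of upper bounds. -/

namespace ExtSeed

variable {κ φ : Type*} [Fintype κ] [Fintype φ] [DecidableEq κ] [DecidableEq φ]
  {F : Type*} [Field F] {t : ExtSeed κ φ F}

/-- The conditions preserved by mutation under which the Laurent phenomenon is proved. -/
structure IsGood (t : ExtSeed κ φ F) : Prop where
  indep : AlgebraicIndependent ℤ t.x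
  skew : t.IsSkew
  compatible : ∃ c Λ, c ≠ 0 ∧ t.IsCompatible c Λ

lemma IsGood.mutate (h : t.IsGood) (k : κ) : (t.mutate k).IsGood where
  indep := indep_mutate h.indep h.skew k
  skew := h.skew.mutate k
  compatible := by
    obtain ⟨c, Λ, hc, hΛ⟩ := h.compatible
    exact ⟨c, _, hc, hΛ.mutate h.skew k⟩

lemma mutate_col_of_ne {j k : κ} (hjk : j ≠ k) (i : κ ⊕ φ) : (t.mutate k).col j i =
    if i = .inl k then -t.b (.inl k) j
    else t.b i j + (t.b i k).toNat * (t.b (.inl k) j).toNat -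
      (-t.b i k).toNat * (-t.b (.inl k) j).toNat := by
  by_cases hi : i = .inl k
  · subst hi; simp [col, ExtSeed.mutate]
  · simp [col, ExtSeed.mutate, hi, hjk, mutateEntry]

/-- At a prime dividing none of the mutable variables of the target cluster, one of the three known
Laurent expressions of `f` has only integral ingredients and unit denominators. Which one depends on
whether the old `x j` vanishes there and on whether `j` and `k` are joined. -/
lemma mutate_mutate_local (h : t.IsGood) {j k : κ} (hjk : j ≠ k) {f : F} (h1 : f ∈ t.laurent)
    (h2 : f ∈ (t.mutate j).laurent) (h3 : f ∈ (t.mutate k).laurent)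
    {π : MvPolynomial (κ ⊕ φ) ℤ} (hπ : Prime π)
    (hmut : ∀ m, ¬ π ∣ X (.inl m)) :
    f ∈ localSubring (aeval ((t.mutate k).mutate j).x : MvPolynomial (κ ⊕ φ) ℤ →ₐ[ℤ] F).toRingHom
      hπ := by
  set t₁ := t.mutate k with ht₁
  set t₃ := t₁.mutate j with ht₃
  have g₁ : t₁.IsGood := h.mutate k
  have g₃ : t₃.IsGood := g₁.mutate j
  set e := (aeval t₃.x : MvPolynomial (κ ⊕ φ) ℤ →ₐ[ℤ] F).toRingHom with he
  have heX : ∀ i, e (X i) = t₃.x i := fun i => by simp [he]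
  have hinj : Function.Injective e := g₃.indep
  have hmem : ∀ i, t₃.x i ∈ localSubring e hπ := fun i => heX i ▸ map_mem_localSubring hπ _
  have hunit : ∀ m, IsUnitAt e π (t₃.x (.inl m)) := fun m =>
    heX (.inl m) ▸ isUnitAt_map (hmut m) hπ
  have hne : ∀ i, i ≠ .inl j → i ≠ .inl k → t₃.x i = t.x i := fun i hj hk => by
    rw [ht₃, mutate_x_of_ne hj, ht₁, mutate_x_of_ne hk]
  have hxk : t₃.x (.inl k) = t.newVar k := by
    rw [ht₃, mutate_x_of_ne (by simpa using hjk.symm), ht₁, mutate_x_self]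
  have hxj1 : t₁.x (.inl j) = t.x (.inl j) := mutate_x_of_ne (by simpa using hjk)
  have hP : t.x (.inl j) * t₃.x (.inl j) =
      e (binomial X (t₁.col j) : MvPolynomial (κ ⊕ φ) ℤ) := by
    rw [ht₃, mutate_x_self, ← hxj1, x_mul_newVar g₁.indep, map_binomial]
    simp only [heX]
    exact (binomial_update t₁.x (t₁.col j) (.inl j) (t₁.newVar j) (g₁.skew.diag j)).symm
  have hxj : t.x (.inl j) =
      e (binomial X (t₁.col j) : MvPolynomial (κ ⊕ φ) ℤ) / t₃.x (.inl j) := by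
    rw [← hP, mul_div_cancel_right₀ _ (g₃.indep.ne_zero _)]
  -- If `π` does not divide this binomial, the old `x j` is a unit and the expansion in the
  -- intermediate seed `t₁` suffices.
  by_cases hdvd : π ∣ (binomial X (t₁.col j) : MvPolynomial (κ ⊕ φ) ℤ)
  swap
  · have hu : IsUnitAt e π (t.x (.inl j)) := hxj ▸ (isUnitAt_map hdvd hπ).div hinj hπ (hunit j)
    have hall : ∀ i, t₁.x i = t₃.x i ∨ t₁.x i = t.x (.inl j) := fun i => by
      by_cases hi : i = .inl j
      · exact Or.inr (hi ▸ hxj1)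
      · exact Or.inl (by rw [ht₃, mutate_x_of_ne hi])
    refine mem_of_mem_laurent (fun i => ?_) (fun m => ?_) h3
    · rcases hall i with hi | hi
      · rw [hi]; exact hmem i
      · rw [hi]; exact hu.mem hπ
    · rcases hall (.inl m) with hi | hi
      · rw [hi]; exact ((hunit m).inv hinj).mem hπ
      · rw [hi]; exact (hu.inv hinj).mem hπ
  have hxjn : IsNonunitAt e π (t.x (.inl j)) := by
    rw [hxj, div_eq_mul_inv]
    exact (isNonunitAt_map hdvd hπ).mul hπ (((hunit j).inv hinj).mem hπ)
  have hkk := x_mul_newVar h.indep k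
  have hxk_of : IsUnitAt e π (binomial t.x (t.col k)) → IsUnitAt e π (t.x (.inl k)) := by
    intro hu
    have : t.x (.inl k) = binomial t.x (t.col k) / t₃.x (.inl k) := by
      rw [← hkk, hxk, mul_div_cancel_right₀ _ (newVar_ne_zero h.indep k)]
    rw [this]
    exact hu.div hinj hπ (hunit k)
  have hskew := h.skew j k
  -- When `j` and `k` are not joined, the two mutations commute: only `x k` separates the cluster of
  -- `t.mutate j` from that of `t₃`, so it remains to see that `x k` is a unit.
  by_cases hb : t.b (.inl k) j = 0
  · obtain ⟨c, Λ, hc, hΛ⟩ := h.compatible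
    have hcol : t₁.col j = t.col j := by
      funext i
      rw [ht₁, mutate_col_of_ne hjk, hb]
      by_cases hi : i = .inl k
      · simp [hi, col, hb]
      · simp [hi, col]
    have hbin : ∀ u : κ ⊕ φ → ℤ, u (.inl k) = 0 → u (.inl j) = 0 →
        binomial t.x u = e (binomial X u) := by
      intro u hk hj
      rw [map_binomial]
      simp only [heX]
      rw [ht₃, ht₁]
      unfold ExtSeed.mutate
      rw [binomial_update _ _ _ _ hj, binomial_update _ _ _ _ hk]
    have hxku : IsUnitAt e π (t.x (.inl k)) := by
      apply hxk_of
      rw [hbin _ (h.skew.diag k) (by simp [col, hskew, hb])]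
      refine isUnitAt_map ?_ hπ
      rw [hcol] at hdvd
      -- Column `k` of the compatible form pairs to `0` with column `j` and to `c ≠ 0` with column
      -- `k`. This is where nondegeneracy enters.
      refine not_dvd_binomial_of_dvd_binomial hπ (w := fun i => Λ i (.inl k)) ?_ ?_ hdvd
      · have := hΛ.sum_eq j (.inl k)
        rwa [if_neg (by simpa using hjk.symm)] at this
      · have := hΛ.sum_eq k (.inl k)
        rw [if_pos rfl] at this
        simp only [col, this]
        exact hc
    have hxj' : t.newVar j = t₃.x (.inl j) := by
      rw [ht₃, mutate_x_self, newVar, newVar, hxj1, hcol, ht₁]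
      congr 1
      exact (binomial_update t.x (t.col j) (.inl k) (t.newVar k) hb).symm
    have hall : ∀ i, (t.mutate j).x i = t₃.x i ∨ (t.mutate j).x i = t.x (.inl k) := fun i => by
      by_cases hi : i = .inl j
      · left; rw [hi, mutate_x_self, hxj']
      · rw [mutate_x_of_ne hi]
        by_cases hik : i = .inl k
        · right; rw [hik]
        · left; rw [hne i hi hik]
    refine mem_of_mem_laurent (fun i => ?_) (fun m => ?_) h2
    · rcases hall i with hi | hi
      · rw [hi]; exact hmem i
      · rw [hi]; exact hxku.mem hπ
    · rcases hall (.inl m) with hi | hi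
      · rw [hi]; exact ((hunit m).inv hinj).mem hπ
      · rw [hi]; exact (hxku.inv hinj).mem hπ
  · have hxku : IsUnitAt e π (t.x (.inl k)) := by
      apply hxk_of
      refine isUnitAt_binomial hπ hdvd (j := .inl j) (by simp [col, hskew, hb]) ?_ hxjn
      intro i hij hi
      have hik : i ≠ .inl k := by
        rintro rfl
        exact hi (h.skew.diag k)
      exact (hne i hij hik).symm
    have hjk' : (.inl j : κ ⊕ φ) ≠ .inl k := by simpa using hjk
    have hnew : ∃ n : ℕ, t.newVar j * t₃.x (.inl k) ^ n ∈ localSubring e hπ := by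
      have hkk' : t.x (.inl k) * t₃.x (.inl k) = binomial t.x (t.col k) := by rw [hxk, hkk]
      have hjj' : t.x (.inl j) * t₃.x (.inl j) = binomial t₃.x (t₁.col j) := by
        rw [hP, map_binomial]; simp only [heX]
      -- `exchange_mem` needs a positive entry. In the negative case both columns are negated, which
      -- leaves their binomials unchanged.
      rcases lt_or_gt_of_ne hb with hb | hb
      · refine ⟨(-t.col j (.inl k)).toNat, ?_⟩
        have := exchange_mem (localSubring e hπ) t.x t₃.x (-t.col j) (-t.col k) hjk'
          (by simpa [col] using hb) (by simp [col, hskew]) (by simp [col, h.skew.diag])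
          (by simp [col, h.skew.diag]) hne hmem (hxjn.mem hπ) (h.indep.ne_zero _)
          (by rw [hkk', binomial_neg]) (by
            rw [hjj', ← binomial_neg]
            congr 1
            funext i
            rw [Pi.neg_apply, ht₁, mutate_col_of_ne hjk]
            split_ifs with hi
            · simp [col]
            · simp only [col, Pi.neg_apply, Int.toNat_of_nonpos hb.le,
                Int.toNat_of_nonneg (neg_nonneg.2 hb.le)]
              push_cast
              ring)
        rwa [binomial_neg] at this
      · refine ⟨(t.col j (.inl k)).toNat, ?_⟩
        exact exchange_mem (localSubring e hπ) t.x t₃.x (t.col j) (t.col k) hjk'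
          (by simpa [col] using hb) (by simp [col, hskew]) (by simp [col, h.skew.diag])
          (by simp [col, h.skew.diag]) hne hmem (hxjn.mem hπ) (h.indep.ne_zero _) hkk' (by
            rw [hjj']
            congr 1
            funext i
            rw [ht₁, mutate_col_of_ne hjk]
            split_ifs with hi
            · simp [col]
            · simp only [col, Int.toNat_of_nonpos (neg_nonpos.2 hb.le), Int.toNat_of_nonneg hb.le]
              push_cast
              ring)
    have hnewV : t.newVar j ∈ localSubring e hπ := by
      obtain ⟨n, hn⟩ := hnew
      exact mem_localSubring_of_mul_mem hπ hinj ((hunit k).pow hπ n) hn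
    -- Neither `x j` nor its exchange partner need be a unit here. The normal form avoids inverting
    -- them: only the other variables, all units at `π`, occur as denominators.
    obtain ⟨N, p, p', hp⟩ := exists_eq_aeval_add_aeval h.indep h.skew h1 h2
    have hcore : ∀ y ∈ t.coreRing j, y ∈ localSubring e hπ := fun y hy =>
      mem_of_mem_coreRing (fun i hi => by
        by_cases hik : i = .inl k
        · rw [hik]; exact hxku.mem hπ
        · rw [← hne i hi hik]; exact hmem i) hy
    have haeval : ∀ y ∈ localSubring e hπ, ∀ q : Polynomial (t.coreRing j),
        Polynomial.aeval y q ∈ localSubring e hπ := by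
      intro y hy q
      rw [Polynomial.aeval_eq_sum_range]
      refine sum_mem fun n _ => ?_
      rw [Algebra.smul_def]
      exact mul_mem (hcore _ (q.coeff n).2) (pow_mem hy n)
    refine mem_localSubring_of_mul_mem hπ hinj ?_ (hp ▸ add_mem (haeval _ (hxjn.mem hπ) p)
      (haeval _ hnewV p'))
    refine (IsUnitAt.prod hπ _ _ fun m hm => ?_).pow hπ N
    by_cases hmk : m = k
    · rw [hmk]; exact hxku
    · rw [← hne _ (by simpa using Finset.ne_of_mem_erase hm) (by simpa using hmk)]
      exact hunit m

/-- The Laurent property propagates along two mutations. -/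
lemma mem_laurent_mutate_mutate (h : t.IsGood) {j k : κ} (hjk : j ≠ k) {f : F}
    (h1 : f ∈ t.laurent) (h2 : f ∈ (t.mutate j).laurent) (h3 : f ∈ (t.mutate k).laurent) :
    f ∈ ((t.mutate k).mutate j).laurent := by
  have g := (h.mutate k).mutate j
  set t₃ := (t.mutate k).mutate j
  set e := (aeval t₃.x : MvPolynomial (κ ⊕ φ) ℤ →ₐ[ℤ] F).toRingHom with he
  have heX : ∀ i, e (X i) = t₃.x i := fun i => by simp [he]
  have hloc : ∀ π (hπ : Prime π), ¬ π ∣ ∏ m : κ, (X (.inl m) : MvPolynomial (κ ⊕ φ) ℤ) →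
      f ∈ localSubring e hπ := fun π hπ hd =>
    mutate_mutate_local h hjk h1 h2 h3 hπ fun m hm =>
      hd (hm.trans (Finset.dvd_prod_of_mem _ (Finset.mem_univ m)))
  -- Any prime not dividing a variable would do. It only serves to exhibit `f` as a fraction of
  -- polynomials.
  have h2p : Prime (C 2 : MvPolynomial (κ ⊕ φ) ℤ) := (prime_C_iff _).2 Int.prime_two
  obtain ⟨a, d, hd, hfa⟩ := hloc _ h2p fun hd => by
    have h3 := map_dvd (aeval (fun _ : κ ⊕ φ => (1 : ℤ))) hd
    simp at h3
  obtain ⟨N, a, ha⟩ := exists_mul_pow_eq (e := e) g.indep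
    (x := ∏ m : κ, (X (.inl m) : MvPolynomial (κ ⊕ φ) ℤ))
    ⟨a, d, fun h0 => hd (h0 ▸ dvd_zero _), hfa⟩ hloc
  refine mem_laurent_of_mul_prod_pow (N := N) (fun m => g.indep.ne_zero _) ?_
  rw [map_prod] at ha
  simp only [heX] at ha
  rw [ha]
  refine polyRing_le_laurent ?_
  rw [polyRing, Algebra.adjoin_range_eq_range_aeval]
  exact ⟨a, rfl⟩

/-- The upper bound: elements that are Laurent in the cluster and in all adjacent clusters. -/
def upperBound (t : ExtSeed κ φ F) : Subalgebra ℤ F := t.laurent ⊓ ⨅ k, (t.mutate k).laurent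

lemma mem_upperBound {f : F} :
    f ∈ t.upperBound ↔ f ∈ t.laurent ∧ ∀ k, f ∈ (t.mutate k).laurent := by
  simp [upperBound, Algebra.mem_inf, Algebra.mem_iInf]

lemma IsGood.mutate_mutate (h : t.IsGood) (k : κ) : (t.mutate k).mutate k = t :=
  ExtSeed.mutate_mutate h.skew (h.indep.ne_zero _) (newVar_ne_zero h.indep k)

/-- Among the neighbours of `t.mutate k`, direction `k` returns to `t`, and every other direction is
covered by `mem_laurent_mutate_mutate`. -/
lemma upperBound_le_mutate (h : t.IsGood) (k : κ) : t.upperBound ≤ (t.mutate k).upperBound := by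
  intro f hf
  rw [mem_upperBound] at hf ⊢
  refine ⟨hf.2 k, fun j => ?_⟩
  by_cases hjk : j = k
  · subst hjk; rw [h.mutate_mutate]; exact hf.1
  · exact mem_laurent_mutate_mutate h hjk hf.1 (hf.2 j) (hf.2 k)

lemma upperBound_mutate (h : t.IsGood) (k : κ) : (t.mutate k).upperBound = t.upperBound := by
  refine le_antisymm ?_ (upperBound_le_mutate h k)
  have := upperBound_le_mutate (h.mutate k) k
  rwa [h.mutate_mutate] at this

lemma IsGood.foldl (h : t.IsGood) (l : List κ) : (l.foldl ExtSeed.mutate t).IsGood := by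
  induction l generalizing t with
  | nil => exact h
  | cons k l ih => exact ih (h.mutate k)

lemma upperBound_foldl (h : t.IsGood) (l : List κ) :
    (l.foldl ExtSeed.mutate t).upperBound = t.upperBound := by
  induction l generalizing t with
  | nil => rfl
  | cons k l ih => rw [List.foldl_cons, ih (h.mutate k), upperBound_mutate h]

lemma x_mem_upperBound (h : t.IsGood) (i : κ ⊕ φ) : t.x i ∈ t.upperBound := by
  rw [mem_upperBound]
  refine ⟨x_mem_laurent i, fun k => ?_⟩
  by_cases hi : i = .inl k
  · subst hi
    have := newVar_mutate h.skew (h.indep.ne_zero _) (newVar_ne_zero h.indep k)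
    rw [← this, newVar, div_eq_mul_inv]
    exact mul_mem (binomial_mem _ _ _ fun i _ => x_mem_laurent i) (inv_x_mem_laurent k)
  · rw [← mutate_x_of_ne hi]
    exact x_mem_laurent i

/-- The Laurent phenomenon: all cluster variables lie in the upper bound of the initial seed. -/
lemma x_foldl_mem_upperBound (h : t.IsGood) (l : List κ) (i : κ ⊕ φ) :
    (l.foldl ExtSeed.mutate t).x i ∈ t.upperBound := by
  rw [← upperBound_foldl h l]
  exact x_mem_upperBound (h.foldl l) i

end ExtSeed

/-! ### The tropical semifield inside the field. -/

section Trop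

variable {m : ℕ} {F : Type*} [Field F] [Algebra (ZP (Trop m)) F]

/-- The generator `z_j` of `Trop(z₁, …, zₘ)`. -/
abbrev tropGen (j : Fin m) : Trop m := Multiplicative.ofAdd (Pi.single j 1)

lemma coeff_one : coeff F (1 : Trop m) = 1 := by rw [coeff, map_one, map_one]

lemma coeff_mul (a b : Trop m) : coeff F (a * b) = coeff F a * coeff F b := by
  simp only [coeff, map_mul]

/-- `coeff` as a monoid homomorphism. -/
noncomputable def coeffHom (m : ℕ) (F : Type*) [Field F] [Algebra (ZP (Trop m)) F] : Trop m →* F where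
  toFun := coeff F
  map_one' := coeff_one
  map_mul' := coeff_mul

lemma coeff_ne_zero (a : Trop m) : coeff F a ≠ 0 := by
  intro h
  have := coeff_mul (F := F) a a⁻¹
  rw [h, mul_inv_cancel, coeff_one, zero_mul] at this
  exact one_ne_zero this

lemma ofAdd_eq_prod (a : Fin m → ℤ) (ha : ∀ j, 0 ≤ a j) :
    (Multiplicative.ofAdd a : Trop m) = ∏ j, tropGen j ^ (a j).toNat := by
  apply Multiplicative.toAdd.injective
  rw [toAdd_prod]
  funext i
  rw [toAdd_ofAdd, Finset.sum_apply]
  simp only [toAdd_pow, toAdd_ofAdd, Pi.smul_apply, nsmul_eq_mul]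
  rw [Finset.sum_eq_single i]
  · simp [ha i]
  · intro j _ hj; simp [hj.symm]
  · simp

lemma coeff_ofAdd (a : Fin m → ℤ) (ha : ∀ j, 0 ≤ a j) :
    coeff F (Multiplicative.ofAdd a : Trop m) = ∏ j, coeff F (tropGen j) ^ (a j).toNat := by
  change coeffHom m F _ = _
  rw [ofAdd_eq_prod a ha, map_prod]
  simp only [map_pow]
  rfl

/-- Together with `one_eq_mul_prod`, this says that `y` and `1` share the tropical factor `y ⊕ 1`.
Cancelling it turns the normalized exchange relation into one with polynomial frozen coefficients.
-/
lemma coeff_eq_mul_prod (y : Trop m) : coeff F y =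
    coeff F (SemifieldAdd.oplus y 1) * ∏ j, coeff F (tropGen j) ^ (y.toAdd j).toNat := by
  have h := coeff_ofAdd (F := F) (m := m) (fun j => ((y.toAdd j).toNat : ℤ)) fun j => by positivity
  simp only [Int.toNat_natCast] at h
  rw [← h, ← coeff_mul]
  congr 1
  apply Multiplicative.toAdd.injective
  funext i
  change y.toAdd i = min (y.toAdd i) 0 + ((y.toAdd i).toNat : ℤ)
  omega

lemma one_eq_mul_prod (y : Trop m) : 1 =
    coeff F (SemifieldAdd.oplus y 1) * ∏ j, coeff F (tropGen j) ^ (-y.toAdd j).toNat := by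
  have h := coeff_ofAdd (F := F) (m := m) (fun j => ((-y.toAdd j).toNat : ℤ)) fun j => by positivity
  simp only [Int.toNat_natCast] at h
  rw [← h, ← coeff_mul, ← coeff_one (F := F) (m := m)]
  congr 1
  apply Multiplicative.toAdd.injective
  funext i
  change 0 = min (y.toAdd i) 0 + ((-y.toAdd i).toNat : ℤ)
  omega

end Trop

/-! ### From seeds with tropical coefficients to geometric seeds. -/

namespace Seed

variable {n m : ℕ} {F : Type*} [Field F] [Algebra (ZP (Trop m)) F]

/-- The seed with the frozen variables joined to the cluster. -/
noncomputable def toExt (s : Seed n (Trop m) F) : ExtSeed (Fin n) (Fin m) F where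
  x := Sum.elim s.x fun j => coeff F (tropGen j)
  b := Sum.elim (fun i k => s.B i k) fun i k => (s.y k).toAdd i

lemma toExt_x_inl (s : Seed n (Trop m) F) (i : Fin n) : s.toExt.x (.inl i) = s.x i := rfl

lemma toExt_x_inr (s : Seed n (Trop m) F) (j : Fin m) :
    s.toExt.x (.inr j) = coeff F (tropGen j) := rfl

lemma toExt_b_inl (s : Seed n (Trop m) F) (i k : Fin n) : s.toExt.b (.inl i) k = s.B i k := rfl

lemma toExt_b_inr (s : Seed n (Trop m) F) (j : Fin m) (k : Fin n) :
    s.toExt.b (.inr j) k = (s.y k).toAdd j := rfl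

lemma toExt_newVar (s : Seed n (Trop m) F) (k : Fin n) : s.toExt.newVar k = s.newVar k := by
  unfold ExtSeed.newVar Seed.newVar ClusterAlgebra.binomial posMonomial ExtSeed.col
  rw [Fintype.prod_sum_type, Fintype.prod_sum_type]
  simp only [toExt_x_inl, toExt_x_inr, toExt_b_inl, toExt_b_inr, Pi.neg_apply]
  conv_rhs => rw [coeff_eq_mul_prod (s.y k), ← one_mul (∏ j, s.x j ^ (-s.B j k).toNat),
    one_eq_mul_prod (F := F) (s.y k)]
  rw [show ∀ a b c d e : F, a * b * c + a * d * e = a * (c * b + e * d) by intros; ring]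
  rw [mul_div_mul_left _ _ (coeff_ne_zero _)]

/-- On exponents, tropical mutation of `y` is matrix mutation of the frozen rows: `y ⊕ 1`
contributes `min y 0 = -[-y]₊`. -/
lemma toExt_mutate (s : Seed n (Trop m) F) (k : Fin n) :
    (s.mutate k).toExt = s.toExt.mutate k := by
  have h1 : (s.mutate k).toExt.x = (s.toExt.mutate k).x := by
    funext i
    rcases i with i | i
    · by_cases hi : i = k
      · subst hi
        rw [ExtSeed.mutate_x_self, toExt_newVar, toExt_x_inl]
        exact Function.update_self _ _ _
      · rw [ExtSeed.mutate_x_of_ne (by simpa using hi), toExt_x_inl, toExt_x_inl]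
        exact Function.update_of_ne hi _ _
    · rw [ExtSeed.mutate_x_of_ne (by simp)]
      rfl
  have h2 : (s.mutate k).toExt.b = (s.toExt.mutate k).b := by
    funext i j
    change _ = if i = .inl k ∨ j = k then _ else _
    rcases i with i | i
    · rw [toExt_b_inl]
      change (if i = k ∨ j = k then _ else _) = _
      by_cases hi : i = k ∨ j = k
      · rw [if_pos hi, if_pos (by simpa using hi), toExt_b_inl]
      · rw [if_neg hi, if_neg (by simpa using hi), ExtSeed.mutateEntry_eq]
        rfl
    · rw [toExt_b_inr]
      change (if j = k then _ else _ : Trop m).toAdd i = _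
      by_cases hj : j = k
      · subst hj
        rw [if_pos rfl, if_pos (Or.inr rfl)]
        rfl
      · rw [if_neg hj, if_neg (by simpa using hj), ExtSeed.mutateEntry, toExt_b_inr, toExt_b_inr,
          toExt_b_inl]
        change (s.y j).toAdd i + ((s.B k j).toNat • (s.y k).toAdd) i +
          (-s.B k j) * min ((s.y k).toAdd i) 0 = _
        rw [Pi.smul_apply, nsmul_eq_mul]
        generalize (s.y k).toAdd i = y
        generalize s.B k j = b
        have h3 : (y.toNat : ℤ) = y - min y 0 := by omega
        have h4 : ((-y).toNat : ℤ) = - min y 0 := by omega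
        have h5 := toNat_sub_toNat_neg' b
        rw [h3, h4]
        linear_combination (min y 0) * h5
  exact congrArg₂ ExtSeed.mk h1 h2

lemma toExt_foldl (s : Seed n (Trop m) F) (l : List (Fin n)) :
    (l.foldl mutate s).toExt = l.foldl ExtSeed.mutate s.toExt := by
  induction l generalizing s with
  | nil => rfl
  | cons k l ih => rw [List.foldl_cons, List.foldl_cons, ih, toExt_mutate]

section Rings

variable {s : Seed n (Trop m) F}

lemma algebraMap_ZPplus_mem (a : ZPplus m) : algebraMap (ZPplus m) F a ∈ s.toExt.laurent := by
  obtain ⟨a, ha⟩ := a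
  change algebraMap (ZP (Trop m)) F a ∈ _
  have : ZPplus m ≤ Subring.comap (algebraMap (ZP (Trop m)) F) s.toExt.laurent.toSubring := by
    rw [ZPplus, Subring.closure_le]
    rintro _ ⟨j, rfl⟩
    exact ExtSeed.x_mem_laurent (t := s.toExt) (.inr j)
  exact this ha

lemma coeff_mem_of_ZPplus (A : Subalgebra (ZPplus m) F) (j : Fin m) : coeff F (tropGen j) ∈ A :=
  A.algebraMap_mem ⟨_, Subring.subset_closure ⟨j, rfl⟩⟩

lemma coeff_mem_of_top (A : Subalgebra (⊤ : Subring (ZP (Trop m))) F) (a : Trop m) :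
    coeff F a ∈ A :=
  A.algebraMap_mem (⟨MonoidAlgebra.of ℤ (Trop m) a, trivial⟩ : (⊤ : Subring (ZP (Trop m))))

lemma mem_laurentRing_ZPplus {f : F} : f ∈ s.laurentRing (ZPplus m) ↔ f ∈ s.toExt.laurent := by
  constructor
  · intro hf
    induction hf using Algebra.adjoin_induction with
    | mem y hy =>
      rcases hy with ⟨i, rfl⟩ | ⟨i, rfl⟩
      · exact ExtSeed.x_mem_laurent (t := s.toExt) (.inl i)
      · exact ExtSeed.inv_x_mem_laurent (t := s.toExt) i
    | algebraMap r => exact algebraMap_ZPplus_mem r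
    | add f g _ _ hf hg => exact add_mem hf hg
    | mul f g _ _ hf hg => exact mul_mem hf hg
  · intro hf
    refine ExtSeed.mem_of_mem_laurent (V := (s.laurentRing (ZPplus m)).toSubring) ?_ ?_ hf
    · rintro (i | i)
      · exact Algebra.subset_adjoin (Or.inl ⟨i, rfl⟩)
      · exact coeff_mem_of_ZPplus _ i
    · exact fun i => Algebra.subset_adjoin (Or.inr ⟨i, rfl⟩)

lemma mem_laurentRing_top {f : F} (hf : f ∈ s.toExt.laurent) : f ∈ s.laurentRing ⊤ := by
  refine ExtSeed.mem_of_mem_laurent (V := (s.laurentRing ⊤).toSubring) ?_ ?_ hf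
  · rintro (i | i)
    · exact Algebra.subset_adjoin (Or.inl ⟨i, rfl⟩)
    · exact coeff_mem_of_top _ _
  · exact fun i => Algebra.subset_adjoin (Or.inr ⟨i, rfl⟩)

/-- The product of the frozen variables. -/
noncomputable def frozenProd (m : ℕ) (F : Type*) [Field F] [Algebra (ZP (Trop m)) F] : F :=
  ∏ j : Fin m, coeff F (tropGen j)

lemma frozenProd_mem : frozenProd m F ∈ s.toExt.laurent :=
  prod_mem fun j _ => ExtSeed.x_mem_laurent (t := s.toExt) (.inr j)

lemma exists_coeff_mul_frozenProd_mem (a : Trop m) :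
    ∃ N : ℕ, coeff F a * frozenProd m F ^ N ∈ s.toExt.laurent := by
  obtain ⟨N, hN⟩ : ∃ N : ℕ, ∀ j, 0 ≤ a.toAdd j + N := by
    refine ⟨∑ j, (a.toAdd j).natAbs, fun j => ?_⟩
    have := Finset.single_le_sum (f := fun j => (a.toAdd j).natAbs) (fun _ _ => Nat.zero_le _)
      (Finset.mem_univ j)
    omega
  refine ⟨N, ?_⟩
  have h1 : frozenProd m F ^ N = coeff F (Multiplicative.ofAdd (fun _ => (N : ℤ)) : Trop m) := by
    rw [coeff_ofAdd _ fun _ => by positivity, frozenProd, ← Finset.prod_pow]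
    simp
  rw [h1, ← coeff_mul]
  have h2 : a * (Multiplicative.ofAdd (fun _ => (N : ℤ)) : Trop m) =
      Multiplicative.ofAdd fun j => a.toAdd j + N := rfl
  rw [h2, coeff_ofAdd _ hN]
  exact prod_mem fun j _ => pow_mem (ExtSeed.x_mem_laurent (t := s.toExt) (.inr j)) _

lemma exists_mul_frozenProd_mem {f : F} (hf : f ∈ s.laurentRing ⊤) :
    ∃ N : ℕ, f * frozenProd m F ^ N ∈ s.toExt.laurent := by
  have hz := frozenProd_mem (s := s)
  have hadd : ∀ f g : F, (∃ N : ℕ, f * frozenProd m F ^ N ∈ s.toExt.laurent) →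
      (∃ N : ℕ, g * frozenProd m F ^ N ∈ s.toExt.laurent) →
      ∃ N : ℕ, (f + g) * frozenProd m F ^ N ∈ s.toExt.laurent := by
    rintro f g ⟨N, hN⟩ ⟨M, hM⟩
    refine ⟨N + M, ?_⟩
    have := add_mem (mul_mem hN (pow_mem hz M)) (mul_mem hM (pow_mem hz N))
    refine (congrArg (· ∈ s.toExt.laurent) ?_).mp this
    ring
  induction hf using Algebra.adjoin_induction with
  | mem y hy =>
    refine ⟨0, ?_⟩
    rw [pow_zero, mul_one]
    rcases hy with ⟨i, rfl⟩ | ⟨i, rfl⟩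
    · exact ExtSeed.x_mem_laurent (t := s.toExt) (.inl i)
    · exact ExtSeed.inv_x_mem_laurent (t := s.toExt) i
  | algebraMap r =>
    obtain ⟨r, hr⟩ := r
    change ∃ N : ℕ, algebraMap (ZP (Trop m)) F r * frozenProd m F ^ N ∈ s.toExt.laurent
    clear hr
    induction r using MonoidAlgebra.induction_on with
    | of g => exact exists_coeff_mul_frozenProd_mem g
    | add f g hf hg => rw [map_add]; exact hadd _ _ hf hg
    | smul r f hf =>
      obtain ⟨N, hN⟩ := hf
      refine ⟨N, ?_⟩
      rw [zsmul_eq_mul, map_mul, map_intCast, mul_assoc]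
      exact mul_mem (intCast_mem _ r) hN
  | add f g _ _ hf hg => exact hadd f g hf hg
  | mul f g _ _ hf hg =>
    obtain ⟨N, hN⟩ := hf
    obtain ⟨M, hM⟩ := hg
    refine ⟨N + M, ?_⟩
    refine (congrArg (· ∈ s.toExt.laurent) ?_).mp (mul_mem hN hM)
    ring

lemma laurentRing_relabel (A : Subring (ZP (Trop m))) (s : Seed n (Trop m) F)
    (σ : Equiv.Perm (Fin n)) : (s.relabel σ).laurentRing A = s.laurentRing A := by
  have h1 : Set.range (s.relabel σ).x = Set.range s.x := σ.surjective.range_comp s.x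
  have h2 : (Set.range fun i => ((s.relabel σ).x i)⁻¹) = Set.range fun i => (s.x i)⁻¹ :=
    σ.surjective.range_comp fun i => (s.x i)⁻¹
  rw [laurentRing, laurentRing, h1, h2]

lemma mem_upperClusterAlgebra (A : Subring (ZP (Trop m))) {f : F} :
    f ∈ s.upperClusterAlgebra A ↔ ∀ l : List (Fin n), f ∈ (l.foldl mutate s).laurentRing A := by
  rw [upperClusterAlgebra, Algebra.mem_iInf]
  constructor
  · intro h l
    exact h ⟨l.foldl mutate s, l, 1, rfl⟩
  · rintro h ⟨_, l, σ, rfl⟩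
    rw [laurentRing_relabel]
    exact h l

lemma mem_clusterVariables {v : F} : v ∈ s.clusterVariables ↔
    ∃ (l : List (Fin n)) (i : Fin n), v = (l.foldl ExtSeed.mutate s.toExt).x (.inl i) := by
  constructor
  · rintro ⟨_, ⟨l, σ, rfl⟩, i, rfl⟩
    exact ⟨l, σ i, by rw [← toExt_foldl]; rfl⟩
  · rintro ⟨l, i, rfl⟩
    refine ⟨l.foldl mutate s, ⟨l, 1, rfl⟩, i, ?_⟩
    rw [← toExt_foldl]; rfl

/-- Invariance of the upper bound reduces the intersection over all seeds to the initial seed and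
its neighbours. -/
lemma mem_upperClusterAlgebra_ZPplus (h : s.toExt.IsGood) {f : F} :
    f ∈ s.upperClusterAlgebra (ZPplus m) ↔ f ∈ s.toExt.upperBound := by
  rw [mem_upperClusterAlgebra]
  simp only [mem_laurentRing_ZPplus, toExt_foldl]
  constructor
  · intro hf
    rw [ExtSeed.mem_upperBound]
    exact ⟨hf [], fun k => hf [k]⟩
  · intro hf l
    rw [← ExtSeed.upperBound_foldl h l, ExtSeed.mem_upperBound] at hf
    exact hf.1

/-- Only finitely many Laurent rings define the upper bound, so one power of the frozen product
clears the negative frozen exponents in all of them. -/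
lemma exists_mul_frozenProd_mem_upperBound {f : F} (hf : f ∈ s.upperClusterAlgebra ⊤) :
    ∃ N : ℕ, f * frozenProd m F ^ N ∈ s.toExt.upperBound := by
  rw [mem_upperClusterAlgebra] at hf
  have h1 : ∀ l : List (Fin n), ∃ N : ℕ, f * frozenProd m F ^ N ∈
      (l.foldl ExtSeed.mutate s.toExt).laurent := fun l => by
    rw [← toExt_foldl]
    exact exists_mul_frozenProd_mem (hf l)
  choose N hN using h1
  have hmono : ∀ (l : List (Fin n)) (M : ℕ), N l ≤ M →
      f * frozenProd m F ^ M ∈ (l.foldl ExtSeed.mutate s.toExt).laurent := by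
    intro l M hM
    rw [← Nat.add_sub_cancel' hM, pow_add, ← mul_assoc]
    refine mul_mem (hN l) (pow_mem ?_ _)
    rw [← toExt_foldl]
    exact frozenProd_mem
  refine ⟨N [] + ∑ k, N [k], ?_⟩
  rw [ExtSeed.mem_upperBound]
  refine ⟨hmono [] _ (Nat.le_add_right _ _), fun k => hmono [k] _ ?_⟩
  exact (Finset.single_le_sum (f := fun k => N [k]) (fun _ _ => Nat.zero_le _)
    (Finset.mem_univ k)).trans (Nat.le_add_left _ _)

lemma clusterAlgebra_le_upperClusterAlgebra_ZPplus (h : s.toExt.IsGood) :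
    s.clusterAlgebra (ZPplus m) ≤ s.upperClusterAlgebra (ZPplus m) := by
  refine Algebra.adjoin_le fun v hv => ?_
  obtain ⟨l, i, rfl⟩ := mem_clusterVariables.1 hv
  exact (mem_upperClusterAlgebra_ZPplus h).2 (ExtSeed.x_foldl_mem_upperBound h l _)

lemma clusterAlgebra_le_upperClusterAlgebra_top (h : s.toExt.IsGood) :
    s.clusterAlgebra ⊤ ≤ s.upperClusterAlgebra ⊤ := by
  refine Algebra.adjoin_le fun v hv => ?_
  obtain ⟨l, i, rfl⟩ := mem_clusterVariables.1 hv
  have h1 := (mem_upperClusterAlgebra_ZPplus h).2 (ExtSeed.x_foldl_mem_upperBound h l (.inl i))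
  rw [mem_upperClusterAlgebra] at h1
  refine (mem_upperClusterAlgebra _).2 fun l' => ?_
  exact mem_laurentRing_top (mem_laurentRing_ZPplus.1 (h1 l'))

end Rings

section Independence

/-- Distinct monomials in the generators are distinct group elements, so the coefficients of a
polynomial can be read off from its value in the group ring. -/
lemma algebraicIndependent_tropGen (hF : Function.Injective (algebraMap (ZP (Trop m)) F)) :
    AlgebraicIndependent ℤ fun j : Fin m => coeff F (tropGen j) := by
  have key : ∀ (P : MvPolynomial (Fin m) ℤ) (d : Fin m →₀ ℕ),
      (aeval (fun j : Fin m => MonoidAlgebra.of ℤ (Trop m) (tropGen j)) P).coeff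
        (Multiplicative.ofAdd fun j => (d j : ℤ)) = P.coeff d := by
    intro P d
    induction P using MvPolynomial.induction_on' with
    | monomial u a =>
      have h : (u.prod fun j k => MonoidAlgebra.of ℤ (Trop m) (tropGen j) ^ k) =
          MonoidAlgebra.of ℤ (Trop m) (Multiplicative.ofAdd fun j => (u j : ℤ)) := by
        rw [ofAdd_eq_prod _ fun j => by positivity, map_prod,
          Finsupp.prod_fintype _ _ fun _ => pow_zero _]
        simp
      rw [aeval_monomial, MvPolynomial.coeff_monomial, h, ← Algebra.smul_def,
        MonoidAlgebra.coeff_smul, Finsupp.smul_apply, MonoidAlgebra.of_apply,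
        MonoidAlgebra.coeff_single, Finsupp.single_apply]
      have h' : (Multiplicative.ofAdd (fun j => (u j : ℤ)) : Trop m) =
          Multiplicative.ofAdd (fun j => (d j : ℤ)) ↔ u = d := by
        rw [Multiplicative.ofAdd.injective.eq_iff, Finsupp.ext_iff, _root_.funext_iff]
        simp
      simp only [h']
      split_ifs <;> simp
    | add p q hp hq => rw [map_add, MvPolynomial.coeff_add, ← hp, ← hq]; rfl
  have h1 : AlgebraicIndependent ℤ fun j : Fin m => MonoidAlgebra.of ℤ (Trop m) (tropGen j) := by
    rw [algebraicIndependent_iff]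
    intro P hP
    ext d
    rw [← key, hP]
    rfl
  exact h1.map' (f := (algebraMap (ZP (Trop m)) F).toIntAlgHom) hF

lemma algebraicIndependent_toExt (hF : Function.Injective (algebraMap (ZP (Trop m)) F))
    {s : Seed n (Trop m) F} (hs : s.IsSeed) : AlgebraicIndependent ℤ s.toExt.x := by
  have h1 := algebraicIndependent_tropGen hF
  have h2 : AlgebraicIndependent ℤ (Sum.elim s.x fun j : Fin m => coeff F (tropGen j)) := by
    refine h1.sumElim_of_tower (S := fracZP (Trop m) F) ?_ hs.algebraicIndependent
    rintro _ ⟨j, rfl⟩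
    exact ⟨⟨_, Subfield.subset_closure ⟨_, rfl⟩⟩, rfl⟩
  exact h2

end Independence

end Seed

/-! ### Independence from transcendence degree. -/

section Transcendence

variable {ι ι' : Type} {F : Type*} [Finite ι] [Field F]

/-- The ring generated by `v` has transcendence degree at least the number of the `x i`, hence at
least the number of its generators, which must then form a transcendence basis. -/
lemma algebraicIndependent_of_mem_adjoin {x : ι' → F} {v : ι → F} (hcard : Cardinal.mk ι ≤ Cardinal.mk ι')
    (hx : AlgebraicIndependent ℤ x) (h : ∀ i, x i ∈ Algebra.adjoin ℤ (Set.range v)) :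
    AlgebraicIndependent ℤ v := by
  let A := Algebra.adjoin ℤ (Set.range v)
  let w : ι → A := fun i => ⟨v i, Algebra.subset_adjoin ⟨i, rfl⟩⟩
  let y : ι' → A := fun i => ⟨x i, h i⟩
  have hinj : Function.Injective A.val := Subtype.val_injective
  have hy : AlgebraicIndependent ℤ y := AlgebraicIndependent.of_comp A.val hx
  have hw : Algebra.adjoin ℤ (Set.range w) = ⊤ := by
    rw [← Algebra.adjoin_adjoin_coe_preimage]
    congr 1
    ext a
    simp [w, Subtype.ext_iff]
  have : FaithfulSMul ℤ A := (faithfulSMul_iff_algebraMap_injective ℤ A).2 hy.algebraMap_injective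
  have : Algebra.IsAlgebraic (Algebra.adjoin ℤ (Set.range w)) A := by
    refine ⟨fun a => ?_⟩
    have ha : a ∈ Algebra.adjoin ℤ (Set.range w) := hw ▸ trivial
    exact isAlgebraic_algebraMap (⟨a, ha⟩ : Algebra.adjoin ℤ (Set.range w))
  have h1 : IsTranscendenceBasis ℤ w := by
    refine Algebra.IsAlgebraic.isTranscendenceBasis_of_lift_le_trdeg_of_finite ℤ w ?_
    exact (Cardinal.lift_le.2 hcard).trans hy.lift_cardinalMk_le_trdeg
  exact h1.1.map' (f := A.val) hinj

end Transcendence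

/-! ### Nine coordinates for the Cremmer–Gervais seed. -/

/-- The cluster and the frozen variables of the Cremmer–Gervais seed as polynomials in nine
coordinates. -/
def coord {R : Type*} [CommRing R] (v : Fin 9 → R) : Fin 6 ⊕ Fin 3 → R :=
  let p := v 0
  let q := v 1
  let r := v 2
  let p' := v 3
  let q' := v 4
  let r' := v 5
  let f := v 6
  let g := v 7
  let h := v 8
  Sum.elim
    ![p, -f * (h * r - p' * g) + q * (r' * p' - r * q'), f * r - q * g, h * r - p' * g, q, r]
    ![-(-f * (h * r - p' * g) + q * (r' * p' - r * q')) * r' -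
        p * ((r' * p' - r * q') * r - g * (h * r - p' * g)),
      -p * (g * p' - r * h) - f * (r' * p' - r * q') + q * (r' * h - g * q'),
      r * r' - p * p']

/-- The new variables of the neighbours of the Cremmer–Gervais seed in the same coordinates. -/
def coordNew {R : Type*} [CommRing R] (v : Fin 9 → R) : Fin 6 → R :=
  let p := v 0
  let q := v 1
  let r := v 2
  let p' := v 3
  let q' := v 4
  let r' := v 5
  let f := v 6
  let g := v 7
  let h := v 8
  ![q * r * p' * q' - q * p' ^ 2 * r' + r ^ 3 * q' - r ^ 2 * p' * r' + r ^ 2 * g * h +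
      r * p' * f * h - r * p' * g ^ 2 - p' ^ 2 * f * g,
    -p * r - q * r',
    -p * r ^ 2 * h ^ 2 + 2 * p * r * p' * g * h - p * p' ^ 2 * g ^ 2 - q * r ^ 2 * q' ^ 2 +
      2 * q * r * p' * q' * r' - q * p' ^ 2 * r' ^ 2 - r ^ 2 * q' * f * h + r * p' * q' * f * g +
      r * p' * r' * f * h - p' ^ 2 * r' * f * g,
    p * q * r + q ^ 2 * r' + q * f * g - r * f ^ 2,
    (r' * p' - r * q') * r - g * (h * r - p' * g),
    p * q * h - p * p' * f - q * r' * g + r * r' * f]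

/-- The extended exchange matrix of the Cremmer–Gervais seed. -/
def cgMatrix : Fin 6 ⊕ Fin 3 → Fin 6 → ℤ :=
  Sum.elim
    ![![0, 1, 0, 0, 0, -1], ![-1, 0, -1, -1, 1, 0], ![0, 1, 0, -1, -1, 1], ![0, 1, 1, 0, -1, -1],
      ![0, -1, 1, 1, 0, -1], ![1, 0, -1, 1, 1, 0]]
    ![![1, -1, 1, 0, 0, 0], ![0, 0, -1, 1, 0, 0], ![-1, 0, 0, 0, 0, 1]]

/-- A form compatible with `cgMatrix`. -/
def cgForm : Fin 6 ⊕ Fin 3 → Fin 6 ⊕ Fin 3 → ℤ :=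
  Sum.elim
    ![Sum.elim ![0, 0, 1, -1, 2, 0] ![-2, -1, 0], Sum.elim ![0, 0, -2, 0, -2, -2] ![2, 2, 0],
      Sum.elim ![-1, 2, 0, 2, -1, 0] ![2, 3, 0], Sum.elim ![1, 0, -2, 0, -3, -2] ![2, 1, 0],
      Sum.elim ![-2, 2, 1, 3, 0, 0] ![2, 3, 0], Sum.elim ![0, 2, 0, 2, 0, 0] ![2, 2, 0]]
    ![Sum.elim ![2, -2, -2, -2, -2, -2] ![0, 0, 0], Sum.elim ![1, -2, -3, -1, -3, -2] ![0, 0, 0],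
      0]

lemma map_coord {R S : Type*} [CommRing R] [CommRing S] (φ : R →+* S) (v : Fin 9 → R)
    (i : Fin 6 ⊕ Fin 3) : φ (coord v i) = coord (fun j => φ (v j)) i := by
  rcases i with i | i <;> fin_cases i <;> simp [coord]

lemma map_coordNew {R S : Type*} [CommRing R] [CommRing S] (φ : R →+* S) (v : Fin 9 → R)
    (i : Fin 6) : φ (coordNew v i) = coordNew (fun j => φ (v j)) i := by
  have h2 : φ 2 = 2 := map_ofNat φ 2
  fin_cases i <;> simp [coordNew, h2]

lemma coord_mul_coordNew {R : Type*} [CommRing R] (v : Fin 9 → R) (k : Fin 6) :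
    coord v (.inl k) * coordNew v k = binomial (coord v) (fun i => cgMatrix i k) := by
  unfold binomial posMonomial
  rw [Fintype.prod_sum_type, Fintype.prod_sum_type]
  fin_cases k <;>
  · simp [coord, coordNew, cgMatrix, Fin.prod_univ_succ]
    ring

section Field

variable {F : Type*} [Field F]

/-- The parametrization is inverted one unknown at a time, each equation being linear in the next
coordinate with a cluster variable as leading coefficient. The auxiliary `a1` and `a3` are the
exchange partners in directions `1` and `3`. -/
lemma exists_coord_eq {X : Fin 6 ⊕ Fin 3 → F} (hX : ∀ i, X i ≠ 0) :
    ∃ v : Fin 9 → F, coord v = X := by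
  obtain ⟨a1, h1⟩ : ∃ a, X (.inl 1) * a =
      X (.inl 0) * X (.inl 2) * X (.inl 3) + X (.inl 4) * X (.inr 0) :=
    ⟨_, mul_div_cancel₀ _ (hX _)⟩
  obtain ⟨a3, h3⟩ : ∃ a, X (.inl 3) * a =
      X (.inl 4) * X (.inl 5) * X (.inr 1) + X (.inl 1) * X (.inl 2) :=
    ⟨_, mul_div_cancel₀ _ (hX _)⟩
  obtain ⟨r', hr'⟩ : ∃ a, X (.inl 4) * a = -(a1 + X (.inl 0) * X (.inl 5)) :=
    ⟨_, mul_div_cancel₀ _ (hX _)⟩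
  obtain ⟨f, hf⟩ : ∃ a, X (.inl 2) * a = -(a3 + X (.inl 4) * a1) := ⟨_, mul_div_cancel₀ _ (hX _)⟩
  obtain ⟨g, hg⟩ : ∃ a, X (.inl 4) * a = X (.inl 5) * f - X (.inl 2) := ⟨_, mul_div_cancel₀ _ (hX _)⟩
  obtain ⟨p', hp'⟩ : ∃ a, X (.inl 0) * a = X (.inl 5) * r' - X (.inr 2) :=
    ⟨_, mul_div_cancel₀ _ (hX _)⟩
  obtain ⟨h, hh⟩ : ∃ a, X (.inl 5) * a = X (.inl 3) + p' * g := ⟨_, mul_div_cancel₀ _ (hX _)⟩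
  obtain ⟨Q, hQ⟩ : ∃ a, X (.inl 4) * a = X (.inl 1) + f * X (.inl 3) := ⟨_, mul_div_cancel₀ _ (hX _)⟩
  obtain ⟨q', hq'⟩ : ∃ a, X (.inl 5) * a = r' * p' - Q := ⟨_, mul_div_cancel₀ _ (hX _)⟩
  let v : Fin 9 → F := ![X (.inl 0), X (.inl 4), X (.inl 5), p', q', r', f, g, h]
  refine ⟨v, ?_⟩
  have e0 : coord v (.inl 0) = X (.inl 0) := rfl
  have e4 : coord v (.inl 4) = X (.inl 4) := rfl
  have e5 : coord v (.inl 5) = X (.inl 5) := rfl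
  have e2 : coord v (.inl 2) = X (.inl 2) := by
    change f * X (.inl 5) - X (.inl 4) * g = _
    linear_combination -hg
  have e3 : coord v (.inl 3) = X (.inl 3) := by
    change h * X (.inl 5) - p' * g = _
    linear_combination hh
  have e1 : coord v (.inl 1) = X (.inl 1) := by
    change -f * (h * X (.inl 5) - p' * g) + X (.inl 4) * (r' * p' - X (.inl 5) * q') = _
    linear_combination -f * hh - X (.inl 4) * hq' + hQ
  have e8 : coord v (.inr 2) = X (.inr 2) := by
    change X (.inl 5) * r' - X (.inl 0) * p' = _
    linear_combination -hp'
  have n1 : coordNew v 1 = a1 := by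
    change -X (.inl 0) * X (.inl 5) - X (.inl 4) * r' = _
    linear_combination -hr'
  have n3 : coordNew v 3 = a3 := by
    have : coordNew v 3 = -(v 1) * coordNew v 1 - v 6 * coord v (.inl 2) := by
      simp [coordNew, coord]; ring
    rw [this, n1, e2]
    change -X (.inl 4) * a1 - f * X (.inl 2) = _
    linear_combination -hf
  have c1 := coord_mul_coordNew v 1
  have c3 := coord_mul_coordNew v 3
  unfold binomial posMonomial at c1 c3
  rw [Fintype.prod_sum_type, Fintype.prod_sum_type] at c1 c3
  simp [Fin.prod_univ_succ, cgMatrix, e0, e1, e2, e3, e4, e5, n1, n3] at c1 c3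
  -- The first two frozen variables were not solved for directly. They are recovered from the
  -- exchange relations in directions `1` and `3`, whose other terms already agree.
  have e6 : coord v (.inr 0) = X (.inr 0) := by
    apply mul_left_cancel₀ (hX (.inl 4))
    linear_combination h1 - c1
  have e7 : coord v (.inr 1) = X (.inr 1) := by
    apply mul_left_cancel₀ (mul_ne_zero (hX (.inl 4)) (hX (.inl 5)))
    linear_combination h3 - c3
  funext i
  rcases i with i | i <;> fin_cases i
  exacts [e0, e1, e2, e3, e4, e5, e6, e7, e8]

end Field

/-! ### The initial seed in these coordinates. -/

section Seed

variable {F : Type*} [Field F] [Algebra (ZP (Trop 3)) F]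

lemma toExt_cremmerGervaisSeed_b (x : Fin 6 → F) :
    (cremmerGervaisSeed x).toExt.b = cgMatrix := by
  funext i k
  rcases i with i | i
  · rw [Seed.toExt_b_inl]
    change ((cremmerGervaisQuiver.arrows _ _ : ℤ) - cremmerGervaisQuiver.arrows _ _) = _
    revert i k
    decide
  · rw [Seed.toExt_b_inr]
    change ((cremmerGervaisQuiver.arrows _ _ : ℤ) - cremmerGervaisQuiver.arrows _ _) = _
    revert i k
    decide

lemma isSkew_of_b_eq {F : Type*} {t : ExtSeed (Fin 6) (Fin 3) F} (h : t.b = cgMatrix) :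
    t.IsSkew := by
  unfold ExtSeed.IsSkew
  rw [h]
  decide

lemma coord_mem_adjoin {R : Type*} [CommRing R] (v : Fin 9 → R) (i : Fin 6 ⊕ Fin 3) :
    coord v i ∈ Algebra.adjoin ℤ (Set.range v) := by
  have h := map_coord (aeval (R := ℤ) v).toRingHom X i
  simp only [AlgHom.toRingHom_eq_coe, RingHom.coe_coe, aeval_X] at h
  rw [← h, Algebra.adjoin_range_eq_range_aeval]
  exact ⟨_, rfl⟩

lemma exists_algebraicIndependent_coord {F : Type*} [Field F] {X : Fin 6 ⊕ Fin 3 → F}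
    (h : AlgebraicIndependent ℤ X) :
    ∃ v : Fin 9 → F, AlgebraicIndependent ℤ v ∧ X = coord v := by
  obtain ⟨v, rfl⟩ := exists_coord_eq h.ne_zero
  exact ⟨v, algebraicIndependent_of_mem_adjoin (by simp) h (coord_mem_adjoin v), rfl⟩

lemma isCompatible_of_b_eq {F : Type*} [Field F] {t : ExtSeed (Fin 6) (Fin 3) F} (h : t.b = cgMatrix) :
    t.IsCompatible 2 cgForm where
  skew := by decide
  sum_eq := by
    rw [h]
    decide

end Seed

/-! ### Irreducibility and coprimality of the initial cluster variables. -/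

section Coordinates

lemma eval_coord (a : Fin 9 → ℤ) (i : Fin 6 ⊕ Fin 3) : eval a (coord X i) = coord a i := by
  rw [map_coord]
  simp only [eval_X]

lemma eval_coordNew (a : Fin 9 → ℤ) (i : Fin 6) : eval a (coordNew X i) = coordNew a i := by
  rw [map_coordNew]
  simp only [eval_X]

/-- Points at which precisely one of the cluster variables vanishes. -/
def separatingPoint : Fin 6 → Fin 9 → ℤ :=
  ![![0, 1, 1, 0, 0, 0, 1, 2, 1], ![1, 1, 1, 0, 0, 0, 0, 1, 1], ![1, 1, 1, 0, 0, 0, 1, 1, 1],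
    ![1, 1, 1, 0, 1, 0, 0, 1, 0], ![1, 0, 1, 0, 0, 0, 1, 1, 1], ![1, 1, 0, 1, 0, 0, 1, 1, 0]]

lemma coord_separatingPoint_self (k : Fin 6) : coord (separatingPoint k) (.inl k) = 0 := by
  revert k; decide

lemma coord_separatingPoint_of_ne {k j : Fin 6} (h : j ≠ k) :
    coord (separatingPoint k) (.inl j) ≠ 0 := by
  revert k j; decide

lemma coordNew_separatingPoint (k : Fin 6) : coordNew (separatingPoint k) k ≠ 0 := by
  revert k; decide

lemma not_dvd_of_eval {σ : Type*} {f g : MvPolynomial σ ℤ} (a : σ → ℤ) (hf : eval a f = 0)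
    (hg : eval a g ≠ 0) : ¬ f ∣ g := fun ⟨c, hc⟩ => hg (by rw [hc, map_mul, hf, zero_mul])

lemma not_coord_dvd_coord {k j : Fin 6} (h : j ≠ k) :
    ¬ (coord X (.inl k) : MvPolynomial (Fin 9) ℤ) ∣ coord X (.inl j) :=
  not_dvd_of_eval (separatingPoint k) (by rw [eval_coord, coord_separatingPoint_self])
    (by rw [eval_coord]; exact coord_separatingPoint_of_ne h)

lemma not_coord_dvd_coordNew (k : Fin 6) :
    ¬ (coord X (.inl k) : MvPolynomial (Fin 9) ℤ) ∣ coordNew X k :=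
  not_dvd_of_eval (separatingPoint k) (by rw [eval_coord, coord_separatingPoint_self])
    (by rw [eval_coordNew]; exact coordNew_separatingPoint k)

lemma irreducible_mul_X_add_of_supported {σ : Type*} {f g : MvPolynomial σ ℤ} (i : σ)
    (hf : Irreducible f) (hif : f ∈ supported ℤ {i}ᶜ) (hig : g ∈ supported ℤ {i}ᶜ)
    (h : ¬ f ∣ g) : Irreducible (f * X i + g) :=
  irreducible_mul_X_add f g i hf.ne_zero (fun hi => mem_supported.1 hif hi rfl)
    (fun hi => mem_supported.1 hig hi rfl) (hf.isRelPrime_iff_not_dvd.2 h)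

/-- Each is a coordinate or, up to sign, linear in one coordinate with an irreducible leading
coefficient; a point where that coefficient vanishes and the rest does not shows coprimality. -/
lemma irreducible_coord (k : Fin 6) : Irreducible (coord X (.inl k) : MvPolynomial (Fin 9) ℤ) := by
  have hX : ∀ i j : Fin 9, i ≠ j → (X i : MvPolynomial (Fin 9) ℤ) ∈ supported ℤ {j}ᶜ :=
    fun i j h => X_mem_supported.2 h
  have hI : ∀ i, Irreducible (X i : MvPolynomial (Fin 9) ℤ) := fun i => X_prime.irreducible
  have h2 : Irreducible (coord X (.inl 2) : MvPolynomial (Fin 9) ℤ) := by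
    have : (coord X (.inl 2) : MvPolynomial (Fin 9) ℤ) = X 2 * X 6 + -(X 1 * X 7) := by
      simp [coord]; ring
    rw [this]
    refine irreducible_mul_X_add_of_supported 6 (hI 2) (hX _ _ (by decide))
      (neg_mem (mul_mem (hX _ _ (by decide)) (hX _ _ (by decide))))
      (not_dvd_of_eval ![0, 1, 0, 0, 0, 0, 0, 1, 0] (by simp) (by simp))
  have h3 : Irreducible (coord X (.inl 3) : MvPolynomial (Fin 9) ℤ) := by
    have : (coord X (.inl 3) : MvPolynomial (Fin 9) ℤ) = X 2 * X 8 + -(X 3 * X 7) := by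
      simp [coord]; ring
    rw [this]
    refine irreducible_mul_X_add_of_supported 8 (hI 2) (hX _ _ (by decide))
      (neg_mem (mul_mem (hX _ _ (by decide)) (hX _ _ (by decide))))
      (not_dvd_of_eval ![0, 0, 0, 1, 0, 0, 0, 1, 0] (by simp) (by simp))
  fin_cases k
  · exact hI 0
  · have : (coord X (.inl 1) : MvPolynomial (Fin 9) ℤ) =
        -(coord X (.inl 3) * X 6 + -(X 1 * (X 5 * X 3 - X 2 * X 4))) := by
      simp [coord]; ring
    change Irreducible (coord X (.inl 1) : MvPolynomial (Fin 9) ℤ)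
    rw [this]
    refine (Associated.refl _).neg_right.irreducible ?_
    refine irreducible_mul_X_add_of_supported 6 h3 ?_ ?_ ?_
    · exact sub_mem (mul_mem (hX _ _ (by decide)) (hX _ _ (by decide)))
        (mul_mem (hX _ _ (by decide)) (hX _ _ (by decide)))
    · exact neg_mem (mul_mem (hX _ _ (by decide)) (sub_mem
        (mul_mem (hX _ _ (by decide)) (hX _ _ (by decide)))
        (mul_mem (hX _ _ (by decide)) (hX _ _ (by decide)))))
    · exact not_dvd_of_eval ![0, 1, 0, 1, 0, 1, 0, 0, 0] (by rw [eval_coord]; decide) (by simp)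
  · exact h2
  · exact h3
  · exact hI 1
  · exact hI 2

end Coordinates

/-! ### The upper bound lies in the polynomial ring. -/

namespace ExtSeed

variable {F : Type*} [Field F] {t : ExtSeed (Fin 6) (Fin 3) F} {v : Fin 9 → F}

lemma newVar_eq_coordNew (hv : AlgebraicIndependent ℤ t.x) (hx : t.x = coord v)
    (hb : t.b = cgMatrix) (k : Fin 6) : t.newVar k = coordNew v k := by
  apply mul_left_cancel₀ (x_ne_zero hv (.inl k))
  rw [x_mul_newVar hv, hx, coord_mul_coordNew]
  congr 1
  funext i
  rw [col, hb]

/-- Integrality is tested at every prime of the factorial ring `ℤ[v]`. A prime dividing no cluster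
variable is handled by the initial Laurent expansion, and one dividing `coord X (.inl k)` by the
expansion in the neighbour in direction `k`, all of whose mutable variables are units there. -/
lemma upperBound_le_range (hg : t.IsGood) (hv : AlgebraicIndependent ℤ v) (hx : t.x = coord v)
    (hb : t.b = cgMatrix) {f : F} (hf : f ∈ t.upperBound) : ∃ a, f = aeval (R := ℤ) v a := by
  have he : Function.Injective (aeval (R := ℤ) v).toRingHom := hv
  have hc : ∀ i, (aeval (R := ℤ) v).toRingHom (coord X i) = t.x i := by
    intro i
    rw [map_coord, hx]
    simp
  have hn : ∀ k, (aeval (R := ℤ) v).toRingHom (coordNew X k) = t.newVar k := by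
    intro k
    rw [map_coordNew, newVar_eq_coordNew hg.indep hx hb]
    simp
  have hx0 : ∀ i, t.x i ≠ 0 := hg.indep.ne_zero
  rw [mem_upperBound] at hf
  refine exists_eq_of_forall_prime he ?_ ?_
  · obtain ⟨N, hN⟩ := exists_mul_prod_pow_mem (fun j => hx0 _) hf.1
    have h1 : t.polyRing ≤ (aeval (R := ℤ) v).range := by
      refine Algebra.adjoin_le ?_
      rintro _ ⟨i, rfl⟩
      exact ⟨_, hc i⟩
    obtain ⟨a, ha⟩ := h1 hN
    refine ⟨a, (∏ j : Fin 6, coord X (.inl j)) ^ N, ?_, ?_⟩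
    · exact pow_ne_zero _ (Finset.prod_ne_zero_iff.2 fun j _ => (irreducible_coord j).ne_zero)
    · simp only [map_pow, map_prod, hc]
      exact ha.symm
  · intro π hπ
    by_cases h : ∀ j : Fin 6, ¬ π ∣ coord X (.inl j)
    · refine mem_of_mem_laurent (fun i => hc i ▸ map_mem_localSubring hπ _) (fun j => ?_) hf.1
      rw [← hc]
      exact ((isUnitAt_map (h j) hπ).inv he).mem hπ
    · push Not at h
      obtain ⟨k, hk⟩ := h
      have hass : Associated π (coord X (.inl k)) :=
        hπ.irreducible.associated_of_dvd (irreducible_coord k) hk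
      refine mem_of_mem_laurent (t := t.mutate k) (fun i => ?_) (fun j => ?_) (hf.2 k)
      · by_cases hi : i = .inl k
        · subst hi
          rw [mutate_x_self, ← hn]
          exact map_mem_localSubring hπ _
        · rw [mutate_x_of_ne hi, ← hc]
          exact map_mem_localSubring hπ _
      · by_cases hj : j = k
        · subst hj
          rw [mutate_x_self, ← hn]
          exact ((isUnitAt_map (fun h => not_coord_dvd_coordNew j
            (hass.dvd_iff_dvd_left.1 h)) hπ).inv he).mem hπ
        · rw [mutate_x_of_ne (by simpa using hj), ← hc]
          exact ((isUnitAt_map (fun h => not_coord_dvd_coord hj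
            (hass.dvd_iff_dvd_left.1 h)) hπ).inv he).mem hπ

end ExtSeed

/-! ### Explicit mutation sequences. -/

namespace ExtSeed

variable {F : Type*} [Field F] {t : ExtSeed (Fin 6) (Fin 3) F} {v : Fin 9 → F}

/-- Mutation of extended exchange matrices. -/
def mutateMatrix (B : Fin 6 ⊕ Fin 3 → Fin 6 → ℤ) (k : Fin 6) : Fin 6 ⊕ Fin 3 → Fin 6 → ℤ :=
  fun i j => if i = .inl k ∨ j = k then -B i j else mutateEntry (B i j) (B i k) (B (.inl k) j)

/-- The cluster and exchange matrix reached from `t` by a sequence of mutations. -/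
structure Reaches (t : ExtSeed (Fin 6) (Fin 3) F) (v : Fin 9 → F) (l : List (Fin 6))
    (a : Fin 6 → F) (B : Fin 6 ⊕ Fin 3 → Fin 6 → ℤ) : Prop where
  x_eq : (l.foldl mutate t).x = Sum.elim a fun j => coord v (.inr j)
  b_eq : (l.foldl mutate t).b = B

/-- The cluster variables of the seeds reached from `t`. -/
def IsClusterVariable (t : ExtSeed (Fin 6) (Fin 3) F) (f : F) : Prop :=
  ∃ (l : List (Fin 6)) (i : Fin 6), f = (l.foldl mutate t).x (.inl i)

lemma reaches_nil (hx : t.x = coord v) (hb : t.b = cgMatrix) :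
    t.Reaches v [] (fun i => coord v (.inl i)) cgMatrix where
  x_eq := by
    rw [List.foldl_nil, hx]
    funext i
    rcases i with i | i <;> rfl
  b_eq := hb

/-- The old variable is nonzero, so the exchange relation determines the new one: each mutation is
certified by a polynomial identity and a finite matrix computation. -/
lemma Reaches.step {l : List (Fin 6)} {a : Fin 6 → F} {B : Fin 6 ⊕ Fin 3 → Fin 6 → ℤ}
    (h : t.Reaches v l a B) (hg : t.IsGood) (k : Fin 6) (y : F) (B' : Fin 6 ⊕ Fin 3 → Fin 6 → ℤ)
    (hy : a k * y = (∏ j, a j ^ (B (.inl j) k).toNat) *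
        ∏ j, coord v (.inr j) ^ (B (.inr j) k).toNat +
      (∏ j, a j ^ (-B (.inl j) k).toNat) * ∏ j, coord v (.inr j) ^ (-B (.inr j) k).toNat)
    (hB : mutateMatrix B k = B') : t.Reaches v (l ++ [k]) (Function.update a k y) B' := by
  have hk := (hg.foldl l).indep
  have h1 := x_mul_newVar hk k
  have h2 : (l.foldl mutate t).x (.inl k) = a k := by rw [h.x_eq]; rfl
  have h3 : (l.foldl mutate t).newVar k = y := by
    apply mul_left_cancel₀ (x_ne_zero hk (.inl k))
    rw [h1, h2, hy]
    unfold binomial posMonomial col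
    rw [Fintype.prod_sum_type, Fintype.prod_sum_type, h.x_eq, h.b_eq]
    rfl
  constructor
  · rw [List.foldl_append, List.foldl_cons, List.foldl_nil]
    change Function.update _ _ _ = _
    rw [h3, h.x_eq, Sum.update_elim_inl]
  · rw [List.foldl_append, List.foldl_cons, List.foldl_nil, ← hB]
    change mutateMatrix (l.foldl ExtSeed.mutate t).b k = _
    rw [h.b_eq]

lemma Reaches.isClusterVariable {l : List (Fin 6)} {k : Fin 6} {a : Fin 6 → F} {y : F}
    {B : Fin 6 ⊕ Fin 3 → Fin 6 → ℤ}
    (h : t.Reaches v l (Function.update a k y) B) : t.IsClusterVariable y := by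
  refine ⟨l, k, ?_⟩
  rw [h.x_eq, Sum.elim_inl, Function.update_self]

lemma isClusterVariable_neg_rp (hg : t.IsGood) (hx : t.x = coord v) (hb : t.b = cgMatrix) :
    t.IsClusterVariable
    (-v 5) := by
  have h1 := (reaches_nil hx hb).step hg 1
    (-v 0 * v 2 - v 1 * v 5) (Sum.elim
        ![![0, -1, 0, 0, 1, -1], ![1, 0, 1, 1, -1, 0], ![0, -1, 0, -1, 0, 1],
          ![0, -1, 1, 0, 0, -1], ![-1, 1, 0, 0, 0, -1], ![1, 0, -1, 1, 1, 0]]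
        ![![0, 1, 0, -1, 0, 0], ![0, 0, -1, 1, 0, 0], ![-1, 0, 0, 0, 0, 1]])
    (by simp [Fin.prod_univ_six, Fin.prod_univ_three, coord, cgMatrix]; ring) (by decide)
  have h2 := h1.step hg 4
    (-v 5) (Sum.elim
        ![![0, 0, 0, 0, -1, -1], ![0, 0, 1, 1, 1, -1], ![0, -1, 0, -1, 0, 1],
          ![0, -1, 1, 0, 0, -1], ![1, -1, 0, 0, 0, 1], ![1, 1, -1, 1, -1, 0]]
        ![![0, 1, 0, -1, 0, 0], ![0, 0, -1, 1, 0, 0], ![-1, 0, 0, 0, 0, 1]])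
    (by simp [Fin.prod_univ_six, Fin.prod_univ_three, Function.update_apply, coord]; ring) (by decide)
  exact h2.isClusterVariable

lemma isClusterVariable_neg_pp (hg : t.IsGood) (hx : t.x = coord v) (hb : t.b = cgMatrix) :
    t.IsClusterVariable
    (-v 3) := by
  have h1 := (reaches_nil hx hb).step hg 0
    (v 1 * v 2 * v 3 * v 4 - v 1 * v 3 ^ 2 * v 5 + v 2 ^ 3 * v 4 - v 2 ^ 2 * v 3 * v 5 + v 2 ^
      2 * v 7 * v 8 + v 2 * v 3 * v 6 * v 8 - v 2 * v 3 * v 7 ^ 2 - v 3 ^ 2 * v 6 * v 7) (Sum.elim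
        ![![0, -1, 0, 0, 0, 1], ![1, 0, -1, -1, 1, -1], ![0, 1, 0, -1, -1, 1],
          ![0, 1, 1, 0, -1, -1], ![0, -1, 1, 1, 0, -1], ![-1, 1, -1, 1, 1, 0]]
        ![![-1, 0, 1, 0, 0, 0], ![0, 0, -1, 1, 0, 0], ![1, 0, 0, 0, 0, 0]])
    (by simp [Fin.prod_univ_six, Fin.prod_univ_three, coord, cgMatrix]; ring) (by decide)
  have h2 := h1.step hg 1
    (-v 1 * v 3 - v 2 ^ 2) (Sum.elim
        ![![0, 1, -1, -1, 0, 0], ![-1, 0, 1, 1, -1, 1], ![1, -1, 0, -1, 0, 1],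
          ![1, -1, 1, 0, 0, -1], ![0, 1, 0, 0, 0, -2], ![0, -1, -1, 1, 2, 0]]
        ![![-1, 0, 1, 0, 0, 0], ![0, 0, -1, 1, 0, 0], ![1, 0, 0, 0, 0, 0]])
    (by simp [Fin.prod_univ_six, Fin.prod_univ_three, Function.update_apply, coord]; ring) (by decide)
  have h3 := h2.step hg 4
    (-v 3) (Sum.elim
        ![![0, 1, -1, -1, 0, 0], ![-1, 0, 1, 1, 1, -1], ![1, -1, 0, -1, 0, 1],
          ![1, -1, 1, 0, 0, -1], ![0, -1, 0, 0, 0, 2], ![0, 1, -1, 1, -2, 0]]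
        ![![-1, 0, 1, 0, 0, 0], ![0, 0, -1, 1, 0, 0], ![1, 0, 0, 0, 0, 0]])
    (by simp [Fin.prod_univ_six, Fin.prod_univ_three, Function.update_apply, coord]) (by decide)
  exact h3.isClusterVariable

lemma isClusterVariable_qp (hg : t.IsGood) (hx : t.x = coord v) (hb : t.b = cgMatrix) :
    t.IsClusterVariable
    (v 4) := by
  have h1 := (reaches_nil hx hb).step hg 1
    (-v 0 * v 2 - v 1 * v 5) (Sum.elim
        ![![0, -1, 0, 0, 1, -1], ![1, 0, 1, 1, -1, 0], ![0, -1, 0, -1, 0, 1],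
          ![0, -1, 1, 0, 0, -1], ![-1, 1, 0, 0, 0, -1], ![1, 0, -1, 1, 1, 0]]
        ![![0, 1, 0, -1, 0, 0], ![0, 0, -1, 1, 0, 0], ![-1, 0, 0, 0, 0, 1]])
    (by simp [Fin.prod_univ_six, Fin.prod_univ_three, coord, cgMatrix]; ring) (by decide)
  have h2 := h1.step hg 2
    (v 2 * v 4 - v 3 * v 5) (Sum.elim
        ![![0, -1, 0, 0, 1, -1], ![1, 0, -1, 1, -1, 1], ![0, 1, 0, 1, 0, -1],
          ![0, -1, -1, 0, 0, 0], ![-1, 1, 0, 0, 0, -1], ![1, -1, 1, 0, 1, 0]]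
        ![![0, 1, 0, -1, 0, 0], ![0, -1, 1, 0, 0, 0], ![-1, 0, 0, 0, 0, 1]])
    (by simp [Fin.prod_univ_six, Fin.prod_univ_three, Function.update_apply, coord]; ring) (by decide)
  have h3 := h2.step hg 4
    (-v 5) (Sum.elim
        ![![0, 0, 0, 0, -1, -1], ![0, 0, -1, 1, 1, 0], ![0, 1, 0, 1, 0, -1],
          ![0, -1, -1, 0, 0, 0], ![1, -1, 0, 0, 0, 1], ![1, 0, 1, 0, -1, 0]]
        ![![0, 1, 0, -1, 0, 0], ![0, -1, 1, 0, 0, 0], ![-1, 0, 0, 0, 0, 1]])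
    (by simp [Fin.prod_univ_six, Fin.prod_univ_three, Function.update_apply, coord]; ring) (by decide)
  have h4 := h3.step hg 0
    (-v 3) (Sum.elim
        ![![0, 0, 0, 0, 1, 1], ![0, 0, -1, 1, 1, 0], ![0, 1, 0, 1, 0, -1],
          ![0, -1, -1, 0, 0, 0], ![-1, -1, 0, 0, 0, 1], ![-1, 0, 1, 0, -1, 0]]
        ![![0, 1, 0, -1, 0, 0], ![0, -1, 1, 0, 0, 0], ![1, 0, 0, 0, -1, 0]])
    (by simp [Fin.prod_univ_six, Fin.prod_univ_three, Function.update_apply, coord]; ring) (by decide)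
  have h5 := h4.step hg 5
    (v 4) (Sum.elim
        ![![0, 0, 1, 0, 1, -1], ![0, 0, -1, 1, 1, 0], ![-1, 1, 0, 1, -1, 1],
          ![0, -1, -1, 0, 0, 0], ![-1, -1, 1, 0, 0, -1], ![1, 0, -1, 0, 1, 0]]
        ![![0, 1, 0, -1, 0, 0], ![0, -1, 1, 0, 0, 0], ![1, 0, 0, 0, -1, 0]])
    (by simp [Fin.prod_univ_six, Fin.prod_univ_three, Function.update_apply, coord]) (by decide)
  exact h5.isClusterVariable

/-- This element and that of `isClusterVariable_pair_right` produce `g` times the frozen variable of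
index `1`; the two `quartic` elements similarly produce a frozen multiple of `f`, and the cubic one
a frozen multiple of `h`. -/
lemma isClusterVariable_pair_left (hg : t.IsGood) (hx : t.x = coord v) (hb : t.b = cgMatrix) :
    t.IsClusterVariable
    (v 0 * v 7 + v 5 * v 6) := by
  have h1 := (reaches_nil hx hb).step hg 1
    (-v 0 * v 2 - v 1 * v 5) (Sum.elim
        ![![0, -1, 0, 0, 1, -1], ![1, 0, 1, 1, -1, 0], ![0, -1, 0, -1, 0, 1],
          ![0, -1, 1, 0, 0, -1], ![-1, 1, 0, 0, 0, -1], ![1, 0, -1, 1, 1, 0]]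
        ![![0, 1, 0, -1, 0, 0], ![0, 0, -1, 1, 0, 0], ![-1, 0, 0, 0, 0, 1]])
    (by simp [Fin.prod_univ_six, Fin.prod_univ_three, coord, cgMatrix]; ring) (by decide)
  have h2 := h1.step hg 2
    (v 2 * v 4 - v 3 * v 5) (Sum.elim
        ![![0, -1, 0, 0, 1, -1], ![1, 0, -1, 1, -1, 1], ![0, 1, 0, 1, 0, -1],
          ![0, -1, -1, 0, 0, 0], ![-1, 1, 0, 0, 0, -1], ![1, -1, 1, 0, 1, 0]]
        ![![0, 1, 0, -1, 0, 0], ![0, -1, 1, 0, 0, 0], ![-1, 0, 0, 0, 0, 1]])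
    (by simp [Fin.prod_univ_six, Fin.prod_univ_three, Function.update_apply, coord]; ring) (by decide)
  have h3 := h2.step hg 3
    (v 0 * v 7 + v 5 * v 6) (Sum.elim
        ![![0, -1, 0, 0, 1, -1], ![1, 0, -1, -1, -1, 1], ![0, 1, 0, -1, 0, -1],
          ![0, 1, 1, 0, 0, 0], ![-1, 1, 0, 0, 0, -1], ![1, -1, 1, 0, 1, 0]]
        ![![0, 0, -1, 1, 0, 0], ![0, -1, 1, 0, 0, 0], ![-1, 0, 0, 0, 0, 1]])
    (by simp [Fin.prod_univ_six, Fin.prod_univ_three, Function.update_apply, coord]; ring) (by decide)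
  exact h3.isClusterVariable

lemma isClusterVariable_pair_right (hg : t.IsGood) (hx : t.x = coord v) (hb : t.b = cgMatrix) :
    t.IsClusterVariable
    (-v 4 * v 7 + v 5 * v 8) := by
  have h1 := (reaches_nil hx hb).step hg 2
    (-v 0 * v 2 ^ 2 * v 8 ^ 2 + 2 * v 0 * v 2 * v 3 * v 7 * v 8 - v 0 * v 3 ^ 2 * v 7 ^ 2 - v 1
      * v 2 ^ 2 * v 4 ^ 2 + 2 * v 1 * v 2 * v 3 * v 4 * v 5 - v 1 * v 3 ^ 2 * v 5 ^ 2 - v 2 ^ 2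
      * v 4 * v 6 * v 8 + v 2 * v 3 * v 4 * v 6 * v 7 + v 2 * v 3 * v 5 * v 6 * v 8 - v 3 ^ 2 *
      v 5 * v 6 * v 7) (Sum.elim
        ![![0, 1, 0, 0, 0, -1], ![-1, 0, 1, -2, 0, 0], ![0, -1, 0, 1, 1, -1],
          ![0, 2, -1, 0, -1, 0], ![0, 0, -1, 1, 0, 0], ![1, 0, 1, 0, 0, 0]]
        ![![1, 0, -1, 0, 0, 1], ![0, 0, 1, 0, -1, 0], ![-1, 0, 0, 0, 0, 1]])
    (by simp [Fin.prod_univ_six, Fin.prod_univ_three, coord, cgMatrix]; ring) (by decide)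
  have h2 := h1.step hg 1
    (v 2 * v 4 - v 3 * v 5) (Sum.elim
        ![![0, -1, 1, 0, 0, -1], ![1, 0, -1, 2, 0, 0], ![-1, 1, 0, -1, 1, -1],
          ![0, -2, 1, 0, -1, 0], ![0, 0, -1, 1, 0, 0], ![1, 0, 1, 0, 0, 0]]
        ![![1, 0, -1, 0, 0, 1], ![0, 0, 1, 0, -1, 0], ![-1, 0, 0, 0, 0, 1]])
    (by simp [Fin.prod_univ_six, Fin.prod_univ_three, Function.update_apply, coord]; ring) (by decide)
  have h3 := h2.step hg 3
    (-v 0 * v 2 * v 8 + v 0 * v 3 * v 7 - v 2 * v 4 * v 6 + v 3 * v 5 * v 6) (Sum.elim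
        ![![0, -1, 1, 0, 0, -1], ![1, 0, 1, -2, 0, 0], ![-1, -1, 0, 1, 0, -1],
          ![0, 2, -1, 0, 1, 0], ![0, 0, 0, -1, 0, 0], ![1, 0, 1, 0, 0, 0]]
        ![![1, 0, -1, 0, 0, 1], ![0, 0, 1, 0, -1, 0], ![-1, 0, 0, 0, 0, 1]])
    (by simp [Fin.prod_univ_six, Fin.prod_univ_three, Function.update_apply, coord]; ring) (by decide)
  have h4 := h3.step hg 4
    (-v 4 * v 7 + v 5 * v 8) (Sum.elim
        ![![0, -1, 1, 0, 0, -1], ![1, 0, 1, -2, 0, 0], ![-1, -1, 0, 1, 0, -1],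
          ![0, 2, -1, 0, -1, 0], ![0, 0, 0, 1, 0, 0], ![1, 0, 1, 0, 0, 0]]
        ![![1, 0, -1, 0, 0, 1], ![0, 0, 1, -1, 1, 0], ![-1, 0, 0, 0, 0, 1]])
    (by simp [Fin.prod_univ_six, Fin.prod_univ_three, Function.update_apply, coord]; ring) (by decide)
  exact h4.isClusterVariable

lemma isClusterVariable_quartic_left (hg : t.IsGood) (hx : t.x = coord v) (hb : t.b = cgMatrix) :
    t.IsClusterVariable
    (-v 0 * v 2 * v 8 + v 0 * v 3 * v 7 - v 2 * v 4 * v 6 + v 3 * v 5 * v 6) := by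
  have h1 := (reaches_nil hx hb).step hg 2
    (-v 0 * v 2 ^ 2 * v 8 ^ 2 + 2 * v 0 * v 2 * v 3 * v 7 * v 8 - v 0 * v 3 ^ 2 * v 7 ^ 2 - v 1
      * v 2 ^ 2 * v 4 ^ 2 + 2 * v 1 * v 2 * v 3 * v 4 * v 5 - v 1 * v 3 ^ 2 * v 5 ^ 2 - v 2 ^ 2
      * v 4 * v 6 * v 8 + v 2 * v 3 * v 4 * v 6 * v 7 + v 2 * v 3 * v 5 * v 6 * v 8 - v 3 ^ 2 *
      v 5 * v 6 * v 7) (Sum.elim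
        ![![0, 1, 0, 0, 0, -1], ![-1, 0, 1, -2, 0, 0], ![0, -1, 0, 1, 1, -1],
          ![0, 2, -1, 0, -1, 0], ![0, 0, -1, 1, 0, 0], ![1, 0, 1, 0, 0, 0]]
        ![![1, 0, -1, 0, 0, 1], ![0, 0, 1, 0, -1, 0], ![-1, 0, 0, 0, 0, 1]])
    (by simp [Fin.prod_univ_six, Fin.prod_univ_three, coord, cgMatrix]; ring) (by decide)
  have h2 := h1.step hg 1
    (v 2 * v 4 - v 3 * v 5) (Sum.elim
        ![![0, -1, 1, 0, 0, -1], ![1, 0, -1, 2, 0, 0], ![-1, 1, 0, -1, 1, -1],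
          ![0, -2, 1, 0, -1, 0], ![0, 0, -1, 1, 0, 0], ![1, 0, 1, 0, 0, 0]]
        ![![1, 0, -1, 0, 0, 1], ![0, 0, 1, 0, -1, 0], ![-1, 0, 0, 0, 0, 1]])
    (by simp [Fin.prod_univ_six, Fin.prod_univ_three, Function.update_apply, coord]; ring) (by decide)
  have h3 := h2.step hg 3
    (-v 0 * v 2 * v 8 + v 0 * v 3 * v 7 - v 2 * v 4 * v 6 + v 3 * v 5 * v 6) (Sum.elim
        ![![0, -1, 1, 0, 0, -1], ![1, 0, 1, -2, 0, 0], ![-1, -1, 0, 1, 0, -1],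
          ![0, 2, -1, 0, 1, 0], ![0, 0, 0, -1, 0, 0], ![1, 0, 1, 0, 0, 0]]
        ![![1, 0, -1, 0, 0, 1], ![0, 0, 1, 0, -1, 0], ![-1, 0, 0, 0, 0, 1]])
    (by simp [Fin.prod_univ_six, Fin.prod_univ_three, Function.update_apply, coord]; ring) (by decide)
  exact h3.isClusterVariable

lemma isClusterVariable_quartic_right (hg : t.IsGood) (hx : t.x = coord v) (hb : t.b = cgMatrix) :
    t.IsClusterVariable
    (v 0 ^ 2 * v 2 + v 0 * v 1 * v 5 - v 0 * v 6 * v 7 - v 5 * v 6 ^ 2) := by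
  have h1 := (reaches_nil hx hb).step hg 1
    (-v 0 * v 2 - v 1 * v 5) (Sum.elim
        ![![0, -1, 0, 0, 1, -1], ![1, 0, 1, 1, -1, 0], ![0, -1, 0, -1, 0, 1],
          ![0, -1, 1, 0, 0, -1], ![-1, 1, 0, 0, 0, -1], ![1, 0, -1, 1, 1, 0]]
        ![![0, 1, 0, -1, 0, 0], ![0, 0, -1, 1, 0, 0], ![-1, 0, 0, 0, 0, 1]])
    (by simp [Fin.prod_univ_six, Fin.prod_univ_three, coord, cgMatrix]; ring) (by decide)
  have h2 := h1.step hg 3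
    (-v 0 ^ 2 * v 2 ^ 2 - 2 * v 0 * v 1 * v 2 * v 5 - v 0 * v 1 * v 7 ^ 2 + v 0 * v 2 * v 6 * v
      7 - v 1 ^ 2 * v 5 ^ 2 - v 1 * v 5 * v 6 * v 7 + v 2 * v 5 * v 6 ^ 2) (Sum.elim
        ![![0, -1, 0, 0, 1, -1], ![1, 0, 2, -1, -1, 0], ![0, -2, 0, 1, 0, 0],
          ![0, 1, -1, 0, 0, 1], ![-1, 1, 0, 0, 0, -1], ![1, 0, 0, -1, 1, 0]]
        ![![0, 0, 0, 1, 0, -1], ![0, 0, 0, -1, 0, 0], ![-1, 0, 0, 0, 0, 1]])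
    (by simp [Fin.prod_univ_six, Fin.prod_univ_three, Function.update_apply, coord]; ring) (by decide)
  have h3 := h2.step hg 2
    (v 0 * v 7 + v 5 * v 6) (Sum.elim
        ![![0, -1, 0, 0, 1, -1], ![1, 0, -2, 1, -1, 0], ![0, 2, 0, -1, 0, 0],
          ![0, -1, 1, 0, 0, 1], ![-1, 1, 0, 0, 0, -1], ![1, 0, 0, -1, 1, 0]]
        ![![0, 0, 0, 1, 0, -1], ![0, 0, 0, -1, 0, 0], ![-1, 0, 0, 0, 0, 1]])
    (by simp [Fin.prod_univ_six, Fin.prod_univ_three, Function.update_apply, coord]; ring) (by decide)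
  have h4 := h3.step hg 1
    (v 0 ^ 2 * v 2 + v 0 * v 1 * v 5 - v 0 * v 6 * v 7 - v 5 * v 6 ^ 2) (Sum.elim
        ![![0, 1, -2, 0, 0, -1], ![-1, 0, 2, -1, 1, 0], ![2, -2, 0, 1, 0, 0],
          ![0, 1, -1, 0, -1, 1], ![0, -1, 0, 1, 0, -1], ![1, 0, 0, -1, 1, 0]]
        ![![0, 0, 0, 1, 0, -1], ![0, 0, 0, -1, 0, 0], ![-1, 0, 0, 0, 0, 1]])
    (by simp [Fin.prod_univ_six, Fin.prod_univ_three, Function.update_apply, coord]; ring) (by decide)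
  exact h4.isClusterVariable

lemma isClusterVariable_cubic (hg : t.IsGood) (hx : t.x = coord v) (hb : t.b = cgMatrix) :
    t.IsClusterVariable
    (v 0 * v 3 * v 8 + v 2 * v 4 * v 7 - v 2 * v 5 * v 8 + v 3 * v 4 * v 6) := by
  have h1 := (reaches_nil hx hb).step hg 1
    (-v 0 * v 2 - v 1 * v 5) (Sum.elim
        ![![0, -1, 0, 0, 1, -1], ![1, 0, 1, 1, -1, 0], ![0, -1, 0, -1, 0, 1],
          ![0, -1, 1, 0, 0, -1], ![-1, 1, 0, 0, 0, -1], ![1, 0, -1, 1, 1, 0]]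
        ![![0, 1, 0, -1, 0, 0], ![0, 0, -1, 1, 0, 0], ![-1, 0, 0, 0, 0, 1]])
    (by simp [Fin.prod_univ_six, Fin.prod_univ_three, coord, cgMatrix]; ring) (by decide)
  have h2 := h1.step hg 0
    (-v 1 * v 3 - v 2 ^ 2) (Sum.elim
        ![![0, 1, 0, 0, -1, 1], ![-1, 0, 1, 1, 0, 0], ![0, -1, 0, -1, 0, 1],
          ![0, -1, 1, 0, 0, -1], ![1, 0, 0, 0, 0, -2], ![-1, 0, -1, 1, 2, 0]]
        ![![0, 1, 0, -1, 0, 0], ![0, 0, -1, 1, 0, 0], ![1, -1, 0, 0, 0, 0]])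
    (by simp [Fin.prod_univ_six, Fin.prod_univ_three, Function.update_apply, coord]; ring) (by decide)
  have h3 := h2.step hg 2
    (v 2 * v 4 - v 3 * v 5) (Sum.elim
        ![![0, 1, 0, 0, -1, 1], ![-1, 0, -1, 1, 0, 1], ![0, 1, 0, 1, 0, -1],
          ![0, -1, -1, 0, 0, 0], ![1, 0, 0, 0, 0, -2], ![-1, -1, 1, 0, 2, 0]]
        ![![0, 1, 0, -1, 0, 0], ![0, -1, 1, 0, 0, 0], ![1, -1, 0, 0, 0, 0]])
    (by simp [Fin.prod_univ_six, Fin.prod_univ_three, Function.update_apply, coord]; ring) (by decide)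
  have h4 := h3.step hg 3
    (v 0 * v 7 + v 5 * v 6) (Sum.elim
        ![![0, 1, 0, 0, -1, 1], ![-1, 0, -1, -1, 0, 1], ![0, 1, 0, -1, 0, -1],
          ![0, 1, 1, 0, 0, 0], ![1, 0, 0, 0, 0, -2], ![-1, -1, 1, 0, 2, 0]]
        ![![0, 0, -1, 1, 0, 0], ![0, -1, 1, 0, 0, 0], ![1, -1, 0, 0, 0, 0]])
    (by simp [Fin.prod_univ_six, Fin.prod_univ_three, Function.update_apply, coord]; ring) (by decide)
  have h5 := h4.step hg 1
    (v 0 * v 2 * v 3 * v 8 - v 0 * v 3 ^ 2 * v 7 + v 2 ^ 2 * v 4 * v 7 - v 2 ^ 2 * v 5 * v 8 +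
      v 2 * v 3 * v 4 * v 6 - v 3 ^ 2 * v 5 * v 6) (Sum.elim
        ![![0, -1, 0, 0, -1, 2], ![1, 0, 1, 1, 0, -1], ![0, -1, 0, -1, 0, 0],
          ![0, -1, 1, 0, 0, 1], ![1, 0, 0, 0, 0, -2], ![-2, 1, 0, -1, 2, 0]]
        ![![0, 0, -1, 1, 0, 0], ![-1, 1, 0, -1, 0, 0], ![0, 1, -1, -1, 0, 0]])
    (by simp [Fin.prod_univ_six, Fin.prod_univ_three, Function.update_apply, coord]; ring) (by decide)
  have h6 := h5.step hg 4
    (-v 3) (Sum.elim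
        ![![0, -1, 0, 0, 1, 0], ![1, 0, 1, 1, 0, -1], ![0, -1, 0, -1, 0, 0],
          ![0, -1, 1, 0, 0, 1], ![-1, 0, 0, 0, 0, 2], ![0, 1, 0, -1, -2, 0]]
        ![![0, 0, -1, 1, 0, 0], ![-1, 1, 0, -1, 0, 0], ![0, 1, -1, -1, 0, 0]])
    (by simp [Fin.prod_univ_six, Fin.prod_univ_three, Function.update_apply, coord]) (by decide)
  have h7 := h6.step hg 5
    (v 0 * v 3 * v 8 + v 2 * v 4 * v 7 - v 2 * v 5 * v 8 + v 3 * v 4 * v 6) (Sum.elim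
        ![![0, -1, 0, 0, 1, 0], ![1, 0, 1, 0, -2, 1], ![0, -1, 0, -1, 0, 0],
          ![0, 0, 1, 0, 0, -1], ![-1, 2, 0, 0, 0, -2], ![0, -1, 0, 1, 2, 0]]
        ![![0, 0, -1, 1, 0, 0], ![-1, 1, 0, -1, 0, 0], ![0, 1, -1, -1, 0, 0]])
    (by simp [Fin.prod_univ_six, Fin.prod_univ_three, Function.update_apply, coord]; ring) (by decide)
  exact h7.isClusterVariable

end ExtSeed

/-! ### Equality over the full group ring. -/

section Equality

variable {F : Type*} [Field F] [Algebra (ZP (Trop 3)) F] {s : Seed 6 (Trop 3) F} {v : Fin 9 → F}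

omit [Algebra (ZP (Trop 3)) F] in
lemma isGood_of_eq {t : ExtSeed (Fin 6) (Fin 3) F} (hb : t.b = cgMatrix)
    (h : AlgebraicIndependent ℤ t.x) : t.IsGood where
  indep := h
  skew := isSkew_of_b_eq hb
  compatible := ⟨2, cgForm, by norm_num, isCompatible_of_b_eq hb⟩

lemma mem_clusterAlgebra_of_isClusterVariable {A : Subring (ZP (Trop 3))} {f : F}
    (hf : s.toExt.IsClusterVariable f) : f ∈ s.clusterAlgebra A :=
  Algebra.subset_adjoin (Seed.mem_clusterVariables.2 hf)

lemma mem_clusterAlgebra_top_of_coeff_mul_mem {a : Trop 3} {f : F}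
    (h : coeff F a * f ∈ s.clusterAlgebra ⊤) : f ∈ s.clusterAlgebra ⊤ := by
  have h1 := mul_mem (Seed.coeff_mem_of_top (s.clusterAlgebra ⊤) a⁻¹) h
  rwa [← mul_assoc, ← coeff_mul, inv_mul_cancel, coeff_one, one_mul] at h1

/-- Division by frozen variables is needed only for `g`, `f` and `h`. The order matters, because the
identity for `h` already uses `f` and `g`. -/
lemma coordinate_mem_clusterAlgebra_top (hg : s.toExt.IsGood) (hx : s.toExt.x = coord v)
    (hb : s.toExt.b = cgMatrix) (i : Fin 9) : v i ∈ s.clusterAlgebra ⊤ := by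
  have hi : ∀ i, coord v (.inl i) ∈ s.clusterAlgebra ⊤ := fun i =>
    mem_clusterAlgebra_of_isClusterVariable ⟨[], i, by rw [List.foldl_nil, hx]⟩
  have hz : ∀ j, coord v (.inr j) = coeff F (tropGen j) := fun j => by rw [← hx]; rfl
  have h0 : v 0 ∈ s.clusterAlgebra ⊤ := hi 0
  have h1 : v 1 ∈ s.clusterAlgebra ⊤ := hi 4
  have h2 : v 2 ∈ s.clusterAlgebra ⊤ := hi 5
  have h3 : v 3 ∈ s.clusterAlgebra ⊤ := by
    simpa using neg_mem (mem_clusterAlgebra_of_isClusterVariable (A := ⊤)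
      (ExtSeed.isClusterVariable_neg_pp hg hx hb))
  have h4 : v 4 ∈ s.clusterAlgebra ⊤ :=
    mem_clusterAlgebra_of_isClusterVariable (ExtSeed.isClusterVariable_qp hg hx hb)
  have h5 : v 5 ∈ s.clusterAlgebra ⊤ := by
    simpa using neg_mem (mem_clusterAlgebra_of_isClusterVariable (A := ⊤)
      (ExtSeed.isClusterVariable_neg_rp hg hx hb))
  have h7 : v 7 ∈ s.clusterAlgebra ⊤ := by
    apply mem_clusterAlgebra_top_of_coeff_mul_mem (a := tropGen 1)
    have h := sub_mem (mul_mem (hi 3) (mem_clusterAlgebra_of_isClusterVariable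
      (ExtSeed.isClusterVariable_pair_left hg hx hb))) (mul_mem (hi 2)
      (mem_clusterAlgebra_of_isClusterVariable (ExtSeed.isClusterVariable_pair_right hg hx hb)))
    convert h using 1
    rw [← hz]
    simp [coord]
    ring
  have h6 : v 6 ∈ s.clusterAlgebra ⊤ := by
    apply mem_clusterAlgebra_top_of_coeff_mul_mem (a := tropGen 0)
    have h := sub_mem (mul_mem (sub_mem (mul_mem (neg_mem h0) h2) (mul_mem h1 h5))
      (mem_clusterAlgebra_of_isClusterVariable
      (ExtSeed.isClusterVariable_quartic_left hg hx hb))) (mul_mem (hi 3)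
      (mem_clusterAlgebra_of_isClusterVariable (ExtSeed.isClusterVariable_quartic_right hg hx hb)))
    convert h using 1
    rw [← hz]
    simp [coord]
    ring
  have h8 : v 8 ∈ s.clusterAlgebra ⊤ := by
    apply mem_clusterAlgebra_top_of_coeff_mul_mem (a := tropGen 2)
    have h := sub_mem (add_mem (mul_mem (mul_mem h2 h4) h7) (mul_mem (mul_mem h3 h4) h6))
      (mem_clusterAlgebra_of_isClusterVariable (ExtSeed.isClusterVariable_cubic hg hx hb))
    convert h using 1
    rw [← hz]
    simp [coord]
    ring
  fin_cases i
  exacts [h0, h1, h2, h3, h4, h5, h6, h7, h8]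

lemma clusterAlgebra_eq_upperClusterAlgebra_top (hv : AlgebraicIndependent ℤ v)
    (hg : s.toExt.IsGood) (hx : s.toExt.x = coord v) (hb : s.toExt.b = cgMatrix) :
    s.clusterAlgebra ⊤ = s.upperClusterAlgebra ⊤ := by
  refine le_antisymm (Seed.clusterAlgebra_le_upperClusterAlgebra_top hg) fun f hf => ?_
  obtain ⟨N, hN⟩ := Seed.exists_mul_frozenProd_mem_upperBound hf
  obtain ⟨a, ha⟩ := ExtSeed.upperBound_le_range hg hv hx hb hN
  have h1 : (Seed.frozenProd 3 F) ^ N = coeff F ((∏ j : Fin 3, tropGen j) ^ N) := by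
    change _ = coeffHom 3 F _
    rw [map_pow, map_prod]
    rfl
  apply mem_clusterAlgebra_top_of_coeff_mul_mem (a := (∏ j : Fin 3, tropGen j) ^ N)
  rw [← h1, mul_comm, ha]
  have h2 : (aeval (R := ℤ) v).range ≤ (s.clusterAlgebra ⊤).restrictScalars ℤ := by
    rw [← Algebra.adjoin_range_eq_range_aeval]
    refine Algebra.adjoin_le ?_
    rintro _ ⟨i, rfl⟩
    exact coordinate_mem_clusterAlgebra_top hg hx hb i
  exact h2 ⟨a, rfl⟩

end Equality

/-! ### The polynomial ring lies in the upper bound. -/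

namespace ExtSeed

section Division

variable {κ φ F : Type*} [Fintype κ] [Fintype φ] [DecidableEq κ] [DecidableEq φ] [Field F]
  {t : ExtSeed κ φ F}

omit [Fintype κ] [Fintype φ] [DecidableEq κ] [DecidableEq φ] in
lemma mem_laurent_of_mul_x_mem (hx : ∀ i, t.x i ≠ 0) {j : κ} {f : F}
    (h : f * t.x (.inl j) ∈ t.laurent) : f ∈ t.laurent := by
  have h1 := mul_mem h (inv_x_mem_laurent (t := t) j)
  rwa [mul_inv_cancel_right₀ (hx _)] at h1

lemma mem_mutate_laurent_of_mul_x_mem (hg : t.IsGood) {j k : κ} (hjk : j ≠ k) {f : F}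
    (h : f * t.x (.inl j) ∈ (t.mutate k).laurent) : f ∈ (t.mutate k).laurent := by
  refine mem_laurent_of_mul_x_mem (hg.mutate k).indep.ne_zero (j := j) ?_
  rwa [mutate_x_of_ne (by simpa using hjk)]

lemma newVar_mem_upperBound (hg : t.IsGood) (k : κ) : t.newVar k ∈ t.upperBound := by
  rw [← upperBound_mutate hg k, ← mutate_x_self]
  exact x_mem_upperBound (hg.mutate k) _

/-- An element is in the upper bound as soon as it can be written with two different
denominators. -/
lemma mem_upperBound_of_mul_mem (hg : t.IsGood) {f : F} (h : ∀ k, ∃ i j : κ, i ≠ k ∧ j ≠ k ∧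
    f * t.x (.inl i) * t.x (.inl j) ∈ t.upperBound) [Nonempty κ] : f ∈ t.upperBound := by
  have h0 := hg.indep.ne_zero
  rw [mem_upperBound]
  constructor
  · obtain ⟨i, j, -, -, hij⟩ := h (Classical.arbitrary κ)
    exact mem_laurent_of_mul_x_mem h0 (mem_laurent_of_mul_x_mem h0 (mem_upperBound.1 hij).1)
  · intro k
    obtain ⟨i, j, hi, hj, hij⟩ := h k
    exact mem_mutate_laurent_of_mul_x_mem hg hi
      (mem_mutate_laurent_of_mul_x_mem hg hj ((mem_upperBound.1 hij).2 k))

end Division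

variable {F : Type*} [Field F] {t : ExtSeed (Fin 6) (Fin 3) F} {v : Fin 9 → F}

lemma IsClusterVariable.mem_upperBound (hg : t.IsGood) {f : F} (hf : t.IsClusterVariable f) :
    f ∈ t.upperBound := by
  obtain ⟨l, i, rfl⟩ := hf
  exact x_foldl_mem_upperBound hg l _

/-- Six coordinates are cluster variables up to sign. Each of `f`, `g`, `h` is written as a fraction
in two ways, so that for every `k` one denominator avoids `x k` and remains invertible in the
Laurent ring of `t.mutate k`. -/
lemma coordinate_mem_upperBound (hg : t.IsGood) (hx : t.x = coord v) (hb : t.b = cgMatrix)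
    (i : Fin 9) : v i ∈ t.upperBound := by
  have hc : ∀ i, coord v i ∈ t.upperBound := fun i => hx ▸ x_mem_upperBound hg i
  have hn : ∀ k, coordNew v k ∈ t.upperBound := fun k => by
    rw [← newVar_eq_coordNew hg.indep hx hb]
    exact newVar_mem_upperBound hg k
  have h0 : v 0 ∈ t.upperBound := hc (.inl 0)
  have h1 : v 1 ∈ t.upperBound := hc (.inl 4)
  have h2 : v 2 ∈ t.upperBound := hc (.inl 5)
  have h3 : v 3 ∈ t.upperBound := by
    simpa using neg_mem ((isClusterVariable_neg_pp hg hx hb).mem_upperBound hg)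
  have h4 : v 4 ∈ t.upperBound := (isClusterVariable_qp hg hx hb).mem_upperBound hg
  have h5 : v 5 ∈ t.upperBound := by
    simpa using neg_mem ((isClusterVariable_neg_rp hg hx hb).mem_upperBound hg)
  have h6 : v 6 ∈ t.upperBound := by
    refine mem_upperBound_of_mul_mem hg fun k => ?_
    -- The denominators for `f` are `x 2` and `x 1 * x 3`. The first is squared only to fit the
    -- two-factor shape of `mem_upperBound_of_mul_mem`.
    by_cases hk : k = 1 ∨ k = 3
    · refine ⟨2, 2, by omega, by omega, ?_⟩
      have h := mul_mem (neg_mem (add_mem (mul_mem h1 (hn 1)) (hn 3))) (hc (.inl 2))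
      convert h using 1
      simp [hx, coord, coordNew, -mul_eq_mul_right_iff]
      ring
    · refine ⟨1, 3, by omega, by omega, ?_⟩
      have h := neg_mem (add_mem (add_mem (mul_mem (mul_mem h0 (pow_mem (hc (.inl 3)) 2)) h1)
        (pow_mem (hc (.inl 1)) 2)) (mul_mem h1 (hn 2)))
      convert h using 1
      simp [hx, coord, coordNew, -mul_eq_mul_right_iff]
      ring
  have h7 : v 7 ∈ t.upperBound := by
    refine mem_upperBound_of_mul_mem hg fun k => ?_
    by_cases hk : k = 1 ∨ k = 3
    · refine ⟨4, 4, by omega, by omega, ?_⟩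
      have h := mul_mem (sub_mem (mul_mem h2 h6) (hc (.inl 2))) h1
      convert h using 1
      simp [hx, coord, -mul_eq_mul_right_iff]
      ring
    · refine ⟨1, 3, by omega, by omega, ?_⟩
      have h := neg_mem (add_mem (mul_mem h2 (add_mem (mul_mem h0 (pow_mem (hc (.inl 3)) 2))
        (hn 2))) (mul_mem (hc (.inl 1)) (hn 4)))
      convert h using 1
      simp [hx, coord, coordNew, -mul_eq_mul_right_iff]
      ring
  have h8 : v 8 ∈ t.upperBound := by
    refine mem_upperBound_of_mul_mem hg fun k => ?_
    by_cases hk : k = 5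
    · refine ⟨0, 4, by omega, by omega, ?_⟩
      have h := add_mem (sub_mem (hn 5) (mul_mem (hc (.inr 2)) h6)) (mul_mem (mul_mem h1 h5) h7)
      convert h using 1
      simp [hx, coord, coordNew, -mul_eq_mul_right_iff]
      ring
    · refine ⟨5, 5, by omega, by omega, ?_⟩
      have h := mul_mem (add_mem (hc (.inl 3)) (mul_mem h3 h7)) h2
      convert h using 1
      simp [hx, coord, -mul_eq_mul_right_iff]
  fin_cases i
  exacts [h0, h1, h2, h3, h4, h5, h6, h7, h8]

lemma aeval_mem_upperBound (hg : t.IsGood) (hx : t.x = coord v) (hb : t.b = cgMatrix)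
    (a : MvPolynomial (Fin 9) ℤ) : aeval v a ∈ t.upperBound := by
  have h : (aeval (R := ℤ) v).range ≤ t.upperBound := by
    rw [← Algebra.adjoin_range_eq_range_aeval]
    refine Algebra.adjoin_le ?_
    rintro _ ⟨i, rfl⟩
    exact coordinate_mem_upperBound hg hx hb i
  exact h ⟨a, rfl⟩

end ExtSeed

/-! ### A log-canonical bracket and a grading on the coordinate ring. -/

section Bracket

/-- The upper triangular part of `bracketTable`. -/
def bracketTableAux {R : Type*} [CommRing R] (v : Fin 9 → R) : Fin 9 → Fin 9 → R :=
  ![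
    ![0, 2 * v 0 * v 1, 0, -2 * v 2 * v 5, -2 * v 0 * v 4 - 2 * v 5 ^ 2, -2 * v 0 * v 5,
      v 0 * v 6, -v 0 * v 7, -v 0 * v 8 - 2 * v 5 * v 7],
    ![0, 0, 0, 2 * v 1 * v 3 + 2 * v 2 ^ 2, 2 * v 0 * v 3 + 2 * v 1 * v 4 + 2 * v 2 * v 5,
      2 * v 0 * v 2, -v 1 * v 6, v 1 * v 7 - 2 * v 2 * v 6,
      3 * v 1 * v 8 + 2 * v 2 * v 7 - 2 * v 3 * v 6],
    ![0, 0, 0, 0, 2 * v 2 * v 4 - 2 * v 3 * v 5, 0, 0, 0, 2 * v 2 * v 8 - 2 * v 3 * v 7],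
    ![0, 0, 0, 0, 2 * v 3 * v 4, 2 * v 3 * v 5, -2 * v 2 * v 7 - v 3 * v 6, v 3 * v 7,
      v 3 * v 8],
    ![0, 0, 0, 0, 0, 2 * v 4 * v 5, -2 * v 0 * v 8 - v 4 * v 6 - 2 * v 5 * v 7,
      -v 4 * v 7 + 2 * v 5 * v 8, -v 4 * v 8],
    ![0, 0, 0, 0, 0, 0, -2 * v 0 * v 7, 0, -2 * v 5 * v 8],
    ![0, 0, 0, 0, 0, 0, 0, -2 * v 0 * v 2 - 2 * v 1 * v 5 - v 6 * v 7,
      -2 * v 0 * v 3 - 2 * v 1 * v 4 + 2 * v 7 ^ 2],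
    ![0, 0, 0, 0, 0, 0, 0, 0, -2 * v 2 * v 4 + 2 * v 3 * v 5 - v 7 * v 8],
    ![0, 0, 0, 0, 0, 0, 0, 0, 0]]

/-- The values of twice the Cremmer–Gervais bracket on the coordinates. -/
def bracketTable {R : Type*} [CommRing R] (v : Fin 9 → R) (i j : Fin 9) : R :=
  bracketTableAux v i j - bracketTableAux v j i

/-- The Poisson bracket on the coordinate ring for which the cluster structure is log-canonical. -/
noncomputable def bracket : Derivation ℤ (MvPolynomial (Fin 9) ℤ)
    (Derivation ℤ (MvPolynomial (Fin 9) ℤ) (MvPolynomial (Fin 9) ℤ)) :=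
  mkDerivation ℤ fun i => mkDerivation ℤ (bracketTable X i)

lemma bracket_X_X (i j : Fin 9) : bracket (X i) (X j) = bracketTable X i j := by
  rw [bracket, mkDerivation_X, mkDerivation_X]

lemma bracketTable_skew {R : Type*} [CommRing R] (v : Fin 9 → R) (i j : Fin 9) :
    bracketTable v i j = -bracketTable v j i :=
  (neg_sub _ _).symm

/-- Skewness on the coordinates propagates by the Leibniz rule, one argument at a time. Together
with the Leibniz rule this is all that is needed of the bracket; the Jacobi identity is never used.
-/
lemma bracket_skew (a b : MvPolynomial (Fin 9) ℤ) : bracket a b = -bracket b a := by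
  have hX : ∀ (i : Fin 9) (b : MvPolynomial (Fin 9) ℤ), bracket (X i) b = -bracket b (X i) := by
    intro i b
    induction b using MvPolynomial.induction_on with
    | C r => simp [← algebraMap_eq]
    | add p q hp hq => rw [map_add, map_add, hp, hq, Derivation.add_apply]; ring
    | mul_X p j hp =>
      rw [Derivation.leibniz, Derivation.leibniz, Derivation.add_apply, Derivation.smul_apply,
        Derivation.smul_apply, hp, bracket_X_X, bracket_X_X, bracketTable_skew X i j]
      simp only [smul_eq_mul]
      ring
  induction a using MvPolynomial.induction_on with
  | C r => simp [← algebraMap_eq]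
  | add p q hp hq => rw [map_add, map_add, Derivation.add_apply, hp, hq]; ring
  | mul_X p i hp =>
    rw [Derivation.leibniz, Derivation.leibniz, Derivation.add_apply, Derivation.smul_apply,
      Derivation.smul_apply, hp, hX]
    simp only [smul_eq_mul]
    ring

lemma bracket_self (a : MvPolynomial (Fin 9) ℤ) : bracket a a = 0 := by
  have h := bracket_skew a a
  have h2 : (2 : MvPolynomial (Fin 9) ℤ) * bracket a a = 0 := by linear_combination h
  exact (mul_eq_zero.1 h2).resolve_left two_ne_zero

/-- The weights of the coordinates for a grading of the cluster structure. -/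
def coordWeight : Fin 9 → ℤ := ![6, 12, 14, 16, 10, 8, 9, 11, 13]

/-- The weights of the extended cluster for the same grading. -/
def clusterWeight : Fin 6 ⊕ Fin 3 → ℤ := Sum.elim ![6, 36, 23, 27, 12, 14] ![44, 33, 22]

/-- The Euler derivation of the grading. -/
noncomputable def euler : Derivation ℤ (MvPolynomial (Fin 9) ℤ) (MvPolynomial (Fin 9) ℤ) :=
  mkDerivation ℤ fun i => (coordWeight i : MvPolynomial (Fin 9) ℤ) * X i

lemma euler_coord (i : Fin 6 ⊕ Fin 3) :
    euler (coord X i) = (clusterWeight i : MvPolynomial (Fin 9) ℤ) * coord X i := by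
  rcases i with i | i <;> fin_cases i <;>
  · simp [coord, euler, clusterWeight, coordWeight, Derivation.leibniz,
      mkDerivation_X]
    try ring

lemma sum_cgMatrix_mul_clusterWeight (j : Fin 6) :
    ∑ i, cgMatrix i j * clusterWeight i = 0 := by
  revert j
  decide

section Biderivation

variable {R : Type*} [CommRing R] {br : Derivation ℤ R (Derivation ℤ R R)} {v : Fin 9 → R}

lemma biderivation_coord_inl_0 (h : ∀ i j, br (v i) (v j) = bracketTable v i j) (l : Fin 6)
    (hl : 0 < l) : br (coord v (.inl 0)) (coord v (.inl l)) =
      (cgForm (.inl 0) (.inl l) : R) * (coord v (.inl 0) * coord v (.inl l)) := by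
  fin_cases l <;> first
  | exact absurd hl (by decide)
  | (simp [coord, h, Derivation.leibniz, bracketTable, bracketTableAux, cgForm]
     try ring)

lemma biderivation_coord_inl_1 (h : ∀ i j, br (v i) (v j) = bracketTable v i j) (l : Fin 6)
    (hl : 1 < l) : br (coord v (.inl 1)) (coord v (.inl l)) =
      (cgForm (.inl 1) (.inl l) : R) * (coord v (.inl 1) * coord v (.inl l)) := by
  fin_cases l <;> first
  | exact absurd hl (by decide)
  | (simp [coord, h, Derivation.leibniz, bracketTable, bracketTableAux, cgForm]
     try ring)

lemma biderivation_coord_inl_2 (h : ∀ i j, br (v i) (v j) = bracketTable v i j) (l : Fin 6)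
    (hl : 2 < l) : br (coord v (.inl 2)) (coord v (.inl l)) =
      (cgForm (.inl 2) (.inl l) : R) * (coord v (.inl 2) * coord v (.inl l)) := by
  fin_cases l <;> first
  | exact absurd hl (by decide)
  | (simp [coord, h, Derivation.leibniz, bracketTable, bracketTableAux, cgForm]
     try ring)

lemma biderivation_coord_inl_3 (h : ∀ i j, br (v i) (v j) = bracketTable v i j) (l : Fin 6)
    (hl : 3 < l) : br (coord v (.inl 3)) (coord v (.inl l)) =
      (cgForm (.inl 3) (.inl l) : R) * (coord v (.inl 3) * coord v (.inl l)) := by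
  fin_cases l <;> first
  | exact absurd hl (by decide)
  | (simp [coord, h, Derivation.leibniz, bracketTable, bracketTableAux, cgForm]
     try ring)

lemma biderivation_coord_inl_4 (h : ∀ i j, br (v i) (v j) = bracketTable v i j) (l : Fin 6)
    (hl : 4 < l) : br (coord v (.inl 4)) (coord v (.inl l)) =
      (cgForm (.inl 4) (.inl l) : R) * (coord v (.inl 4) * coord v (.inl l)) := by
  fin_cases l <;> first
  | exact absurd hl (by decide)
  | (simp [coord, h, bracketTable, bracketTableAux, cgForm]
     try ring)

lemma biderivation_coord_inl_0_inr (h : ∀ i j, br (v i) (v j) = bracketTable v i j) (l : Fin 3) :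
    br (coord v (.inl 0)) (coord v (.inr l)) =
      (cgForm (.inl 0) (.inr l) : R) * (coord v (.inl 0) * coord v (.inr l)) := by
  fin_cases l <;>
  · simp [coord, h, Derivation.leibniz, bracketTable, bracketTableAux, cgForm]
    try ring

lemma biderivation_coord_inl_1_inr (h : ∀ i j, br (v i) (v j) = bracketTable v i j) (l : Fin 3) :
    br (coord v (.inl 1)) (coord v (.inr l)) =
      (cgForm (.inl 1) (.inr l) : R) * (coord v (.inl 1) * coord v (.inr l)) := by
  fin_cases l <;>
  · simp [coord, h, Derivation.leibniz, bracketTable, bracketTableAux, cgForm]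
    try ring

lemma biderivation_coord_inl_2_inr (h : ∀ i j, br (v i) (v j) = bracketTable v i j) (l : Fin 3) :
    br (coord v (.inl 2)) (coord v (.inr l)) =
      (cgForm (.inl 2) (.inr l) : R) * (coord v (.inl 2) * coord v (.inr l)) := by
  fin_cases l <;>
  · simp [coord, h, Derivation.leibniz, bracketTable, bracketTableAux, cgForm]
    try ring

lemma biderivation_coord_inl_3_inr (h : ∀ i j, br (v i) (v j) = bracketTable v i j) (l : Fin 3) :
    br (coord v (.inl 3)) (coord v (.inr l)) =
      (cgForm (.inl 3) (.inr l) : R) * (coord v (.inl 3) * coord v (.inr l)) := by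
  fin_cases l <;>
  · simp [coord, h, Derivation.leibniz, bracketTable, bracketTableAux, cgForm]
    try ring

lemma biderivation_coord_inl_4_inr (h : ∀ i j, br (v i) (v j) = bracketTable v i j) (l : Fin 3) :
    br (coord v (.inl 4)) (coord v (.inr l)) =
      (cgForm (.inl 4) (.inr l) : R) * (coord v (.inl 4) * coord v (.inr l)) := by
  fin_cases l <;>
  · simp [coord, h, Derivation.leibniz, bracketTable, bracketTableAux, cgForm]
    try ring

lemma biderivation_coord_inl_5_inr (h : ∀ i j, br (v i) (v j) = bracketTable v i j) (l : Fin 3) :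
    br (coord v (.inl 5)) (coord v (.inr l)) =
      (cgForm (.inl 5) (.inr l) : R) * (coord v (.inl 5) * coord v (.inr l)) := by
  fin_cases l <;>
  · simp [coord, h, Derivation.leibniz, bracketTable, bracketTableAux, cgForm]
    try ring

lemma biderivation_coord_inr_0 (h : ∀ i j, br (v i) (v j) = bracketTable v i j) (l : Fin 3)
    (hl : 0 < l) : br (coord v (.inr 0)) (coord v (.inr l)) =
      (cgForm (.inr 0) (.inr l) : R) * (coord v (.inr 0) * coord v (.inr l)) := by
  fin_cases l <;> first
  | exact absurd hl (by decide)
  | (simp [coord, h, Derivation.leibniz, bracketTable, bracketTableAux, cgForm]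
     try ring)

lemma biderivation_coord_inr_1 (h : ∀ i j, br (v i) (v j) = bracketTable v i j) (l : Fin 3)
    (hl : 1 < l) : br (coord v (.inr 1)) (coord v (.inr l)) =
      (cgForm (.inr 1) (.inr l) : R) * (coord v (.inr 1) * coord v (.inr l)) := by
  fin_cases l <;> first
  | exact absurd hl (by decide)
  | (simp [coord, h, Derivation.leibniz, bracketTable, bracketTableAux, cgForm]
     try ring)

end Biderivation

/-- The structure constants are those of the compatible form `cgForm`, so log-canonicity can be
propagated through mutations along with the form. -/
lemma bracket_coord (i l : Fin 6 ⊕ Fin 3) : bracket (coord X i) (coord X l) =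
    (cgForm i l : MvPolynomial (Fin 9) ℤ) * (coord X i * coord X l) := by
  have hE := bracket_X_X
  have hskew : ∀ i l, cgForm i l = -cgForm l i := by decide
  have hdiag : ∀ i, cgForm i i = 0 := by decide
  have hself : ∀ i, bracket (coord X i) (coord X i) =
      (cgForm i i : MvPolynomial (Fin 9) ℤ) * (coord X i * coord X i) := fun i => by
    rw [bracket_self, hdiag, Int.cast_zero, zero_mul]
  have hsymm : ∀ i l, bracket (coord X l) (coord X i) =
      (cgForm l i : MvPolynomial (Fin 9) ℤ) * (coord X l * coord X i) →
      bracket (coord X i) (coord X l) =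
      (cgForm i l : MvPolynomial (Fin 9) ℤ) * (coord X i * coord X l) := fun i l h => by
    rw [bracket_skew, h, hskew i l, Int.cast_neg]; ring
  have h1 : ∀ i l : Fin 6, i < l → bracket (coord X (.inl i)) (coord X (.inl l)) =
      (cgForm (.inl i) (.inl l) : MvPolynomial (Fin 9) ℤ) *
        (coord X (.inl i) * coord X (.inl l)) := by
    intro i l h
    fin_cases i
    exacts [biderivation_coord_inl_0 hE l h, biderivation_coord_inl_1 hE l h,
      biderivation_coord_inl_2 hE l h, biderivation_coord_inl_3 hE l h,
      biderivation_coord_inl_4 hE l h, absurd h (by revert l; decide)]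
  have h2 : ∀ (i : Fin 6) (l : Fin 3), bracket (coord X (.inl i)) (coord X (.inr l)) =
      (cgForm (.inl i) (.inr l) : MvPolynomial (Fin 9) ℤ) *
        (coord X (.inl i) * coord X (.inr l)) := by
    intro i l
    fin_cases i
    exacts [biderivation_coord_inl_0_inr hE l, biderivation_coord_inl_1_inr hE l,
      biderivation_coord_inl_2_inr hE l, biderivation_coord_inl_3_inr hE l,
      biderivation_coord_inl_4_inr hE l, biderivation_coord_inl_5_inr hE l]
  have h3 : ∀ i l : Fin 3, i < l → bracket (coord X (.inr i)) (coord X (.inr l)) =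
      (cgForm (.inr i) (.inr l) : MvPolynomial (Fin 9) ℤ) *
        (coord X (.inr i) * coord X (.inr l)) := by
    intro i l h
    fin_cases i
    exacts [biderivation_coord_inr_0 hE l h, biderivation_coord_inr_1 hE l h,
      absurd h (by revert l; decide)]
  rcases i with i | i <;> rcases l with l | l
  · rcases lt_trichotomy i l with h | rfl | h
    exacts [h1 i l h, hself _, hsymm _ _ (h1 l i h)]
  · exact h2 i l
  · exact hsymm _ _ (h2 l i)
  · rcases lt_trichotomy i l with h | rfl | h
    exacts [h3 i l h, hself _, hsymm _ _ (h3 l i h)]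

end Bracket

/-! ### Propagation of log-canonicity and homogeneity under mutation. -/

namespace ExtSeed

/-- The vanishing pairing makes the two exchange monomials have equal weight, so applying `δ` to the
exchange relation and cancelling `c k` gives the weight of the new variable. The factor `m` covers
both uses: `m = 1` for the grading and `m = c l` for bracketing with `c l`. -/
lemma derivation_newVar {κ φ F A R : Type*} [Fintype κ] [Fintype φ] [DecidableEq κ]
    [DecidableEq φ] [Field F] [CommRing A] [CommRing R] [IsDomain R] [Algebra A R]
    {t : ExtSeed κ φ F} (δ : Derivation A R R) {c : κ ⊕ φ → R} {c' : R} {k : κ}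
    (hc : c (.inl k) * c' = binomial c (t.col k)) (h0 : c (.inl k) ≠ 0) {m : R} {w : κ ⊕ φ → ℤ}
    (hw : ∀ i, δ (c i) = (w i : R) * (m * c i)) (hs : ∑ i, t.b i k * w i = 0) :
    δ c' = (t.mutateWeight k w (.inl k) : R) * (m * c') := by
  apply mul_left_cancel₀ h0
  have h1 := congrArg δ hc
  have h2 := sum_toNat_mul (t.col k) w
  have hs' : ∑ i, t.col k i * w i = 0 := hs
  rw [hs', zero_add] at h2
  rw [Derivation.leibniz, hw, binomial, map_add, derivation_posMonomial δ c w m hw,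
    derivation_posMonomial δ c w m hw, ← h2, ← mul_add, ← mul_add, ← binomial, ← hc, smul_eq_mul,
    smul_eq_mul] at h1
  rw [mutateWeight, Function.update_self]
  change _ = _ * (((-w (.inl k) + ∑ i, ((t.col k i).toNat : ℤ) * w i : ℤ) : R) * _)
  rw [Int.cast_add, Int.cast_neg]
  linear_combination h1

variable {F : Type*} [Field F] {t : ExtSeed (Fin 6) (Fin 3) F} {v : Fin 9 → F}

/-- The extended cluster is given by polynomials `c` in the coordinates that are homogeneous for
the grading and log-canonical for the bracket. -/
structure IsCanonical (t : ExtSeed (Fin 6) (Fin 3) F) (v : Fin 9 → F)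
    (c : Fin 6 ⊕ Fin 3 → MvPolynomial (Fin 9) ℤ) (Λ : Fin 6 ⊕ Fin 3 → Fin 6 ⊕ Fin 3 → ℤ)
    (w : Fin 6 ⊕ Fin 3 → ℤ) : Prop where
  aeval_eq : ∀ i, aeval v (c i) = t.x i
  compatible : t.IsCompatible 2 Λ
  bracket_eq : ∀ i l, bracket (c i) (c l) = (Λ i l : MvPolynomial (Fin 9) ℤ) * (c i * c l)
  euler_eq : ∀ i, euler (c i) = (w i : MvPolynomial (Fin 9) ℤ) * c i
  sum_eq : ∀ j, ∑ i, t.b i j * w i = 0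

variable {c : Fin 6 ⊕ Fin 3 → MvPolynomial (Fin 9) ℤ} {Λ : Fin 6 ⊕ Fin 3 → Fin 6 ⊕ Fin 3 → ℤ}
  {w : Fin 6 ⊕ Fin 3 → ℤ}

lemma isCanonical_coord (hx : t.x = coord v) (hb : t.b = cgMatrix) :
    t.IsCanonical v (coord X) cgForm clusterWeight where
  aeval_eq i := by
    have h := map_coord (aeval (R := ℤ) v).toRingHom X i
    simp only [AlgHom.toRingHom_eq_coe, RingHom.coe_coe, aeval_X] at h
    rw [h, hx]
  compatible := isCompatible_of_b_eq hb
  bracket_eq := bracket_coord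
  euler_eq := euler_coord
  sum_eq j := by rw [hb]; exact sum_cgMatrix_mul_clusterWeight j

lemma IsCanonical.ne_zero (h : t.IsCanonical v c Λ w) (hg : t.IsGood) (i : Fin 6 ⊕ Fin 3) :
    c i ≠ 0 := fun h0 => hg.indep.ne_zero i (by rw [← h.aeval_eq, h0, map_zero])

lemma IsCanonical.mul_eq (h : t.IsCanonical v c Λ w) (hv : AlgebraicIndependent ℤ v)
    (hg : t.IsGood) {k : Fin 6} {a : MvPolynomial (Fin 9) ℤ} (ha : aeval v a = t.newVar k) :
    c (.inl k) * a = binomial c (t.col k) := by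
  apply hv
  rw [map_mul, h.aeval_eq, ha, x_mul_newVar hg.indep]
  have h1 := map_binomial (aeval (R := ℤ) v).toRingHom c (t.col k)
  simp only [AlgHom.toRingHom_eq_coe, RingHom.coe_coe, h.aeval_eq] at h1
  exact h1.symm

/-- For `l ≠ k`, compatibility says that column `k` of the exchange matrix pairs to zero with `Λ (·,
l)`, which is exactly the hypothesis of `derivation_newVar` for the bracket with `c l`. -/
lemma IsCanonical.mutate (h : t.IsCanonical v c Λ w) (hv : AlgebraicIndependent ℤ v)
    (hg : t.IsGood) {k : Fin 6} {a : MvPolynomial (Fin 9) ℤ} (ha : aeval v a = t.newVar k) :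
    (t.mutate k).IsCanonical v (Function.update c (.inl k) a) (t.mutateForm k Λ)
      (t.mutateWeight k w) := by
  have hmul := h.mul_eq hv hg ha
  have hcomp := h.compatible.mutate hg.skew k
  have hnew : ∀ l, l ≠ .inl k → bracket a (c l) =
      (t.mutateForm k Λ (.inl k) l : MvPolynomial (Fin 9) ℤ) * (a * c l) := by
    intro l hl
    have hs : ∑ i, t.b i k * -Λ i l = 0 := by
      simp only [mul_neg, Finset.sum_neg_distrib]
      rw [h.compatible.sum_eq, if_neg hl, neg_zero]
    have h1 := derivation_newVar (t := t) (bracket (c l)) hmul (h.ne_zero hg _) (m := c l)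
      (w := fun i => -Λ i l) (fun i => by
        rw [bracket_skew, h.bracket_eq]; push_cast; ring) hs
    rw [bracket_skew, h1, mutateForm, if_neg hl, mutateWeight, mutateWeight, Function.update_self,
      Function.update_self]
    simp only [mul_neg, Finset.sum_neg_distrib]
    push_cast
    ring
  refine ⟨fun i => ?_, hcomp, fun i l => ?_, fun i => ?_, fun j => ?_⟩
  · by_cases hi : i = .inl k
    · subst hi
      rw [Function.update_self, mutate_x_self, ha]
    · rw [Function.update_of_ne hi, mutate_x_of_ne hi, h.aeval_eq]
  · by_cases hi : i = .inl k
    · subst hi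
      rw [Function.update_self]
      by_cases hl : l = .inl k
      · subst hl
        have h0 := hcomp.skew (.inl k) (.inl k)
        have h0' : t.mutateForm k Λ (.inl k) (.inl k) = 0 := by omega
        rw [Function.update_self, bracket_self, h0', Int.cast_zero, zero_mul]
      · rw [Function.update_of_ne hl]
        exact hnew l hl
    · rw [Function.update_of_ne hi]
      by_cases hl : l = .inl k
      · subst hl
        rw [Function.update_self, bracket_skew, hnew i hi, hcomp.skew i]
        push_cast
        ring
      · rw [Function.update_of_ne hl, h.bracket_eq, mutateForm, if_neg hl, mutateWeight,
          Function.update_of_ne hi]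
  · by_cases hi : i = .inl k
    · subst hi
      have h1 := derivation_newVar (t := t) euler hmul (h.ne_zero hg _) (m := 1) (w := w)
        (fun i => by rw [h.euler_eq, one_mul]) (h.sum_eq k)
      rw [Function.update_self, h1, one_mul]
    · rw [Function.update_of_ne hi, h.euler_eq, mutateWeight, Function.update_of_ne hi]
  · rw [sum_mutate_mul hg.skew, h.sum_eq, h.sum_eq]
    simp

/-- Every new variable lies in the invariant upper bound, hence is again a polynomial in the
coordinates. -/
lemma IsCanonical.foldl (h : t.IsCanonical v c Λ w) (hv : AlgebraicIndependent ℤ v)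
    (hg : t.IsGood) (hub : ∀ f ∈ t.upperBound, ∃ a, f = aeval (R := ℤ) v a) (l : List (Fin 6)) :
    ∃ c Λ w, (l.foldl ExtSeed.mutate t).IsCanonical v c Λ w := by
  induction l generalizing t c Λ w with
  | nil => exact ⟨c, Λ, w, h⟩
  | cons k l ih =>
    obtain ⟨a, ha⟩ := hub _ (newVar_mem_upperBound hg k)
    exact ih (h.mutate hv hg ha.symm) (hg.mutate k) (by rwa [upperBound_mutate hg])

end ExtSeed

/-! ### Derivations nilpotent modulo a constant. -/

section LocallyNilpotent

variable {A R : Type*} [CommRing A] [CommRing R] [Algebra A R] {δ : Derivation A R R} {π : R}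

lemma dvd_derivation (hπ : δ π = 0) {a : R} (h : π ∣ a) : π ∣ δ a := by
  obtain ⟨b, rfl⟩ := h
  rw [Derivation.leibniz, hπ, smul_zero, add_zero]
  exact Dvd.intro _ rfl

lemma dvd_iterate_derivation (hπ : δ π = 0) {a : R} (h : π ∣ a) (M : ℕ) : π ∣ δ^[M] a := by
  induction M with
  | zero => exact h
  | succ M ih => rw [Function.iterate_succ_apply']; exact dvd_derivation hπ ih

lemma dvd_iterate_derivation_of_le (hπ : δ π = 0) {a : R} {M N : ℕ} (hMN : M ≤ N)
    (h : π ∣ δ^[M] a) : π ∣ δ^[N] a := by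
  obtain ⟨K, rfl⟩ := Nat.exists_eq_add_of_le' hMN
  rw [Function.iterate_add_apply]
  exact dvd_iterate_derivation hπ h K

/-- One application of Leibniz lowers the nilpotency exponent of one factor in each term, so
induction on `M + N` works. -/
lemma dvd_iterate_derivation_mul (hπ : δ π = 0) {a b : R} {M N : ℕ} (ha : π ∣ δ^[M] a)
    (hb : π ∣ δ^[N] b) : π ∣ δ^[M + N] (a * b) := by
  induction h : M + N generalizing a b M N with
  | zero =>
    obtain rfl : M = 0 := by omega
    exact ha.mul_right b
  | succ K ih =>
    rcases M with _ | M
    · exact dvd_iterate_derivation hπ (ha.mul_right b) _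
    rcases N with _ | N
    · exact dvd_iterate_derivation hπ (hb.mul_left a) _
    rw [Function.iterate_succ_apply, Derivation.leibniz, iterate_map_add, smul_eq_mul, smul_eq_mul]
    rw [Function.iterate_succ_apply] at ha hb
    refine dvd_add ?_ ?_
    · exact ih (M := M + 1) (by rwa [Function.iterate_succ_apply]) hb (by omega)
    · exact ih (M := N + 1) (by rwa [Function.iterate_succ_apply]) ha (by omega)

/-- The elements on which a derivation is nilpotent modulo a constant `π`. -/
def nilpotentModSubring (δ : Derivation A R R) {π : R} (hπ : δ π = 0) : Subring R where
  carrier := {a | ∃ M, π ∣ δ^[M] a}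
  zero_mem' := ⟨0, dvd_zero π⟩
  one_mem' := ⟨1, by simp⟩
  add_mem' := by
    rintro a b ⟨M, hM⟩ ⟨N, hN⟩
    refine ⟨max M N, ?_⟩
    rw [iterate_map_add]
    exact dvd_add (dvd_iterate_derivation_of_le hπ (le_max_left _ _) hM)
      (dvd_iterate_derivation_of_le hπ (le_max_right _ _) hN)
  neg_mem' := by
    rintro a ⟨M, hM⟩
    exact ⟨M, by rw [iterate_map_neg]; exact (dvd_neg).2 hM⟩
  mul_mem' := by
    rintro a b ⟨M, hM⟩ ⟨N, hN⟩
    exact ⟨_, dvd_iterate_derivation_mul hπ hM hN⟩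

lemma mem_nilpotentModSubring_of_derivation_mem (hπ : δ π = 0) {a : R}
    (h : δ a ∈ nilpotentModSubring δ hπ) : a ∈ nilpotentModSubring δ hπ := by
  obtain ⟨M, hM⟩ := h
  exact ⟨M + 1, by rwa [Function.iterate_succ_apply]⟩

lemma mem_nilpotentModSubring_of_dvd (hπ : δ π = 0) {a : R} (h : π ∣ δ a) :
    a ∈ nilpotentModSubring δ hπ := ⟨1, h⟩

/-- The elements which a derivation maps to multiples of `π`. -/
def constantModSubring (δ : Derivation A R R) (π : R) : Subring R where
  carrier := {a | π ∣ δ a}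
  zero_mem' := by simp
  one_mem' := by simp
  add_mem' := by
    intro a b ha hb
    change π ∣ δ _
    rw [map_add]
    exact dvd_add ha hb
  neg_mem' := by
    intro a ha
    change π ∣ δ _
    rw [map_neg]
    exact (dvd_neg).2 ha
  mul_mem' := by
    intro a b ha hb
    change π ∣ δ _
    rw [Derivation.leibniz]
    exact dvd_add (Dvd.dvd.mul_left hb a) (Dvd.dvd.mul_left ha b)

lemma dvd_iterate_derivation_mul_sub (hπ : δ π = 0) {ν : R} (hν : ν ∈ constantModSubring δ π)
    (a : R) (M : ℕ) : π ∣ δ^[M] (ν * a) - ν * δ^[M] a := by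
  induction M with
  | zero => simp
  | succ M ih =>
    have h1 := dvd_derivation hπ ih
    rw [map_sub, Derivation.leibniz δ ν, smul_eq_mul, smul_eq_mul] at h1
    rw [Function.iterate_succ_apply', Function.iterate_succ_apply']
    have h2 := dvd_add h1 (Dvd.dvd.mul_left (show π ∣ δ ν from hν) (δ^[M] a))
    refine h2.trans (dvd_of_eq ?_)
    ring

lemma dvd_iterate_two_mul_sub (hπ : δ π = 0) {q a : R} (hq : q ∈ constantModSubring δ π)
    (h : π ∣ δ (δ a) - q * a) (M : ℕ) : π ∣ δ^[2 * M] a - q ^ M * a := by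
  induction M with
  | zero => simp
  | succ M ih =>
    have h1 := dvd_iterate_derivation hπ ih 2
    rw [iterate_map_sub, ← Function.iterate_add_apply] at h1
    have h2 := dvd_iterate_derivation_mul_sub hπ (pow_mem hq M) a 2
    have h3 := Dvd.dvd.mul_left h (q ^ M)
    have h4 := dvd_add (dvd_add h1 h2) h3
    rw [show 2 * (M + 1) = 2 + 2 * M by ring]
    refine h4.trans (dvd_of_eq ?_)
    change δ^[2 + 2 * M] a - δ^[2] (q ^ M * a) + (δ^[2] (q ^ M * a) - q ^ M * δ (δ a)) +
      q ^ M * (δ (δ a) - q * a) = _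
    ring

/-- Modulo `π` both `ν` and `q` are constants, so `δ ^ (2 M)` sends `ν * a` to `ν * q ^ M * a`.
Nilpotency therefore turns into a divisibility. -/
lemma exists_dvd_mul_pow_mul (hπ : δ π = 0) {ν q a : R} (hν : ν ∈ constantModSubring δ π)
    (hq : q ∈ constantModSubring δ π) (h : π ∣ δ (δ a) - q * a)
    (ha : ν * a ∈ nilpotentModSubring δ hπ) : ∃ M : ℕ, π ∣ ν * (q ^ M * a) := by
  obtain ⟨M, hM⟩ := ha
  refine ⟨M, ?_⟩
  have h1 := dvd_iterate_derivation_of_le hπ (show M ≤ 2 * M by omega) hM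
  have h2 := dvd_iterate_derivation_mul_sub hπ hν a (2 * M)
  have h3 := Dvd.dvd.mul_left (dvd_iterate_two_mul_sub hπ hq h M) ν
  have h4 := dvd_sub (dvd_sub h1 h2) h3
  refine h4.trans (dvd_of_eq ?_)
  ring

end LocallyNilpotent

/-! ### Weight `11` contains a single monomial. -/

section Grading

lemma coeff_euler (m : Fin 9 →₀ ℕ) (a : MvPolynomial (Fin 9) ℤ) :
    MvPolynomial.coeff m (euler a) = (∑ i, (m i : ℤ) * coordWeight i) * MvPolynomial.coeff m a := by
  induction a using MvPolynomial.induction_on' with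
  | monomial u r =>
    have h1 : (monomial u r : MvPolynomial (Fin 9) ℤ) =
        (r : MvPolynomial (Fin 9) ℤ) * posMonomial X (fun i => (u i : ℤ)) := by
      rw [monomial_eq, Finsupp.prod_fintype _ _ fun _ => pow_zero _, posMonomial, eq_intCast]
      simp
    have h2 := derivation_posMonomial euler X coordWeight 1
      (fun i => by rw [one_mul, euler, mkDerivation_X]) (fun i => (u i : ℤ))
    have h3 : euler (monomial u r) =
        C (∑ i, (u i : ℤ) * coordWeight i) * monomial u r := by
      rw [h1, ← zsmul_eq_mul, map_zsmul, h2, zsmul_eq_mul, one_mul, eq_intCast]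
      simp only [Int.toNat_natCast]
      ring
    rw [h3, coeff_C_mul, MvPolynomial.coeff_monomial]
    split_ifs with h
    · rw [h]
    · simp
  | add p q hp hq => rw [map_add, MvPolynomial.coeff_add, MvPolynomial.coeff_add, hp, hq]; ring

/-- All coordinate weights are at least `6`, so a monomial of weight `11` has degree one, and `X 7`
is the only coordinate of that weight. -/
lemma eq_C_mul_X_of_euler_eq {a : MvPolynomial (Fin 9) ℤ} {n : ℤ}
    (ha : euler a = (n : MvPolynomial (Fin 9) ℤ) * a)
    (h7 : MvPolynomial.coeff (Finsupp.single 7 1) a ≠ 0) :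
    a = C (MvPolynomial.coeff (Finsupp.single 7 1) a) * X 7 := by
  have h : ∀ m, MvPolynomial.coeff m a ≠ 0 → ∑ i, (m i : ℤ) * coordWeight i = n := by
    intro m hm
    apply mul_right_cancel₀ hm
    rw [← coeff_euler, ha, ← eq_intCast (C : ℤ →+* MvPolynomial (Fin 9) ℤ), coeff_C_mul]
  have hn := h _ h7
  rw [Finset.sum_eq_single 7 (by intro i _ hi; simp [hi.symm]) (by simp)] at hn
  ext m
  rw [coeff_C_mul, coeff_X]
  split_ifs with hm
  · rw [← hm, mul_one]
  · rw [mul_zero]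
    by_contra h0
    have h1 := h m h0
    rw [← hn] at h1
    simp [Fin.sum_univ_succ, coordWeight] at h1
    have h2 : m 0 = 0 ∧ m 1 = 0 ∧ m 2 = 0 ∧ m 3 = 0 ∧ m 4 = 0 ∧ m 5 = 0 ∧ m 6 = 0 ∧ m 7 = 1 ∧
        m 8 = 0 := by
      have b0 : m 0 ≤ 1 := by omega
      have b4 : m 4 ≤ 1 := by omega
      have b5 : m 5 ≤ 1 := by omega
      have b6 : m 6 ≤ 1 := by omega
      interval_cases m 0 <;> interval_cases m 4 <;> interval_cases m 5 <;> interval_cases m 6 <;>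
        omega
    obtain ⟨m0, m1, m2, m3, m4, m5, m6, m7, m8⟩ := h2
    apply hm
    ext i
    fin_cases i <;> simp [m0, m1, m2, m3, m4, m5, m6, m7, m8]

end Grading

/-! ### No cluster variable is an integer multiple of `g`. -/

namespace ExtSeed

variable {F : Type*} [Field F] {t : ExtSeed (Fin 6) (Fin 3) F} {v : Fin 9 → F}
  {c : Fin 6 ⊕ Fin 3 → MvPolynomial (Fin 9) ℤ} {Λ : Fin 6 ⊕ Fin 3 → Fin 6 ⊕ Fin 3 → ℤ}
  {w : Fin 6 ⊕ Fin 3 → ℤ}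

/-- Every polynomial lying in the Laurent rings of a seed and of its neighbour in direction `k`
is, up to a monomial in the other variables, annihilated modulo `c k` by a power of the Hamiltonian
derivation of `c k`. -/
lemma IsCanonical.exists_mul_mem_nilpotentModSubring (h : t.IsCanonical v c Λ w)
    (hv : AlgebraicIndependent ℤ v) (hg : t.IsGood)
    (hub : ∀ f ∈ t.upperBound, ∃ a, f = aeval (R := ℤ) v a) {k : Fin 6}
    {a : MvPolynomial (Fin 9) ℤ} (ha : aeval v a ∈ t.upperBound) :
    ∃ N : ℕ, (∏ j ∈ Finset.univ.erase k, c (.inl j)) ^ N * a ∈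
      nilpotentModSubring (bracket (c (.inl k))) (bracket_self (c (.inl k))) := by
  set δ := bracket (c (.inl k)) with hδ
  set T := nilpotentModSubring δ (bracket_self (c (.inl k))) with hT
  have hdvd : ∀ i, c (.inl k) ∣ δ (c i) := fun i => by
    rw [hδ, h.bracket_eq]
    exact ⟨(Λ (.inl k) i : MvPolynomial (Fin 9) ℤ) * c i, by ring⟩
  have hcT : ∀ i, c i ∈ T := fun i => mem_nilpotentModSubring_of_dvd _ (hdvd i)
  obtain ⟨a', ha'⟩ := hub _ (newVar_mem_upperBound hg k)
  have hmul := h.mul_eq hv hg ha'.symm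
  -- Since `δ (c k) = 0`, dividing the derivative of the exchange relation by `c k` writes `δ a'` as
  -- a combination of monomials in the cluster, which `δ` kills modulo `c k`.
  have ha'T : a' ∈ T := by
    apply mem_nilpotentModSubring_of_derivation_mem
    have h1 : δ a' = ((∑ i, ((t.col k i).toNat : ℤ) * Λ (.inl k) i : ℤ) :
          MvPolynomial (Fin 9) ℤ) * posMonomial c (t.col k) +
        ((∑ i, (((-t.col k) i).toNat : ℤ) * Λ (.inl k) i : ℤ) :
          MvPolynomial (Fin 9) ℤ) * posMonomial c (-t.col k) := by
      apply mul_left_cancel₀ (h.ne_zero hg (.inl k))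
      have h2 := congrArg δ hmul
      have hw : ∀ i, δ (c i) =
          (Λ (.inl k) i : MvPolynomial (Fin 9) ℤ) * (c (.inl k) * c i) := h.bracket_eq _
      rw [Derivation.leibniz, bracket_self, smul_zero, add_zero, binomial, map_add,
        derivation_posMonomial δ c _ _ hw, derivation_posMonomial δ c _ _ hw, smul_eq_mul] at h2
      rw [h2]
      ring
    rw [h1]
    exact add_mem (mul_mem (intCast_mem _ _) (posMonomial_mem _ _ _ fun i _ => hcT i))
      (mul_mem (intCast_mem _ _) (posMonomial_mem _ _ _ fun i _ => hcT i))
  rw [mem_upperBound] at ha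
  obtain ⟨N, g, g', hgg⟩ := exists_eq_aeval_add_aeval hg.indep hg.skew ha.1 (ha.2 k)
  let V : Subring F := T.map (aeval (R := ℤ) v).toRingHom
  have hmemV : ∀ b ∈ T, aeval (R := ℤ) v b ∈ V := fun b hb => ⟨b, hb, rfl⟩
  have haeval : ∀ (y : F) (p : Polynomial (t.coreRing k)), y ∈ V →
      Polynomial.aeval y p ∈ V := by
    intro y p hy
    rw [Polynomial.aeval_eq_sum_range]
    refine sum_mem fun i _ => ?_
    rw [Algebra.smul_def]
    refine mul_mem (mem_of_mem_coreRing (t := t) (fun i _ => ?_) (p.coeff i).2) (pow_mem hy i)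
    rw [← h.aeval_eq]
    exact hmemV _ (hcT i)
  have hsum := add_mem (haeval _ g (h.aeval_eq (.inl k) ▸ hmemV _ (hcT _)))
    (haeval _ g' (ha' ▸ hmemV _ ha'T))
  rw [← hgg] at hsum
  obtain ⟨b, hb, hb'⟩ := hsum
  refine ⟨N, ?_⟩
  have : (∏ j ∈ Finset.univ.erase k, c (.inl j)) ^ N * a = b := by
    apply hv
    refine Eq.trans ?_ hb'.symm
    rw [map_mul, map_pow, map_prod, mul_comm]
    simp only [h.aeval_eq]
  rw [this]
  exact hb

/-- The test element is `f = X 6`: modulo `n g`, the square of the Hamiltonian derivation multiplies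
it by the constant `4 n² r r'`, which is incompatible with nilpotency. -/
lemma IsCanonical.ne_C_mul_X (h : t.IsCanonical v c Λ w) (hv : AlgebraicIndependent ℤ v)
    (hg : t.IsGood) (hub : ∀ f ∈ t.upperBound, ∃ a, f = aeval (R := ℤ) v a)
    (hub' : ∀ a, aeval (R := ℤ) v a ∈ t.upperBound) {k : Fin 6} {n : ℤ} (hn : n ≠ 0) :
    c (.inl k) ≠ C n * X 7 := by
  intro hk
  obtain ⟨N, hN⟩ := h.exists_mul_mem_nilpotentModSubring hv hg hub (k := k) (hub' (X 6))
  set δ := bracket (c (.inl k)) with hδ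
  have hX : ∀ i, δ (X i) = C n * bracketTable X 7 i := fun i => by
    rw [hδ, hk, ← algebraMap_eq, Derivation.leibniz, Derivation.map_algebraMap, smul_zero, add_zero,
      Derivation.smul_apply, bracket_X_X, smul_eq_mul]
  have hdvd : ∀ i, c i ∈ constantModSubring δ (c (.inl k)) := fun i => by
    change _ ∣ δ _
    rw [hδ, h.bracket_eq]
    exact ⟨(Λ (.inl k) i : MvPolynomial (Fin 9) ℤ) * c i, by ring⟩
  have hC : ∀ m : ℤ, (C m : MvPolynomial (Fin 9) ℤ) ∈ constantModSubring δ (c (.inl k)) :=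
    fun m => by rw [eq_intCast C m]; exact intCast_mem _ m
  set q : MvPolynomial (Fin 9) ℤ := C (4 * n ^ 2) * (X 2 * X 5) with hq
  have h2 : δ (X 2) = 0 := by rw [hX]; simp [bracketTable, bracketTableAux]
  have h5 : δ (X 5) = 0 := by rw [hX]; simp [bracketTable, bracketTableAux]
  have hqS : q ∈ constantModSubring δ (c (.inl k)) := by
    refine mul_mem (hC _) (mul_mem ?_ ?_)
    · change _ ∣ δ _
      rw [h2]; exact dvd_zero _
    · change _ ∣ δ _
      rw [h5]; exact dvd_zero _
  have h66 : c (.inl k) ∣ δ (δ (X 6)) - q * X 6 := by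
    have h0 : δ (X 0) = C n * (X 0 * X 7) := by
      rw [hX]; simp [bracketTable, bracketTableAux]
    have h1 : δ (X 1) = C n * (2 * X 2 * X 6 - X 1 * X 7) := by
      rw [hX]; simp [bracketTable, bracketTableAux]
    have h7 : δ (X 7) = 0 := by rw [hX]; simp [bracketTable]
    have h6 : δ (X 6) = n • (2 • (X 0 * X 2) + 2 • (X 1 * X 5) + X 6 * X 7) := by
      rw [hX]; simp [bracketTable, bracketTableAux]; ring
    refine ⟨C n * (4 * X 0 * X 2 + X 6 * X 7), ?_⟩
    rw [hk, h6]
    simp only [map_zsmul, map_nsmul, map_add, Derivation.leibniz, h0, h1, h2, h5, h6, h7, hq]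
    simp
    ring
  obtain ⟨M, d, hd⟩ := exists_dvd_mul_pow_mul (bracket_self (c (.inl k)))
    (pow_mem (prod_mem fun j _ => hdvd (.inl j)) N) hqS h66 hN
  have hx0 := hg.indep.ne_zero
  -- The divisibility holds only after multiplication by a monomial in the other cluster variables.
  -- That monomial is invertible in the Laurent ring of `t.mutate k`; in all the other rings `x k`
  -- itself is invertible.
  have hy : aeval v (q ^ M * X 6) / t.x (.inl k) ∈ t.upperBound := by
    have hqM := hub' (q ^ M * X 6)
    rw [mem_upperBound] at hqM ⊢
    constructor
    · rw [div_eq_mul_inv]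
      exact mul_mem hqM.1 (inv_x_mem_laurent k)
    · intro j
      by_cases hj : j = k
      · subst hj
        have hd' := congrArg (aeval v) hd
        have h1 : aeval v (q ^ M * X 6) / t.x (.inl j) =
            aeval v d * ((∏ i ∈ Finset.univ.erase j, t.x (.inl i))⁻¹) ^ N := by
          rw [map_mul (aeval v) _ (q ^ M * X 6), map_mul (aeval v) _ d, map_pow, map_prod] at hd'
          simp only [h.aeval_eq] at hd'
          have h0 : ∏ i ∈ Finset.univ.erase j, t.x (.inl i) ≠ 0 :=
            Finset.prod_ne_zero_iff.2 fun i _ => hx0 _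
          rw [div_eq_iff (hx0 _), inv_pow]
          field_simp
          linear_combination hd'
        rw [h1]
        refine mul_mem ((mem_upperBound.1 (hub' d)).2 j) (pow_mem ?_ N)
        rw [← Finset.prod_inv_distrib]
        refine prod_mem fun i hi => ?_
        have h2 := inv_x_mem_laurent (t := t.mutate j) i
        rwa [mutate_x_of_ne (by simpa using Finset.ne_of_mem_erase hi)] at h2
      · have h2 := inv_x_mem_laurent (t := t.mutate j) k
        rw [mutate_x_of_ne (by simpa using Ne.symm hj)] at h2
        rw [div_eq_mul_inv]
        exact mul_mem (hqM.2 j) h2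
  obtain ⟨b, hb⟩ := hub _ hy
  rw [div_eq_iff (hx0 _), ← h.aeval_eq, ← map_mul] at hb
  -- At `g = 0` with all other coordinates `1`, a multiple of `g` vanishes, whereas `q ^ M * X 6`
  -- takes the value `(4 n²) ^ M`.
  have hb' := congrArg (eval fun i => if i = 7 then (0 : ℤ) else 1) (hv hb)
  simp [hk, hq, hn] at hb'

end ExtSeed

/-! ### Strictness over the polynomial ground ring. -/

section Strict

variable {F : Type*} [Field F] [Algebra (ZP (Trop 3)) F] {s : Seed 6 (Trop 3) F} {v : Fin 9 → F}

/-- The polynomials without linear term in the variable `X 7`. -/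
def withoutLinearTerm : Subring (MvPolynomial (Fin 9) ℤ) where
  carrier := {a | MvPolynomial.coeff (Finsupp.single 7 1) a = 0}
  zero_mem' := by simp
  one_mem' := by
    change MvPolynomial.coeff _ _ = 0
    rw [MvPolynomial.coeff_one, if_neg (Ne.symm (by simp))]
  add_mem' := by
    intro a b ha hb
    change MvPolynomial.coeff _ _ = 0
    rw [MvPolynomial.coeff_add, show _ = _ from ha, show _ = _ from hb, add_zero]
  neg_mem' := by
    intro a ha
    change MvPolynomial.coeff _ _ = 0
    rw [MvPolynomial.coeff_neg, show _ = _ from ha, neg_zero]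
  mul_mem' := by
    intro a b ha hb
    change MvPolynomial.coeff _ _ = 0
    -- A linear coefficient of a product pairs the constant term of one factor with the linear term
    -- of the other.
    rw [MvPolynomial.coeff_mul, Finsupp.antidiagonal_single, Finset.sum_map,
      Finset.Nat.sum_antidiagonal_eq_sum_range_succ_mk, Finset.sum_range_succ,
      Finset.sum_range_one]
    have ha' : MvPolynomial.coeff (Finsupp.single 7 1) a = 0 := ha
    have hb' : MvPolynomial.coeff (Finsupp.single 7 1) b = 0 := hb
    simp [ha', hb']

/-- The coordinate `g` lies in the upper cluster algebra, while all cluster variables and all frozen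
variables lie in the subring of polynomials without linear term in `g`. -/
lemma clusterAlgebra_lt_upperClusterAlgebra_ZPplus (hv : AlgebraicIndependent ℤ v)
    (hg : s.toExt.IsGood) (hx : s.toExt.x = coord v) (hb : s.toExt.b = cgMatrix) :
    s.clusterAlgebra (ZPplus 3) < s.upperClusterAlgebra (ZPplus 3) := by
  refine lt_of_le_of_ne (Seed.clusterAlgebra_le_upperClusterAlgebra_ZPplus hg) fun heq => ?_
  have h7 : v 7 ∈ s.clusterAlgebra (ZPplus 3) := by
    rw [heq, Seed.mem_upperClusterAlgebra_ZPplus hg]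
    exact ExtSeed.coordinate_mem_upperBound hg hx hb 7
  have hub : ∀ f ∈ s.toExt.upperBound, ∃ a, f = aeval (R := ℤ) v a := fun f hf =>
    ExtSeed.upperBound_le_range hg hv hx hb hf
  let V : Subring F := withoutLinearTerm.map (aeval (R := ℤ) v).toRingHom
  have hV : ∀ f ∈ s.clusterAlgebra (ZPplus 3), f ∈ V := by
    intro f hf
    induction hf using Algebra.adjoin_induction with
    | mem y hy =>
      obtain ⟨l, i, rfl⟩ := Seed.mem_clusterVariables.1 hy
      obtain ⟨c, Λ, w, h⟩ := (ExtSeed.isCanonical_coord hx hb).foldl hv hg hub l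
      rw [← h.aeval_eq]
      refine ⟨c (.inl i), ?_, rfl⟩
      by_contra h0
      exact h.ne_C_mul_X hv (hg.foldl l) (by rwa [ExtSeed.upperBound_foldl hg])
        (fun a => by
          rw [ExtSeed.upperBound_foldl hg]
          exact ExtSeed.aeval_mem_upperBound hg hx hb a) h0
        (eq_C_mul_X_of_euler_eq (h.euler_eq _) h0)
    | algebraMap r =>
      obtain ⟨r, hr⟩ := r
      change algebraMap (ZP (Trop 3)) F r ∈ V
      have h1 : ZPplus 3 ≤ V.comap (algebraMap (ZP (Trop 3)) F) := by
        rw [ZPplus, Subring.closure_le]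
        rintro _ ⟨j, rfl⟩
        have hz := (ExtSeed.isCanonical_coord hx hb).aeval_eq (.inr j)
        refine ⟨coord X (.inr j), ?_, hz⟩
        change MvPolynomial.coeff _ _ = 0
        by_contra h0
        -- A point with `g = 0` at which none of the three frozen variables vanishes, so none of
        -- them is a multiple of `g`.
        have h2 := congrArg (eval ![1, 1, 1, 0, 0, 1, 1, 0, 1])
          (eq_C_mul_X_of_euler_eq (euler_coord _) h0)
        rw [eval_coord, map_mul, eval_X] at h2
        have h3 : ∀ j, coord (![1, 1, 1, 0, 0, 1, 1, 0, 1] : Fin 9 → ℤ) (.inr j) ≠ 0 := by decide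
        exact h3 j (h2.trans (mul_zero _))
      exact h1 hr
    | add f g _ _ hf hg => exact add_mem hf hg
    | mul f g _ _ hf hg => exact mul_mem hf hg
  obtain ⟨a, ha, ha'⟩ := hV _ h7
  have h1 : a = X 7 := hv (by rw [aeval_X]; exact ha')
  rw [h1] at ha
  have h2 : MvPolynomial.coeff (Finsupp.single 7 1) (X 7 : MvPolynomial (Fin 9) ℤ) = 0 := ha
  rw [MvPolynomial.coeff_X] at h2
  simp at h2

end Strict

end ClusterAlgebra

theorem proposition4p1 {F : Type*} [Field F]
    [Algebra (ClusterAlgebra.ZP (ClusterAlgebra.Trop 3)) F]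
    (hF : Function.Injective (algebraMap (ClusterAlgebra.ZP (ClusterAlgebra.Trop 3)) F))
    (x : Fin 6 → F) (hx : (ClusterAlgebra.cremmerGervaisSeed x).IsSeed) :
    (ClusterAlgebra.cremmerGervaisSeed x).clusterAlgebra ⊤ =
        (ClusterAlgebra.cremmerGervaisSeed x).upperClusterAlgebra ⊤ ∧
      (ClusterAlgebra.cremmerGervaisSeed x).clusterAlgebra (ClusterAlgebra.ZPplus 3) <
        (ClusterAlgebra.cremmerGervaisSeed x).upperClusterAlgebra (ClusterAlgebra.ZPplus 3) := by
  have hind := ClusterAlgebra.Seed.algebraicIndependent_toExt hF hx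
  have hb := ClusterAlgebra.toExt_cremmerGervaisSeed_b x
  have hg := ClusterAlgebra.isGood_of_eq hb hind
  obtain ⟨v, hv, hxv⟩ := ClusterAlgebra.exists_algebraicIndependent_coord hind
  exact ⟨ClusterAlgebra.clusterAlgebra_eq_upperClusterAlgebra_top hv hg hxv hb,
    ClusterAlgebra.clusterAlgebra_lt_upperClusterAlgebra_ZPplus hv hg hxv hb⟩
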